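/- **Conventions.** $[N]$ is a range of $N$ integers; positions, symbols and elements of $[N]$ are counted from $0$. Algorithms run on a randomized word RAM with words of $\kappa w = O(w)$ bits, where $\kappa\ge 1$ is an absolute constant: in one step it performs a basic arithmetic or bitwise operation on words, a comparison, a memory access, a read of a symbol of a read-only input, the drawing of a uniformly random word, or (where allowed) one oracle call. All parameters of the problem fit in $O(1)$ words; specifically, $\mathrm{err}\le w$ and $n\le 2^w$. Space is counted in words, without the read-only inputs. All algorithms and all constants hidden in $O(\cdot)$ and $\mathrm{poly}(\cdot)$ are absolute (independent of $\ell,\tau,n,m,\sigma,\mathrm{err},w$ and of the strings). For $R\in\Sigma^m$ and $T\in\Sigma^{3n}$, an answer to the *core-matching query* $T$ on $R$ is a position $i$ at which the central third $T[n\,..\,2n)$ occurs in $R$, i.e. $R[i\,..\,i+n)=T[n\,..\,2n)$; if $T$ does not occur in $R$, a special failure symbol may be returned instead. *Inverting* a function $f:[N]\to[N]$ at $y\in[N]$ means obtaining an arbitrary element of $f^{-1}(y)$, or the information that $f^{-1}(y)=\emptyset$. **Theorem.** Let $\ell\ge 0$ and $\tau\ge 1$ be integers, and let $n=2^\ell\cdot\tau$.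 Given random access to a reference $R\in\Sigma^m$, $m\ge 1$, over an alphabet $\Sigma$ of $\sigma$ integers, and an integer parameter $\mathrm{err}\ge\max(1,\log_2(m\sigma))$, one can compute and store, in worst-case $O(\mathrm{poly}(\mathrm{err}))$ time, a sequence of functions such that, with probability at least $1-2^{-\mathrm{err}}$ over the random words drawn, all of the following holds. 1. There are $O(\mathrm{err})$ functions. All of them have domain and co-domain $[N]$ for a common $N=O(m\cdot\mathrm{err}/n)$. Each is stored in $O(\mathrm{err})$ space and, given random access to $R$ and to its stored description, can be evaluated at any point of $[N]$ deterministically in $O(n\cdot\mathrm{err})$ time and $O(\mathrm{err})$ additional working space. 2. Every core-matching query $T\in\Sigma^{3n}$ on $R$ can be reduced to inverting each of the functions at most once: given random access to $R$, $T$ and the stored functions, and an oracle that inverts the functions (choosing preimages arbitrarily), a deterministic algorithm that asks for at most one inversion of each function answers the query correctly in $O(n\cdot\mathrm{err})$ time, where an oracle call takes one step, and $O(\mathrm{err})$ additional working space. -/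

import Mathlib

namespace WordRAM

/-- Binary word operations. -/
inductive Op where
  | add | sub | mul | div | mod | lt | eq | and | or | xor | shl | shr

/-- Value of an operation on words of `W` bits; arithmetic is modulo `2 ^ W`, comparisons
return `0` or `1`, and `x / 0 = 0`, `x % 0 = x`. -/
def Op.eval (W : ℕ) : Op → ℕ → ℕ → ℕ
  | .add, a, b => (a + b) % 2 ^ W
  | .sub, a, b => (a + (2 ^ W - b)) % 2 ^ W
  | .mul, a, b => (a * b) % 2 ^ W
  | .div, a, b => a / b
  | .mod, a, b => a % b
  | .lt, a, b => if a < b then 1 else 0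
  | .eq, a, b => if a = b then 1 else 0
  | .and, a, b => a &&& b
  | .or, a, b => a ||| b
  | .xor, a, b => a ^^^ b
  | .shl, a, b => (a * 2 ^ b) % 2 ^ W
  | .shr, a, b => a / 2 ^ b

/-- Structured word-RAM programs. Arguments named `d e a b` are (numbers of) registers; a program
mentions only finitely many of them. -/
inductive Cmd where
  /-- do nothing -/
  | skip
  /-- `d := v` -/
  | const (d v : ℕ)
  /-- `d := a o b` -/
  | op (o : Op) (d a b : ℕ)
  /-- `d := mem[a]` -/
  | load (d a : ℕ)
  /-- `mem[a] := b` -/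
  | store (a b : ℕ)
  /-- `d := ref[a]`, read-only -/
  | readRef (d a : ℕ)
  /-- `d := data[a]`, read-only -/
  | readData (d a : ℕ)
  /-- `d := text[a]`, read-only -/
  | readText (d a : ℕ)
  /-- `d :=` a fresh random word -/
  | rand (d : ℕ)
  /-- ask the oracle for the pair of the contents of `a` and `b`; `d := 1` and `e := x` if it
  answers `x`, and `d := 0` and `e := 0` if it answers that there is none -/
  | query (d e a b : ℕ)
  /-- sequential composition -/
  | seq (p q : Cmd)
  /-- run `p` if `a` is nonzero, and `q` otherwise -/
  | ite (a : ℕ) (p q : Cmd)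
  /-- run `p` as long as `a` is nonzero -/
  | loop (a : ℕ) (p : Cmd)

/-- The surroundings in which a program runs. -/
structure Machine where
  /-- number of bits of a word -/
  width : ℕ
  /-- number of cells of the working memory -/
  space : ℕ
  /-- read-only array holding the reference -/
  ref : ℕ → ℕ
  /-- read-only array holding previously stored data -/
  data : ℕ → ℕ
  /-- read-only array holding the text -/
  text : ℕ → ℕ
  /-- the sequence of random words -/
  coins : ℕ → ℕ
  /-- the oracle -/
  oracle : ℕ → ℕ → Option ℕ

/-- Registers, working memory, number of random words used, list of oracle queries asked. -/
structure State where
  reg : ℕ → ℕ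
  mem : ℕ → ℕ
  used : ℕ
  asked : List (ℕ × ℕ)

/-- Assign a register. -/
def State.set (s : State) (d v : ℕ) : State := { s with reg := Function.update s.reg d v }

/-- The state at the start: the registers `0, 1, 2, …` hold the listed numbers, and all other
registers and the working memory are zero. -/
def State.init (l : List ℕ) : State where
  reg i := l.getD i 0
  mem _ := 0
  used := 0
  asked := []

/-- `Exec M p s t s'`: on `M`, program `p` started in state `s` halts in state `s'` after `t`
steps. There is no rule for an access outside the `M.space` cells of the working memory. -/
inductive Exec (M : Machine) : Cmd → State → ℕ → State → Prop
  | skip (s : State) : Exec M .skip s 1 s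
  | const (s : State) (d v : ℕ) : Exec M (.const d v) s 1 (s.set d (v % 2 ^ M.width))
  | op (s : State) (o : Op) (d a b : ℕ) :
      Exec M (.op o d a b) s 1 (s.set d (o.eval M.width (s.reg a) (s.reg b)))
  | load (s : State) (d a : ℕ) (h : s.reg a < M.space) :
      Exec M (.load d a) s 1 (s.set d (s.mem (s.reg a)))
  | store (s : State) (a b : ℕ) (h : s.reg a < M.space) :
      Exec M (.store a b) s 1 { s with mem := Function.update s.mem (s.reg a) (s.reg b) }
  | readRef (s : State) (d a : ℕ) : Exec M (.readRef d a) s 1 (s.set d (M.ref (s.reg a)))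
  | readData (s : State) (d a : ℕ) : Exec M (.readData d a) s 1 (s.set d (M.data (s.reg a)))
  | readText (s : State) (d a : ℕ) : Exec M (.readText d a) s 1 (s.set d (M.text (s.reg a)))
  | rand (s : State) (d : ℕ) :
      Exec M (.rand d) s 1 { s.set d (M.coins s.used) with used := s.used + 1 }
  | query_some (s : State) (d e a b x : ℕ) (h : M.oracle (s.reg a) (s.reg b) = some x) :
      Exec M (.query d e a b) s 1
        { (s.set d 1).set e x with asked := (s.reg a, s.reg b) :: s.asked }
  | query_none (s : State) (d e a b : ℕ) (h : M.oracle (s.reg a) (s.reg b) = none) :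
      Exec M (.query d e a b) s 1
        { (s.set d 0).set e 0 with asked := (s.reg a, s.reg b) :: s.asked }
  | seq {p q : Cmd} {s s₁ s₂ : State} {t₁ t₂ : ℕ} :
      Exec M p s t₁ s₁ → Exec M q s₁ t₂ s₂ → Exec M (.seq p q) s (t₁ + t₂) s₂
  | ite_true {a : ℕ} {p q : Cmd} {s s₁ : State} {t : ℕ} :
      s.reg a ≠ 0 → Exec M p s t s₁ → Exec M (.ite a p q) s (t + 1) s₁
  | ite_false {a : ℕ} {p q : Cmd} {s s₁ : State} {t : ℕ} :
      s.reg a = 0 → Exec M q s t s₁ → Exec M (.ite a p q) s (t + 1) s₁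
  | loop_done {a : ℕ} {p : Cmd} {s : State} :
      s.reg a = 0 → Exec M (.loop a p) s 1 s
  | loop_step {a : ℕ} {p : Cmd} {s s₁ s₂ : State} {t₁ t₂ : ℕ} :
      s.reg a ≠ 0 → Exec M p s t₁ s₁ → Exec M (.loop a p) s₁ t₂ s₂ →
      Exec M (.loop a p) s (t₁ + t₂ + 1) s₂

/-- Started with the numbers `l` in its first registers, `p` halts within `time` steps in a state
that satisfies `Q`. -/
def Halts (M : Machine) (p : Cmd) (l : List ℕ) (time : ℕ) (Q : State → Prop) : Prop :=
  ∃ t s, Exec M p (State.init l) t s ∧ t ≤ time ∧ Q s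

/-- The probability of an event when `L` words of `W` bits are drawn independently and uniformly
at random. -/
noncomputable def prob (L W : ℕ) (P : (Fin L → Fin (2 ^ W)) → Prop) : ℝ :=
  (Nat.card {ω // P ω} : ℝ) / Nat.card (Fin L → Fin (2 ^ W))

end WordRAM

namespace CoreMatching

open WordRAM

/-- A string (or a sequence of random words) as an array, padded with zeros. Positions and symbols
are counted from `0`. -/
def toArray {a b : ℕ} (X : Fin a → Fin b) (i : ℕ) : ℕ :=
  if h : i < a then (X ⟨i, h⟩ : ℕ) else 0

/-- `P` occurs in `X` at position `i`. -/
def OccursAt {a b σ : ℕ} (P : Fin a → Fin σ) (X : Fin b → Fin σ) (i : ℕ) : Prop :=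
  ∃ h : i + a ≤ b, ∀ j : Fin a, X ⟨i + j, by omega⟩ = P j

/-- The central third of a text of length `3 * n`. -/
def core {n σ : ℕ} (T : Fin (3 * n) → Fin σ) : Fin n → Fin σ :=
  fun j => T ⟨n + j, by omega⟩

/-- Correct answers to a core-matching query: an occurrence in `R` of the central third of `T`, or,
if `T` does not occur in `R`, possibly the failure symbol `none`. -/
def IsAnswer {m n σ : ℕ} (R : Fin m → Fin σ) (T : Fin (3 * n) → Fin σ) : Option ℕ → Prop
  | some i => OccursAt (core T) R i
  | none => ∀ i, ¬ OccursAt T R i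

/-- `inv i y` is some preimage of `y` under `f i`, or `none` if there is no preimage; nothing is
assumed about its values outside the range of the indices. -/
def IsInverter {k N : ℕ} (f : Fin k → Fin N → Fin N) (inv : ℕ → ℕ → Option ℕ) : Prop :=
  ∀ (i : Fin k) (y : Fin N),
    match inv i y with
    | some x => ∃ h : x < N, f i ⟨x, h⟩ = y
    | none => ∀ x, f i x ≠ y

/-- The machine for the construction: random words, access to `R`, no oracle. -/
def buildMachine {m σ L W : ℕ} (space : ℕ) (R : Fin m → Fin σ) (ω : Fin L → Fin (2 ^ W)) :
    Machine where
  width := W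
  space := space
  ref := toArray R
  data _ := 0
  text _ := 0
  coins := toArray ω
  oracle _ _ := none

/-- The machine for evaluating a function that is stored in `data`: access to `R`, no randomness,
no oracle. -/
def evalMachine {m σ : ℕ} (W space : ℕ) (R : Fin m → Fin σ) (data : ℕ → ℕ) : Machine where
  width := W
  space := space
  ref := toArray R
  data := data
  text _ := 0
  coins _ := 0
  oracle _ _ := none

/-- The machine for a query: access to `R`, to the stored functions, to the text `T`, and to an
inversion oracle, no randomness. -/
def queryMachine {m n σ : ℕ} (W space : ℕ) (R : Fin m → Fin σ) (data : ℕ → ℕ)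
    (T : Fin (3 * n) → Fin σ) (inv : ℕ → ℕ → Option ℕ) : Machine where
  width := W
  space := space
  ref := toArray R
  data := data
  text := toArray T
  coins _ := 0
  oracle := inv

/-- The `len` words of `mem` from address `start` on, as an array padded with zeros. -/
def block (mem : ℕ → ℕ) (start len : ℕ) (j : ℕ) : ℕ :=
  if j < len then mem (start + j) else 0

/-- The construction has halted with `k`, `N`, `len` in registers `0, 1, 2` and `k` blocks of `len`
words, the stored functions, at the beginning of its memory of `space` cells. `Success` says that
these are functions from `[N]` to `[N]` with all the promised properties, for the constant `c`, the
evaluation program `eval` and the query program `query`. -/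
def Success {m σ : ℕ} (W space c n err : ℕ) (eval query : Cmd) (R : Fin m → Fin σ)
    (mem : ℕ → ℕ) (k N len : ℕ) : Prop :=
  k ≤ c * err ∧ len ≤ c * err ∧ N * n ≤ c * (m * err) ∧ k * len ≤ space ∧
  ∃ f : Fin k → Fin N → Fin N,
    (∀ (i : Fin k) (x : Fin N),
      Halts (evalMachine W (c * err) R (block mem (i * len) len)) eval
        [n, m, σ, err, k, N, len, x] (c * (n * err)) (fun s => s.reg 0 = f i x)) ∧
    ∀ (T : Fin (3 * n) → Fin σ) (inv : ℕ → ℕ → Option ℕ), IsInverter f inv →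
      Halts (queryMachine W (c * err) R (block mem 0 (k * len)) T inv) query
        [n, m, σ, err, k, N, len] (c * (n * err)) (fun s =>
          (∀ q ∈ s.asked, q.1 < k ∧ q.2 < N) ∧
          (s.asked.map Prod.fst).Nodup ∧
          IsAnswer R T (if s.reg 0 = 0 then none else some (s.reg 1)))

end CoreMatching

/-! The stored functions map a block of starting positions of the reference to a bucket of the
minimal fingerprint, in a random order, among the substrings of length `2 * n` that start in the
block. A query computes the minimal fingerprint of a window of starting positions in the text,
inverts the function at its bucket and verifies the resulting alignment. -/

/-! Put `g = n / 16`. The starting positions of substrings of length `2 * n` of the reference are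
cut into blocks of `g + 1`. A seed of five random words fixes the modulus and the base of a
Karp–Rabin fingerprint, an affine hash that orders the fingerprints, and the multiplier of a second
hash that distributes them over buckets. The function of this seed sends a block to the bucket of
its minimal fingerprint.

Let the text occur at position `p`. A window of `2 * g + 1` starting positions inside this
occurrence contains a whole block (`exists_block`). If the window and this block have the same
minimal fingerprint, the bucket computed from the text has a preimage. If moreover no block with
another minimum falls into that bucket, and fingerprints distinguish substrings, then every preimage
is a block containing the minimal substring of the window. That substring has length `2 * n` and
offset at most `n` in the text, so it covers the core, and aligning the two copies gives an
occurrence of the core (`coreAt_candidate`). Candidates are compared with the core symbol by symbol,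
so an unlucky seed costs time but never correctness.

The obstacle is repetition: the window may have many more distinct substrings than the block, and
then its minimum is unlikely to lie in the block. By `exists_pure_window`, one of three consecutive
windows is harmless. If the first or the last has no repeated substring, counting suffices.
Otherwise both lie in periodic stretches with a long overlap; the least period of the overlap
extends over both stretches, and `g + 1` consecutive positions of the middle window see either all
its substrings or only distinct ones. Which window is harmless depends on `p`, which a query does
not know, so function number `i` is tied to window `i % 3`.

All hashing is done modulo the word range `2 ^ W`, without exact pairwise independence. Its
substitute is `card_mul_add_mod_lt_le`, valid because keys are much smaller than `2 ^ W`. It yields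
a unique minimum inside the block with probability at least `1 / 64` (`card_unique_min_ge`) and
separation from the other buckets with probability at least `1 / 2` (`card_separated_ge`). The
fingerprint modulus is a random integer instead of a random prime, so no primality test is needed:
by `card_smooth_le` at least half of the candidates have a large prime factor, and the usual
polynomial argument works modulo that factor. So fingerprints are faithful with probability at least
`1 / 4`, and a seed is good for a given `p` with probability at least `1 / 512`
(`card_seedGood_ge`). With `1024 * err` independent seeds for each of the three windows, a fixed `p`
fails with probability at most `4 ^ (-err)`, and a union bound over at most `2 ^ err` positions
finishes (`card_some_never_good_le`).

On the machine, building is copying random words to memory, and a window is searched in linear time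
with rolling fingerprints (`runs_scan`). `success_of_good` joins the programs with the
combinatorics. If `m < 3 * n`, no text occurs and no function is stored. -/

/-! ### Number theory: smooth numbers are rare. -/

/-- The primes below `2 ^ Y` contribute `O(Y)` to the sum of `log p / (p - 1)`. -/
theorem sum_log_div_sub_one_le (Y : ℕ) :
    ∑ p ∈ (Finset.range (2 ^ Y)).filter Nat.Prime, Real.log p / ((p : ℝ) - 1)
      ≤ 8 * Y * Real.log 2 := by
  induction Y with
  | zero =>
    have : (Finset.range (2 ^ 0)).filter Nat.Prime = ∅ := by decide
    rw [this]; simp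
  | succ Y ih =>
    have hsplit : (Finset.range (2 ^ (Y + 1))).filter Nat.Prime =
        (Finset.range (2 ^ Y)).filter Nat.Prime ∪ (Finset.Ico (2 ^ Y) (2 ^ (Y + 1))).filter Nat.Prime := by
      rw [← Finset.filter_union]
      congr 1
      rw [Finset.range_eq_Ico, Finset.range_eq_Ico, Finset.Ico_union_Ico_eq_Ico (by positivity)
        (Nat.pow_le_pow_right (by norm_num) (by omega))]
    have hdisj : Disjoint ((Finset.range (2 ^ Y)).filter Nat.Prime)
        ((Finset.Ico (2 ^ Y) (2 ^ (Y + 1))).filter Nat.Prime) := by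
      rw [Finset.disjoint_left]
      intro x hx hx'
      simp only [Finset.mem_filter, Finset.mem_range, Finset.mem_Ico] at hx hx'
      omega
    rw [hsplit, Finset.sum_union hdisj]
    have hpow : (0 : ℝ) < 2 ^ Y := by positivity
    -- On a dyadic range `p - 1 ≥ p / 2 ≥ 2 ^ Y / 2`, so Chebyshev's `θ(x) ≤ x * log 4` gives a
    -- contribution of at most `8 * log 2` per range.
    have h1 : ∑ p ∈ (Finset.Ico (2 ^ Y) (2 ^ (Y + 1))).filter Nat.Prime, Real.log p / ((p : ℝ) - 1)
        ≤ ∑ p ∈ (Finset.Ico (2 ^ Y) (2 ^ (Y + 1))).filter Nat.Prime, (2 / 2 ^ Y) * Real.log p := by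
      apply Finset.sum_le_sum
      intro p hp
      simp only [Finset.mem_filter, Finset.mem_Ico] at hp
      have hp2 : (2 : ℝ) ≤ p := by exact_mod_cast hp.2.two_le
      have hpY : (2 : ℝ) ^ Y ≤ p := by exact_mod_cast hp.1.1
      have hl : 0 ≤ Real.log p := Real.log_nonneg (by linarith)
      rw [div_eq_mul_inv, mul_comm]
      refine mul_le_mul_of_nonneg_right ?_ hl
      rw [inv_eq_one_div, div_le_div_iff₀ (by linarith) hpow]
      linarith
    have h2 : ∑ p ∈ (Finset.Ico (2 ^ Y) (2 ^ (Y + 1))).filter Nat.Prime, Real.log p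
        ≤ Real.log 4 * 2 ^ (Y + 1) := by
      have h3 := Chebyshev.theta_le_log4_mul_x (x := (2 : ℝ) ^ (Y + 1)) (by positivity)
      refine le_trans ?_ h3
      have h4 : Chebyshev.theta ((2 : ℝ) ^ (Y + 1)) = Chebyshev.theta (((2 ^ (Y + 1) : ℕ)) : ℝ) := by
        push_cast; rfl
      rw [h4, Chebyshev.theta_eq_sum_primesLE_log]
      apply Finset.sum_le_sum_of_subset_of_nonneg
      · intro p hp
        simp only [Finset.mem_filter, Finset.mem_Ico] at hp
        rw [Nat.mem_primesLE]
        exact ⟨hp.1.2.le, hp.2⟩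
      · intro p hp _
        exact Real.log_natCast_nonneg p
    rw [← Finset.mul_sum] at h1
    have h5 : (2 / 2 ^ Y : ℝ) * (Real.log 4 * 2 ^ (Y + 1)) = 8 * Real.log 2 := by
      have : Real.log 4 = 2 * Real.log 2 := by
        rw [show (4 : ℝ) = 2 ^ 2 by norm_num, Real.log_pow]; norm_num
      rw [this, pow_succ]; field_simp; norm_num
    have h6 := mul_le_mul_of_nonneg_left h2 (show (0 : ℝ) ≤ 2 / 2 ^ Y by positivity)
    push_cast
    linarith

open Classical in
/-- Few numbers up to `2 ^ a` have only prime factors below `2 ^ Y` if `a` is large compared to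
`Y`. -/
theorem card_smooth_le {a Y : ℕ} (h : 32 * Y + 2 < a) :
    2 * ((Finset.Icc 1 (2 ^ a)).filter (fun M => ∀ p, p.Prime → p ∣ M → p < 2 ^ Y)).card
      ≤ 2 ^ a := by
  set S := (Finset.Icc 1 (2 ^ a)).filter (fun M => ∀ p, p.Prime → p ∣ M → p < 2 ^ Y) with hS
  have hl2 : 0 < Real.log 2 := Real.log_pos (by norm_num)
  have hne : ∀ M ∈ S, M ≠ 0 := by
    intro M hM
    simp only [hS, Finset.mem_filter, Finset.mem_Icc] at hM
    omega
  have hP0 : ∏ M ∈ S, M ≠ 0 := Finset.prod_ne_zero_iff.2 hne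
  -- The product of all smooth numbers is compared with the factorial: Legendre's formula bounds the
  -- exponent of each prime by `2 ^ a / (p - 1)`, and only primes below `2 ^ Y` occur.
  have hdvd : ∏ M ∈ S, M ∣ (2 ^ a).factorial := by
    rw [← Finset.prod_Ico_id_eq_factorial]
    refine Finset.prod_dvd_prod_of_subset _ _ _ fun M hM => ?_
    simp only [hS, Finset.mem_filter, Finset.mem_Icc] at hM
    rw [Finset.mem_Ico]
    omega
  have hupper : Real.log ((∏ M ∈ S, M : ℕ) : ℝ) ≤ 2 ^ a * (8 * Y * Real.log 2) := by
    rw [Real.log_nat_eq_sum_factorization, Finsupp.sum]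
    calc ∑ p ∈ (∏ M ∈ S, M).factorization.support,
          (((∏ M ∈ S, M).factorization p : ℕ) : ℝ) * Real.log p
        ≤ ∑ p ∈ (∏ M ∈ S, M).factorization.support,
            2 ^ a * (Real.log p / ((p : ℝ) - 1)) := by
          apply Finset.sum_le_sum
          intro p hp
          have hpp : p.Prime := Nat.prime_of_mem_primeFactors hp
          have : Fact p.Prime := ⟨hpp⟩
          have hp2 : (2 : ℝ) ≤ p := by exact_mod_cast hpp.two_le
          have h1 : (∏ M ∈ S, M).factorization p ≤ (2 ^ a).factorial.factorization p :=
            (Nat.factorization_le_iff_dvd hP0 (Nat.factorial_ne_zero _)).2 hdvd p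
          have h2 := sub_one_mul_padicValNat_factorial (p := p) (2 ^ a)
          rw [← Nat.factorization_def _ hpp] at h2
          have h3 : (p - 1) * (∏ M ∈ S, M).factorization p ≤ 2 ^ a :=
            (Nat.mul_le_mul_left _ h1).trans (h2.trans_le (Nat.sub_le _ _))
          have h4 : ((p : ℝ) - 1) * ((∏ M ∈ S, M).factorization p : ℕ) ≤ 2 ^ a := by
            have : (((p - 1) * (∏ M ∈ S, M).factorization p : ℕ) : ℝ) ≤ ((2 ^ a : ℕ) : ℝ) := by
              exact_mod_cast h3
            rw [Nat.cast_mul, Nat.cast_sub hpp.one_le] at this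
            push_cast at this ⊢
            exact this
          have hl : 0 ≤ Real.log p := Real.log_nonneg (by linarith)
          rw [mul_div_assoc', le_div_iff₀ (by linarith)]
          nlinarith
      _ ≤ ∑ p ∈ (Finset.range (2 ^ Y)).filter Nat.Prime, 2 ^ a * (Real.log p / ((p : ℝ) - 1)) := by
          apply Finset.sum_le_sum_of_subset_of_nonneg
          · intro p hp
            have hpp : p.Prime := Nat.prime_of_mem_primeFactors hp
            have hpd : p ∣ ∏ M ∈ S, M := Nat.dvd_of_mem_primeFactors hp
            obtain ⟨M, hM, hpM⟩ := (Prime.dvd_finsetProd_iff hpp.prime _).1 hpd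
            simp only [hS, Finset.mem_filter, Finset.mem_Icc] at hM
            simp only [Finset.mem_filter, Finset.mem_range]
            exact ⟨hM.2 p hpp hpM, hpp⟩
          · intro p hp _
            simp only [Finset.mem_filter] at hp
            have hp2 : (2 : ℝ) ≤ p := by exact_mod_cast hp.2.two_le
            have hl : 0 ≤ Real.log p := Real.log_nonneg (by linarith)
            have : (0 : ℝ) < p - 1 := by linarith
            positivity
      _ ≤ 2 ^ a * (8 * Y * Real.log 2) := by
          rw [← Finset.mul_sum]
          exact mul_le_mul_of_nonneg_left (sum_log_div_sub_one_le Y) (by positivity)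
  have hX : 2 ^ a = 4 * 2 ^ (a - 2) := by
    rw [show a = (a - 2) + 2 by omega, pow_add]; simp; ring
  -- Fewer than `2 ^ (a - 2)` members are below `2 ^ (a - 2)`; each of the others contributes at
  -- least `(a - 2) * log 2`.
  have hlower : ((S.card : ℝ) - 2 ^ (a - 2)) * (((a - 2 : ℕ) : ℝ) * Real.log 2)
      ≤ Real.log ((∏ M ∈ S, M : ℕ) : ℝ) := by
    rw [Nat.cast_prod, Real.log_prod (fun M hM => by exact_mod_cast hne M hM)]
    have hcard : S.card ≤ (S.filter (fun M => 2 ^ (a - 2) ≤ M)).card + 2 ^ (a - 2) := by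
      rw [← Finset.card_filter_add_card_filter_not (s := S) (fun M => 2 ^ (a - 2) ≤ M)]
      gcongr
      calc (S.filter (fun M => ¬ 2 ^ (a - 2) ≤ M)).card ≤ (Finset.range (2 ^ (a - 2))).card := by
            apply Finset.card_le_card
            intro M hM
            simp only [Finset.mem_filter, Finset.mem_range] at hM ⊢
            omega
        _ = _ := Finset.card_range _
    have hcard' : (S.card : ℝ) - 2 ^ (a - 2) ≤ (S.filter (fun M => 2 ^ (a - 2) ≤ M)).card := by
      have : (S.card : ℝ) ≤ (S.filter (fun M => 2 ^ (a - 2) ≤ M)).card + 2 ^ (a - 2) := by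
        exact_mod_cast hcard
      linarith
    calc ((S.card : ℝ) - 2 ^ (a - 2)) * (((a - 2 : ℕ) : ℝ) * Real.log 2)
        ≤ (S.filter (fun M => 2 ^ (a - 2) ≤ M)).card * (((a - 2 : ℕ) : ℝ) * Real.log 2) :=
          mul_le_mul_of_nonneg_right hcard' (by positivity)
      _ = ∑ M ∈ S.filter (fun M => 2 ^ (a - 2) ≤ M), (((a - 2 : ℕ) : ℝ) * Real.log 2) := by
          rw [Finset.sum_const, nsmul_eq_mul]
      _ ≤ ∑ M ∈ S.filter (fun M => 2 ^ (a - 2) ≤ M), Real.log M := by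
          apply Finset.sum_le_sum
          intro M hM
          simp only [Finset.mem_filter] at hM
          rw [← Real.log_pow]
          exact Real.log_le_log (by positivity) (by exact_mod_cast hM.2)
      _ ≤ ∑ M ∈ S, Real.log M := by
          apply Finset.sum_le_sum_of_subset_of_nonneg (Finset.filter_subset _ _)
          intro M hM _
          exact Real.log_natCast_nonneg M
  by_contra hcon
  push Not at hcon
  -- If more than half of the numbers were smooth, the two bounds would give `a - 2 < 4 * 8 * Y`.
  have hbig : (2 : ℝ) ^ (a - 2) < (S.card : ℝ) - 2 ^ (a - 2) := by
    have : (2 * (2 * 2 ^ (a - 2)) : ℝ) < 2 * S.card := by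
      have : (4 * 2 ^ (a - 2) : ℝ) < 2 * S.card := by
        rw [hX] at hcon; exact_mod_cast hcon
      linarith
    linarith
  have ha : (32 * Y : ℝ) < ((a - 2 : ℕ) : ℝ) := by
    have : 32 * Y < a - 2 := by omega
    exact_mod_cast this
  have h1 := hlower.trans hupper
  have hXr : (2 : ℝ) ^ a = 4 * 2 ^ (a - 2) := by exact_mod_cast hX
  rw [hXr] at h1
  have hpos : (0 : ℝ) < 2 ^ (a - 2) := by positivity
  have h2 : (2 : ℝ) ^ (a - 2) * (((a - 2 : ℕ) : ℝ) * Real.log 2)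
      < ((S.card : ℝ) - 2 ^ (a - 2)) * (((a - 2 : ℕ) : ℝ) * Real.log 2) := by
    apply mul_lt_mul_of_pos_right hbig
    have : (0 : ℝ) ≤ Y := by positivity
    have : (0 : ℝ) < ((a - 2 : ℕ) : ℝ) := by linarith
    positivity
  have h3 : (2 : ℝ) ^ (a - 2) * (((a - 2 : ℕ) : ℝ) * Real.log 2)
      < 2 ^ (a - 2) * (32 * Y * Real.log 2) := by linarith
  have h4 := lt_of_mul_lt_mul_left h3 hpos.le
  have h5 := lt_of_mul_lt_mul_right h4 hl2.le
  linarith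

/-! ### Periodicity: windows in which minima are likely to lie in a given block. -/

namespace CoreMatching

/-- `d` is a period of `X` restricted to `[a, b)`. -/
def PeriodOn (X : ℕ → ℕ) (d a b : ℕ) : Prop := ∀ z, a ≤ z → z + d < b → X z = X (z + d)

/-- The substrings of length `L` of `X` at `i` and at `j` are equal. -/
def WindowEq (X : ℕ → ℕ) (L i j : ℕ) : Prop := ∀ t, t < L → X (i + t) = X (j + t)

theorem WindowEq.periodOn {X : ℕ → ℕ} {L i j : ℕ} (h : WindowEq X L i j) (hij : i ≤ j) :
    PeriodOn X (j - i) i (j + L) := by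
  intro z hz hz'
  have := h (z - i) (by omega)
  rwa [show i + (z - i) = z by omega, show j + (z - i) = z + (j - i) by omega] at this

/-- A period of a long substring extends to the whole string if the string has some not too long
period. -/
theorem PeriodOn.extend {X : ℕ → ℕ} {d e a b a' b' : ℕ} (h : PeriodOn X e a b)
    (h' : PeriodOn X d a' b') (ha : a ≤ a') (hb : b' ≤ b) (hl : a' + e + d ≤ b') (he : 0 < e) :
    PeriodOn X d a b := by
  -- Both sides of the equation are moved by the period `e` towards `[a', b')`, first from the left
  -- and then from the right. The assumed length of that range keeps a jump from overshooting it.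
  have left : ∀ k z, a' - z ≤ k → a ≤ z → z + d < b' → X z = X (z + d) := by
    intro k
    induction k with
    | zero => intro z hk _ hz'; exact h' z (by omega) hz'
    | succ k ih =>
      intro z hk hz hz'
      by_cases hza : a' ≤ z
      · exact h' z hza hz'
      · rw [h z hz (by omega), h (z + d) (by omega) (by omega),
          ih (z + e) (by omega) (by omega) (by omega)]
        congr 1; omega
  have right : ∀ z, a ≤ z → z + d < b → X z = X (z + d) := by
    intro z
    induction z using Nat.strong_induction_on with
    | _ z ih =>
      intro hz hzb
      by_cases hzb' : z + d < b'
      · exact left _ z le_rfl hz hzb'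
      · have h1 := h (z - e) (by omega) (by omega)
        have h2 := h (z - e + d) (by omega) (by omega)
        have h3 := ih (z - e) (by omega) (by omega) (by omega)
        rw [show z - e + e = z by omega] at h1
        rw [show z - e + d + e = z + d by omega] at h2
        rw [← h1, ← h2, h3]
  exact right

/-- A subrange has `g + 1` distinct values, and the whole range has at most `2 * g + 1`. -/
theorem card_image_Icc_le_of_injOn {φ : ℕ → ℕ} {g u o : ℕ}
    (h : Set.InjOn φ (Set.Icc u (u + 2 * g))) (ho : u ≤ o) (ho' : o + g ≤ u + 2 * g) :
    ((Finset.Icc u (u + 2 * g)).image φ).card ≤ 2 * ((Finset.Icc o (o + g)).image φ).card := by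
  have h1 : ((Finset.Icc o (o + g)).image φ).card = g + 1 := by
    rw [Finset.card_image_of_injOn, Nat.card_Icc]
    · omega
    · intro x hx y hy hxy
      simp only [Finset.coe_Icc, Set.mem_Icc] at hx hy
      exact h ⟨by omega, by omega⟩ ⟨by omega, by omega⟩ hxy
  have h2 : ((Finset.Icc u (u + 2 * g)).image φ).card ≤ 2 * g + 1 := by
    refine Finset.card_image_le.trans ?_
    rw [Nat.card_Icc]; omega
  omega

/-- Among three consecutive ranges of starting positions there is one in which every subrange of
half the length sees at least half of the distinct substrings. -/
theorem exists_pure_window (X : ℕ → ℕ) {g L p : ℕ} (hL : 10 * g ≤ L) :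
    ∃ v, v < 3 ∧ ∀ φ : ℕ → ℕ, (∀ i j, p ≤ i → p ≤ j → i ≤ p + 6 * g → j ≤ p + 6 * g →
        (φ i = φ j ↔ WindowEq X L i j)) →
      ∀ o, p + 2 * g * v ≤ o → o + g ≤ p + 2 * g * v + 2 * g →
      ((Finset.Icc (p + 2 * g * v) (p + 2 * g * v + 2 * g)).image φ).card
        ≤ 2 * ((Finset.Icc o (o + g)).image φ).card := by
  have distinct : ∀ u, p ≤ u → u + 2 * g ≤ p + 6 * g →
      (¬ ∃ i j, u ≤ i ∧ i < j ∧ j ≤ u + 2 * g ∧ WindowEq X L i j) → ∀ φ : ℕ → ℕ,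
      (∀ i j, p ≤ i → p ≤ j → i ≤ p + 6 * g → j ≤ p + 6 * g →
        (φ i = φ j ↔ WindowEq X L i j)) → Set.InjOn φ (Set.Icc u (u + 2 * g)) := by
    intro u hu hu' hno φ hφ i hi j hj hij
    rw [Set.mem_Icc] at hi hj
    by_contra hne
    rcases lt_or_gt_of_ne hne with hlt | hlt
    · exact hno ⟨i, j, hi.1, hlt, hj.2,
        (hφ i j (by omega) (by omega) (by omega) (by omega)).1 hij⟩
    · exact hno ⟨j, i, hj.1, hlt, hi.2,
        (hφ j i (by omega) (by omega) (by omega) (by omega)).1 hij.symm⟩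
  by_cases h0 : ∃ i j, p + 2 * g * 0 ≤ i ∧ i < j ∧ j ≤ p + 2 * g * 0 + 2 * g ∧ WindowEq X L i j
  swap
  · exact ⟨0, by norm_num, fun φ hφ o ho ho' =>
      card_image_Icc_le_of_injOn (distinct _ (by omega) (by omega) h0 φ hφ) ho ho'⟩
  by_cases h2 : ∃ i j, p + 2 * g * 2 ≤ i ∧ i < j ∧ j ≤ p + 2 * g * 2 + 2 * g ∧ WindowEq X L i j
  swap
  · exact ⟨2, by norm_num, fun φ hφ o ho ho' =>
      card_image_Icc_le_of_injOn (distinct _ (by omega) (by omega) h2 φ hφ) ho ho'⟩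
  obtain ⟨i, j, hi, hij, hj, hw⟩ := h0
  obtain ⟨i', j', hi', hij', hj', hw'⟩ := h2
  have hp := hw.periodOn hij.le
  have hp' := hw'.periodOn hij'.le
  -- `[p + 6 * g, p + L)` lies in both periodic stretches and has length at least `4 * g`, enough
  -- for two periods of at most `2 * g`. Its least period `d` therefore extends to both stretches.
  have hex : ∃ d, 0 < d ∧ PeriodOn X d (p + 6 * g) (p + L) :=
    ⟨j - i, by omega, fun z hz hz' => hp z (by omega) (by omega)⟩
  classical
  set d := Nat.find hex with hd
  obtain ⟨hd0, hdp⟩ := Nat.find_spec hex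
  have hdle : d ≤ j - i := Nat.find_min' hex
    ⟨by omega, fun z hz hz' => hp z (by omega) (by omega)⟩
  have hdle' : d ≤ j' - i' := Nat.find_min' hex
    ⟨by omega, fun z hz hz' => hp' z (by omega) (by omega)⟩
  have hq := hp.extend hdp (by omega) (by omega) (by omega) (by omega)
  have hq' := hp'.extend hdp (by omega) (by omega) (by omega) (by omega)
  refine ⟨1, by norm_num, fun φ hφ o ho ho' => ?_⟩
  have hshift : ∀ x, p + 2 * g ≤ x → x + d ≤ p + 4 * g → φ x = φ (x + d) := by
    intro x hx hx'
    rw [hφ x (x + d) (by omega) (by omega) (by omega) (by omega)]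
    intro t ht
    rw [show x + d + t = x + t + d by omega]
    by_cases hz : i' ≤ x + t
    · exact hq' _ hz (by omega)
    · exact hq _ (by omega) (by omega)
  -- For `d ≤ g + 1` any `g + 1` consecutive positions meet every class modulo `d`, hence every
  -- substring of the window. For larger `d`, a repetition at distance at most `g` would give the
  -- overlap a period smaller than `d`.
  by_cases hdg : d ≤ g + 1
  · have hmem : ∀ k x, p + 2 * g ≤ x → x ≤ p + 4 * g → (o - x) + (x - (o + g)) ≤ k →
        φ x ∈ (Finset.Icc o (o + g)).image φ := by
      intro k
      induction k with
      | zero =>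
        intro x hx hx' hk
        exact Finset.mem_image_of_mem φ (Finset.mem_Icc.2 ⟨by omega, by omega⟩)
      | succ k ih =>
        intro x hx hx' hk
        by_cases h1 : x < o
        · rw [hshift x hx (by omega)]
          exact ih _ (by omega) (by omega) (by omega)
        · by_cases h3 : o + g < x
          · have := hshift (x - d) (by omega) (by omega)
            rw [show x - d + d = x by omega] at this
            rw [← this]
            exact ih _ (by omega) (by omega) (by omega)
          · exact Finset.mem_image_of_mem φ (Finset.mem_Icc.2 ⟨by omega, by omega⟩)
    have hsub : (Finset.Icc (p + 2 * g * 1) (p + 2 * g * 1 + 2 * g)).image φ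
        ⊆ (Finset.Icc o (o + g)).image φ := by
      intro y hy
      obtain ⟨x, hx, rfl⟩ := Finset.mem_image.1 hy
      rw [Finset.mem_Icc] at hx
      exact hmem _ x (by omega) (by omega) le_rfl
    have := Finset.card_le_card hsub
    omega
  · have hlt : ∀ x y, o ≤ x → x < y → y ≤ o + g → φ x ≠ φ y := by
      intro x y hx hxy hy hφxy
      have hw'' := ((hφ x y (by omega) (by omega) (by omega) (by omega)).1 hφxy).periodOn hxy.le
      have : d ≤ y - x := Nat.find_min' hex
        ⟨by omega, fun z hz hz' => hw'' z (by omega) (by omega)⟩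
      omega
    have hinj : Set.InjOn φ (Finset.Icc o (o + g) : Set ℕ) := by
      intro x hx y hy hxy
      simp only [Finset.coe_Icc, Set.mem_Icc] at hx hy
      rcases lt_trichotomy x y with h | h | h
      · exact absurd hxy (hlt x y hx.1 h hy.2)
      · exact h
      · exact absurd hxy.symm (hlt y x hy.1 h hx.2)
    rw [Finset.card_image_of_injOn hinj, Nat.card_Icc]
    have h4 := Finset.card_image_le
      (s := Finset.Icc (p + 2 * g * 1) (p + 2 * g * 1 + 2 * g)) (f := φ)
    rw [Nat.card_Icc] at h4
    omega

end CoreMatching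

/-! ### Hashing modulo the word range. -/

namespace CoreMatching

section Hashing

open scoped Classical

/-- An arithmetic progression modulo `Q` hits a short interval not much more often than expected. -/
theorem card_mul_add_mod_lt_le {Q z τ c : ℕ} (hz : 0 < z) (hzτ : z ≤ τ) (hc : c < Q) :
    (Finset.univ.filter (fun a : Fin Q => ((a : ℕ) * z + c) % Q < τ)).card ≤ 4 * τ := by
  have hQ : 0 < Q := by omega
  set A := Finset.univ.filter (fun a : Fin Q => ((a : ℕ) * z + c) % Q < τ) with hA
  -- The progression wraps around at most `z` times, and between two wraps at most `τ / z + 1` of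
  -- its terms, spaced by `z`, fit into an interval of length `τ`.
  have himg : A.image (fun a : Fin Q => ((a : ℕ) * z + c) / Q) ⊆ Finset.range (z + 1) := by
    intro k hk
    obtain ⟨a, -, rfl⟩ := Finset.mem_image.1 hk
    rw [Finset.mem_range, Nat.div_lt_iff_lt_mul hQ]
    have := a.2
    nlinarith
  have hfib : ∀ k ∈ A.image (fun a : Fin Q => ((a : ℕ) * z + c) / Q),
      (A.filter (fun a : Fin Q => ((a : ℕ) * z + c) / Q = k)).card ≤ τ / z + 1 := by
    intro k _
    set F := A.filter (fun a : Fin Q => ((a : ℕ) * z + c) / Q = k) with hF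
    rcases F.eq_empty_or_nonempty with he | hne
    · rw [he]; simp
    set a0 := F.min' hne with ha0
    have hclose : ∀ a ∈ F, k * Q ≤ (a : ℕ) * z + c ∧ (a : ℕ) * z + c < k * Q + τ := by
      intro a ha
      simp only [hF, hA, Finset.mem_filter, Finset.mem_univ, true_and] at ha
      have := Nat.div_add_mod ((a : ℕ) * z + c) Q
      rw [ha.2, mul_comm] at this
      omega
    calc F.card ≤ (Finset.range (τ / z + 1)).card := by
          apply Finset.card_le_card_of_injOn (fun a : Fin Q => (a : ℕ) - a0)
          · intro a ha
            have h1 := hclose a ha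
            have h2 := hclose a0 (F.min'_mem hne)
            have h3 : (a0 : ℕ) ≤ a := F.min'_le a ha
            simp only [Finset.coe_range, Set.mem_Iio]
            rw [Nat.lt_succ_iff, Nat.le_div_iff_mul_le hz, Nat.sub_mul]
            omega
          · intro a ha b hb hab
            have h1 : (a0 : ℕ) ≤ a := F.min'_le a ha
            have h2 : (a0 : ℕ) ≤ b := F.min'_le b hb
            simp only at hab
            exact Fin.ext (by omega)
      _ = _ := Finset.card_range _
  have h1 := Finset.card_le_mul_card_image (s := A)
    (f := fun a : Fin Q => ((a : ℕ) * z + c) / Q) (τ / z + 1) hfib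
  have h2 := Finset.card_le_card himg
  rw [Finset.card_range] at h2
  have h3 : τ / z * z ≤ τ := Nat.div_mul_le_self τ z
  have h4 : τ / z ≤ τ := Nat.div_le_self τ z
  calc A.card ≤ (τ / z + 1) * (z + 1) := h1.trans (Nat.mul_le_mul_left _ h2)
    _ = τ / z * z + τ / z + z + 1 := by ring
    _ ≤ 4 * τ := by omega

/-- Translation by `c` permutes the residues modulo `Q`. -/
theorem card_add_mod_lt {Q τ c : ℕ} (hτ : τ ≤ Q) :
    (Finset.univ.filter (fun b : Fin Q => (c + (b : ℕ)) % Q < τ)).card = τ := by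
  rcases Nat.eq_zero_or_pos Q with rfl | hQ
  · have : τ = 0 := by omega
    subst this; simp
  have : NeZero Q := ⟨hQ.ne'⟩
  have h1 : (Finset.univ.filter (fun b : Fin Q => (c + (b : ℕ)) % Q < τ)).card
      = (Finset.univ.filter (fun b : Fin Q => (b : ℕ) < τ)).card := by
    apply Finset.card_bij (fun b _ => Fin.ofNat Q c + b)
    · intro b hb
      simp only [Finset.mem_filter, Finset.mem_univ, true_and] at hb ⊢
      rw [Fin.val_add, Fin.val_ofNat, Nat.mod_add_mod]
      exact hb
    · intro a _ b _ hab
      exact add_left_cancel hab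
    · intro b hb
      refine ⟨b - Fin.ofNat Q c, ?_, by abel⟩
      simp only [Finset.mem_filter, Finset.mem_univ, true_and] at hb ⊢
      have h2 : ((Fin.ofNat Q c + (b - Fin.ofNat Q c) : Fin Q) : ℕ) = b := by
        congr 1; abel
      rw [Fin.val_add, Fin.val_ofNat, Nat.mod_add_mod] at h2
      rw [h2]; exact hb
  rw [h1]
  calc (Finset.univ.filter (fun b : Fin Q => (b : ℕ) < τ)).card
      = ((Finset.univ.filter (fun b : Fin Q => (b : ℕ) < τ)).map Fin.valEmbedding).card :=
        (Finset.card_map _).symm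
    _ = (Finset.range τ).card := by
        congr 1
        ext x
        simp only [Finset.mem_map, Finset.mem_filter, Finset.mem_univ, true_and, Finset.mem_range]
        constructor
        · rintro ⟨b, hb, rfl⟩; exact hb
        · intro hx; exact ⟨⟨x, by omega⟩, hx, rfl⟩
    _ = τ := Finset.card_range _

/-- The affine hash function on words. -/
def wordHash (Q a b x : ℕ) : ℕ := (a * x + b) % Q

theorem card_wordHash_lt {Q τ : ℕ} (x : ℕ) (hτ : τ ≤ Q) :
    (Finset.univ.filter (fun s : Fin Q × Fin Q => wordHash Q s.1 s.2 x < τ)).card = Q * τ := by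
  rw [Finset.card_filter, Fintype.sum_prod_type]
  simp_rw [← Finset.card_filter]
  have : ∀ a : Fin Q, (Finset.univ.filter (fun b : Fin Q => wordHash Q a b x < τ)).card = τ :=
    fun a => card_add_mod_lt hτ
  simp [this]

/-- Given the hash value `c` of `x`, the multiplier `a` determines `b`, and the value at `y` is `a *
(y - x) + c`, a progression in `a`. So up to a factor `4` this is the bound of pairwise
independence. -/
theorem card_wordHash_pair_le {Q τ x y : ℕ} (hxy : x < y) (hz : y - x ≤ τ) (hτ : τ ≤ Q) :
    (Finset.univ.filter (fun s : Fin Q × Fin Q =>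
      wordHash Q s.1 s.2 x < τ ∧ wordHash Q s.1 s.2 y < τ)).card ≤ τ * (4 * τ) := by
  set A := Finset.univ.filter (fun s : Fin Q × Fin Q =>
      wordHash Q s.1 s.2 x < τ ∧ wordHash Q s.1 s.2 y < τ) with hA
  have hkey : ∀ s : Fin Q × Fin Q, wordHash Q s.1 s.2 y
      = ((s.1 : ℕ) * (y - x) + wordHash Q s.1 s.2 x) % Q := by
    intro s
    unfold wordHash
    rw [Nat.add_mod_mod, ← add_assoc, ← Nat.mul_add, Nat.sub_add_cancel hxy.le]
  have hfib : ∀ c ∈ A.image (fun s => wordHash Q s.1 s.2 x),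
      (A.filter (fun s => wordHash Q s.1 s.2 x = c)).card ≤ 4 * τ := by
    intro c hc
    obtain ⟨s0, hs0, rfl⟩ := Finset.mem_image.1 hc
    simp only [hA, Finset.mem_filter, Finset.mem_univ, true_and] at hs0
    refine le_trans ?_ (card_mul_add_mod_lt_le (Q := Q) (c := wordHash Q s0.1 s0.2 x)
      (Nat.sub_pos_of_lt hxy) hz (by omega))
    apply Finset.card_le_card_of_injOn (fun s => s.1)
    · intro s hs
      simp only [hA, Finset.coe_filter, Finset.mem_filter, Finset.mem_univ, true_and,
        Set.mem_ofPred_eq] at hs ⊢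
      rw [← hs.2, ← hkey]; exact hs.1.2
    · rintro ⟨a, b⟩ hs ⟨a', b'⟩ hs' hab
      simp only [hA, Finset.coe_filter, Finset.mem_filter, Finset.mem_univ, true_and,
        Set.mem_ofPred_eq] at hs hs' hab
      subst hab
      have h1 : ((a : ℕ) * x + b) % Q = ((a : ℕ) * x + b') % Q := hs.2.trans hs'.2.symm
      have h2 : (b : ℕ) ≡ b' [MOD Q] := Nat.ModEq.add_left_cancel' _ h1
      have h3 : (b : ℕ) = b' := Nat.ModEq.eq_of_lt_of_lt h2 b.2 b'.2
      rw [Fin.ext h3]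
  have h1 := Finset.card_le_mul_card_image (s := A)
    (f := fun s => wordHash Q s.1 s.2 x) (4 * τ) hfib
  have h2 : (A.image (fun s => wordHash Q s.1 s.2 x)).card ≤ τ := by
    rw [← Finset.card_range τ]
    apply Finset.card_le_card
    intro c hc
    obtain ⟨s0, hs0, rfl⟩ := Finset.mem_image.1 hc
    simp only [hA, Finset.mem_filter, Finset.mem_univ, true_and] at hs0
    exact Finset.mem_range.2 hs0.1
  calc A.card ≤ 4 * τ * _ := h1
    _ ≤ 4 * τ * τ := Nat.mul_le_mul_left _ h2
    _ = _ := by ring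

/-- The affine hash function has a unique minimum over `U` on words, and attains it in `I`. -/
def UniqueMin (Q : ℕ) (U I : Finset ℕ) (a b : ℕ) : Prop :=
  ∃ x ∈ I, ∀ y ∈ U, y ≠ x → wordHash Q a b x < wordHash Q a b y

/-- With constant probability, the minimum of the affine hash function over `U` is attained only
once, and in a prescribed subset of at least half the size. -/
theorem card_unique_min_ge {Q D : ℕ} {U I : Finset ℕ} (hIU : I ⊆ U) (hU : U.Nonempty)
    (hcard : U.card ≤ 2 * I.card) (hD : ∀ x ∈ U, x < D) (hQ : 8 * U.card * D ≤ Q) :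
    Q * Q ≤ 64 * (Finset.univ.filter (fun s : Fin Q × Fin Q =>
      UniqueMin Q U I s.1 s.2)).card := by
  set u := U.card with hu
  have hu0 : 0 < u := Finset.card_pos.2 hU
  set τ := Q / (8 * u) with hτ
  have hτQ : τ ≤ Q := Nat.div_le_self _ _
  have h8 : 8 * u * τ ≤ Q := Nat.mul_div_le Q (8 * u)
  have hDτ : D ≤ τ := by
    rw [hτ, Nat.le_div_iff_mul_le (by omega)]
    linarith
  have hD0 : 0 < D := by
    obtain ⟨x, hx⟩ := hU
    have := hD x hx
    omega
  have h16 : Q ≤ 16 * u * τ := by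
    have h1 := Nat.div_add_mod Q (8 * u)
    have h2 := Nat.mod_lt Q (show 0 < 8 * u by omega)
    have h3 : 8 * u ≤ 8 * u * τ := Nat.le_mul_of_pos_right _ (by omega)
    rw [← hτ] at h1
    nlinarith
  -- `E x`: only `x` is hashed below `τ`. These events are disjoint and each implies a unique
  -- minimum at `x`. By the pair bound each contains at least `Q * τ - 4 * u * τ ^ 2 ≥ Q * τ / 2`
  -- seeds.
  set E : ℕ → Finset (Fin Q × Fin Q) := fun x => Finset.univ.filter (fun s : Fin Q × Fin Q =>
    wordHash Q s.1 s.2 x < τ ∧ ∀ y ∈ U, y ≠ x → τ ≤ wordHash Q s.1 s.2 y) with hE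
  have hpair : ∀ x ∈ I, ∀ y ∈ U.erase x, (Finset.univ.filter (fun s : Fin Q × Fin Q =>
      wordHash Q s.1 s.2 x < τ ∧ wordHash Q s.1 s.2 y < τ)).card ≤ τ * (4 * τ) := by
    intro x hx y hy
    obtain ⟨hyx, hyU⟩ := Finset.mem_erase.1 hy
    have h1 := hD x (hIU hx)
    have h2 := hD y hyU
    rcases lt_or_gt_of_ne hyx with h | h
    · simp_rw [and_comm (a := wordHash Q _ _ x < τ)]
      exact card_wordHash_pair_le h (by omega) hτQ
    · exact card_wordHash_pair_le h (by omega) hτQ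
  have hEx : ∀ x ∈ I, Q * τ ≤ 2 * (E x).card := by
    intro x hx
    have hsub : Finset.univ.filter (fun s : Fin Q × Fin Q => wordHash Q s.1 s.2 x < τ) ⊆
        E x ∪ (U.erase x).biUnion (fun y => Finset.univ.filter (fun s : Fin Q × Fin Q =>
          wordHash Q s.1 s.2 x < τ ∧ wordHash Q s.1 s.2 y < τ)) := by
      intro s hs
      simp only [Finset.mem_filter, Finset.mem_univ, true_and] at hs
      simp only [hE, Finset.mem_union, Finset.mem_filter, Finset.mem_univ, true_and,
        Finset.mem_biUnion, Finset.mem_erase]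
      by_cases hall : ∀ y ∈ U, y ≠ x → τ ≤ wordHash Q s.1 s.2 y
      · exact Or.inl ⟨hs, hall⟩
      · push Not at hall
        obtain ⟨y, hy, hyx, hlt⟩ := hall
        exact Or.inr ⟨y, ⟨hyx, hy⟩, hs, hlt⟩
    have h1 := (Finset.card_le_card hsub).trans (Finset.card_union_le _ _)
    rw [card_wordHash_lt x hτQ] at h1
    have h2 := Finset.card_biUnion_le_card_mul (U.erase x) (fun y => Finset.univ.filter
      (fun s : Fin Q × Fin Q => wordHash Q s.1 s.2 x < τ ∧ wordHash Q s.1 s.2 y < τ))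
      (τ * (4 * τ)) (hpair x hx)
    have h3 : (U.erase x).card ≤ u := Finset.card_erase_le
    have h4 := Nat.mul_le_mul_right (τ * (4 * τ)) h3
    have h5 := Nat.mul_le_mul_right τ h8
    nlinarith
  have hdisj : (I : Set ℕ).PairwiseDisjoint E := by
    intro x hx y hy hxy
    rw [Function.onFun, Finset.disjoint_left]
    intro s hs hs'
    simp only [hE, Finset.mem_filter, Finset.mem_univ, true_and] at hs hs'
    have := hs.2 y (hIU hy) hxy.symm
    omega
  have hsub : I.biUnion E ⊆ Finset.univ.filter (fun s : Fin Q × Fin Q =>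
      UniqueMin Q U I s.1 s.2) := by
    intro s hs
    obtain ⟨x, hx, hsx⟩ := Finset.mem_biUnion.1 hs
    simp only [hE, Finset.mem_filter, Finset.mem_univ, true_and] at hsx ⊢
    exact ⟨x, hx, fun y hy hyx => hsx.1.trans_le (hsx.2 y hy hyx)⟩
  have h1 := Finset.card_le_card hsub
  rw [Finset.card_biUnion hdisj] at h1
  have h2 : I.card * (Q * τ) ≤ 2 * ∑ x ∈ I, (E x).card := by
    rw [Finset.mul_sum, ← smul_eq_mul, ← Finset.sum_const]
    exact Finset.sum_le_sum hEx
  have h3 : Q * Q ≤ Q * (16 * u * τ) := Nat.mul_le_mul_left _ h16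
  have h4 : u * (Q * τ) ≤ 2 * I.card * (Q * τ) := Nat.mul_le_mul_right _ hcard
  nlinarith

/-- The bucket hash function on words. -/
def bucketHash (Q S a x : ℕ) : ℕ := (a * x % Q) / S

/-- Some other element of `Y` gets into the same bucket as `x`. -/
def Collides (Q S : ℕ) (Y : Finset ℕ) (x a : ℕ) : Prop :=
  ∃ y ∈ Y, y ≠ x ∧ bucketHash Q S a y = bucketHash Q S a x

/-- In a common bucket the two products differ by less than `S` modulo `Q`, so `a * (y - x)`,
shifted by `S` to make it positive, lies in an interval of length `2 * S`. If `2 * S > Q`, the bound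
is trivial. -/
theorem card_bucketHash_eq_le {Q S x y : ℕ} (hS : 0 < S) (hxy : x < y) (hz : y - x ≤ 2 * S) :
    (Finset.univ.filter (fun a : Fin Q => bucketHash Q S a x = bucketHash Q S a y)).card
      ≤ 8 * S := by
  by_cases h2S : 2 * S ≤ Q
  · refine le_trans ?_ ((card_mul_add_mod_lt_le (Q := Q) (c := S) (Nat.sub_pos_of_lt hxy) hz
      (by omega)).trans (by omega))
    apply Finset.card_le_card
    intro a ha
    rw [Finset.mem_filter] at ha ⊢
    refine ⟨Finset.mem_univ _, ?_⟩
    replace ha : (a : ℕ) * x % Q / S = a * y % Q / S := ha.2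
    set v := (a : ℕ) * x % Q with hv
    set w := (a : ℕ) * y % Q with hw
    have hd1 := Nat.div_add_mod v S
    have hd2 := Nat.div_add_mod w S
    have hm1 := Nat.mod_lt v hS
    have hm2 := Nat.mod_lt w hS
    rw [ha] at hd1
    have hcong : (a : ℕ) * (y - x) + v ≡ w [MOD Q] := by
      have e : (a : ℕ) * (y - x) + a * x = a * y := by
        rw [← Nat.mul_add, Nat.sub_add_cancel hxy.le]
      calc (a : ℕ) * (y - x) + v ≡ a * (y - x) + a * x [MOD Q] :=
            Nat.ModEq.add_left _ (Nat.mod_modEq _ _)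
        _ = a * y := e
        _ ≡ w [MOD Q] := (Nat.mod_modEq _ _).symm
    have hcong2 : (a : ℕ) * (y - x) + S ≡ w + S - v [MOD Q] := by
      apply Nat.ModEq.add_right_cancel' v
      rw [show w + S - v + v = w + S by omega, add_right_comm]
      exact hcong.add_right S
    rw [show ((a : ℕ) * (y - x) + S) % Q = w + S - v from
      Nat.mod_eq_of_modEq hcong2 (by omega)]
    omega
  · refine (Finset.card_filter_le _ _).trans ?_
    rw [Finset.card_univ, Fintype.card_fin]
    omega

theorem card_bucketHash_collision_le {Q S D x : ℕ} (hS : 0 < S) (Y : Finset ℕ) (hx : x < D)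
    (hY : ∀ y ∈ Y, y < D) (hD : D ≤ 2 * S) :
    (Finset.univ.filter (fun a : Fin Q => Collides Q S Y x a)).card ≤ Y.card * (8 * S) := by
  have hsub : Finset.univ.filter (fun a : Fin Q => Collides Q S Y x a) ⊆ Y.biUnion (fun y =>
        Finset.univ.filter (fun a : Fin Q => y ≠ x ∧ bucketHash Q S a y = bucketHash Q S a x)) := by
    intro a ha
    simp only [Finset.mem_filter, Finset.mem_univ, true_and, Finset.mem_biUnion] at ha ⊢
    exact ha
  refine (Finset.card_le_card hsub).trans (Finset.card_biUnion_le_card_mul _ _ _ ?_)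
  intro y hy
  have := hY y hy
  rcases lt_trichotomy y x with h | h | h
  · refine le_trans (Finset.card_le_card ?_) (card_bucketHash_eq_le (Q := Q) hS h (by omega))
    intro a ha
    simp only [Finset.mem_filter, Finset.mem_univ, true_and] at ha ⊢
    exact ha.2
  · simp [h]
  · refine le_trans (Finset.card_le_card ?_) (card_bucketHash_eq_le (Q := Q) hS h (by omega))
    intro a ha
    simp only [Finset.mem_filter, Finset.mem_univ, true_and] at ha ⊢
    exact ha.2.symm

end Hashing

end CoreMatching

/-! ### Fingerprints with a random modulus. -/

namespace CoreMatching

/-- The Karp–Rabin fingerprint modulo `M` with base `r` of the substring of length `L` at `i`. -/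
def fingerprint (X : ℕ → ℕ) (M r L i : ℕ) : ℕ :=
  (∑ j ∈ Finset.range L, X (i + j) * r ^ (L - 1 - j)) % M

section Fingerprint

open scoped Classical

theorem WindowEq.fingerprint_eq {X : ℕ → ℕ} {L i j : ℕ} (h : WindowEq X L i j) (M r : ℕ) :
    fingerprint X M r L i = fingerprint X M r L j := by
  unfold fingerprint
  congr 1
  exact Finset.sum_congr rfl fun t ht => by rw [h t (Finset.mem_range.1 ht)]

/-- Every residue class modulo `p` has at most `Q / p + 1` members below `Q`. -/
theorem card_natCast_mem_le {Q p : ℕ} (B : Finset (ZMod p)) :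
    (Finset.univ.filter (fun r : Fin Q => ((r : ℕ) : ZMod p) ∈ B)).card
      ≤ (Q / p + 1) * B.card := by
  set A := Finset.univ.filter (fun r : Fin Q => ((r : ℕ) : ZMod p) ∈ B) with hA
  have hfib : ∀ c ∈ A.image (fun r : Fin Q => ((r : ℕ) : ZMod p)),
      (A.filter (fun r : Fin Q => ((r : ℕ) : ZMod p) = c)).card ≤ Q / p + 1 := by
    intro c _
    rw [← Finset.card_range (Q / p + 1)]
    apply Finset.card_le_card_of_injOn (fun r : Fin Q => (r : ℕ) / p)
    · intro r _
      simp only [Finset.coe_range, Set.mem_Iio, Nat.lt_succ_iff]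
      exact Nat.div_le_div_right r.2.le
    · intro r hr r' hr' hrr
      simp only [Finset.coe_filter, Set.mem_ofPred_eq] at hr hr' hrr
      have h1 : ((r : ℕ) : ZMod p) = ((r' : ℕ) : ZMod p) := hr.2.trans hr'.2.symm
      rw [ZMod.natCast_eq_natCast_iff'] at h1
      apply Fin.ext
      rw [← Nat.div_add_mod (r : ℕ) p, ← Nat.div_add_mod (r' : ℕ) p, h1, hrr]
  refine (Finset.card_le_mul_card_image A _ hfib).trans
    (Nat.mul_le_mul_left _ (Finset.card_le_card ?_))
  intro c hc
  obtain ⟨r, hr, rfl⟩ := Finset.mem_image.1 hc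
  simp only [hA, Finset.mem_filter] at hr
  exact hr.2

/-- Different substrings rarely have equal fingerprints if the modulus has a large prime factor. -/
theorem card_fingerprint_eq_le {X : ℕ → ℕ} {Q p M L i j : ℕ} (hp : p.Prime) (hpM : p ∣ M)
    (hX : ∀ t, X t < p) (hne : ¬ WindowEq X L i j) :
    (Finset.univ.filter (fun r : Fin Q =>
      fingerprint X M (r % M) L i = fingerprint X M (r % M) L j)).card ≤ (Q / p + 1) * L := by
  have : Fact p.Prime := ⟨hp⟩
  -- Equal fingerprints modulo `M` make the base a root of the difference polynomial modulo `p`. It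
  -- is nonzero because symbols are smaller than `p`.
  set P : Polynomial (ZMod p) := ∑ t ∈ Finset.range L,
    Polynomial.C ((X (i + t) : ZMod p) - (X (j + t) : ZMod p)) * Polynomial.X ^ (L - 1 - t) with hP
  have hcoeff : ∀ t, t < L → P.coeff (L - 1 - t) = (X (i + t) : ZMod p) - (X (j + t) : ZMod p) := by
    intro t ht
    rw [hP, Polynomial.finsetSum_coeff, Finset.sum_eq_single t]
    · rw [Polynomial.coeff_C_mul_X_pow, if_pos rfl]
    · intro s hs hst
      rw [Finset.mem_range] at hs
      rw [Polynomial.coeff_C_mul_X_pow, if_neg (by omega)]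
    · intro h; exact absurd (Finset.mem_range.2 ht) h
  have hP0 : P ≠ 0 := by
    unfold WindowEq at hne
    push Not at hne
    obtain ⟨t, ht, hXt⟩ := hne
    intro h0
    have h1 := hcoeff t ht
    rw [h0, Polynomial.coeff_zero] at h1
    have h2 := (sub_eq_zero.1 h1.symm)
    rw [ZMod.natCast_eq_natCast_iff', Nat.mod_eq_of_lt (hX _), Nat.mod_eq_of_lt (hX _)] at h2
    exact hXt h2
  have hdeg : P.roots.toFinset.card ≤ L := by
    refine (Multiset.toFinset_card_le _).trans ((Polynomial.card_roots' P).trans ?_)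
    refine Polynomial.natDegree_sum_le_of_forall_le _ _ fun t _ => ?_
    exact (Polynomial.natDegree_C_mul_X_pow_le _ _).trans (by omega)
  refine le_trans (Finset.card_le_card ?_) ((card_natCast_mem_le (Q := Q)
    P.roots.toFinset).trans (Nat.mul_le_mul_left _ hdeg))
  intro r hr
  simp only [Finset.mem_filter, Finset.mem_univ, true_and] at hr ⊢
  rw [Multiset.mem_toFinset, Polynomial.mem_roots hP0, Polynomial.IsRoot.def]
  have hr' : (∑ t ∈ Finset.range L, X (i + t) * ((r : ℕ) % M) ^ (L - 1 - t))
      ≡ (∑ t ∈ Finset.range L, X (j + t) * ((r : ℕ) % M) ^ (L - 1 - t)) [MOD p] :=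
    Nat.ModEq.of_dvd hpM hr
  rw [← ZMod.natCast_eq_natCast_iff] at hr'
  push_cast at hr'
  -- Reducing the base modulo `M` first is harmless because `p ∣ M`.
  have hrM : (((r : ℕ) % M : ℕ) : ZMod p) = ((r : ℕ) : ZMod p) := by
    rw [ZMod.natCast_eq_natCast_iff']
    exact Nat.mod_mod_of_dvd _ hpM
  rw [hrM] at hr'
  rw [hP, Polynomial.eval_finsetSum]
  simp only [Polynomial.eval_mul, Polynomial.eval_C, Polynomial.eval_pow, Polynomial.eval_X,
    sub_mul, Finset.sum_sub_distrib]
  exact sub_eq_zero.2 hr'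

/-- The fingerprint distinguishes all substrings of length `L` that start before position `m`. -/
def FingerprintFaithful (X : ℕ → ℕ) (L m M r : ℕ) : Prop :=
  ∀ i j, i < m → j < m → fingerprint X M r L i = fingerprint X M r L j → WindowEq X L i j

/-- Union bound over the `m * m` pairs, each with at most `(Q / p + 1) * L ≤ 2 * (Q / p) * L` bad
bases. -/
theorem card_faithful_ge {X : ℕ → ℕ} {Q p M L m : ℕ} (hp : p.Prime) (hpM : p ∣ M)
    (hX : ∀ t, X t < p) (hpQ : p ≤ Q) (hm : 4 * (m * m * L) ≤ p) :
    Q ≤ 2 * (Finset.univ.filter (fun r : Fin Q => FingerprintFaithful X L m M (r % M))).card := by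
  set bad : ℕ × ℕ → Finset (Fin Q) := fun ij => Finset.univ.filter (fun r : Fin Q =>
    ¬ WindowEq X L ij.1 ij.2 ∧
      fingerprint X M (r % M) L ij.1 = fingerprint X M (r % M) L ij.2) with hbad
  have hcov : (Finset.univ : Finset (Fin Q)) ⊆
      Finset.univ.filter (fun r : Fin Q => FingerprintFaithful X L m M (r % M)) ∪
      (Finset.range m ×ˢ Finset.range m).biUnion bad := by
    intro r _
    by_cases h : FingerprintFaithful X L m M (r % M)
    · exact Finset.mem_union_left _ (Finset.mem_filter.2 ⟨Finset.mem_univ _, h⟩)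
    · unfold FingerprintFaithful at h
      push Not at h
      obtain ⟨i, j, hi, hj, he, hw⟩ := h
      refine Finset.mem_union_right _ (Finset.mem_biUnion.2 ⟨(i, j), ?_, ?_⟩)
      · exact Finset.mem_product.2 ⟨Finset.mem_range.2 hi, Finset.mem_range.2 hj⟩
      · exact Finset.mem_filter.2 ⟨Finset.mem_univ _, hw, he⟩
  have h1 := (Finset.card_le_card hcov).trans (Finset.card_union_le _ _)
  have h2 : ((Finset.range m ×ˢ Finset.range m).biUnion bad).card
      ≤ (Finset.range m ×ˢ Finset.range m).card * ((Q / p + 1) * L) := by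
    apply Finset.card_biUnion_le_card_mul
    rintro ⟨i, j⟩ _
    by_cases hw : WindowEq X L i j
    · simp [hbad, hw]
    · refine le_trans (Finset.card_le_card ?_) (card_fingerprint_eq_le (Q := Q) hp hpM hX hw)
      intro r hr
      simp only [hbad, Finset.mem_filter, Finset.mem_univ, true_and] at hr ⊢
      exact hr.2
  rw [Finset.card_product, Finset.card_range] at h2
  rw [Finset.card_univ, Fintype.card_fin] at h1
  have h3 : Q / p * p ≤ Q := Nat.div_mul_le_self Q p
  have h4 : 1 ≤ Q / p := (Nat.one_le_div_iff hp.pos).2 hpQ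
  have h5 : 2 * (m * m * ((Q / p + 1) * L)) ≤ Q := by
    have h6 : Q / p * (4 * (m * m * L)) ≤ Q := (Nat.mul_le_mul_left _ hm).trans h3
    have h7 : m * m * L ≤ Q / p * (m * m * L) := Nat.le_mul_of_pos_left _ h4
    calc 2 * (m * m * ((Q / p + 1) * L)) = 2 * (Q / p * (m * m * L)) + 2 * (m * m * L) := by ring
      _ ≤ Q / p * (4 * (m * m * L)) := by linarith
      _ ≤ Q := h6
  omega

/-- A random modulus below `2 ^ a` has a large prime factor with probability at least `1 / 2`. -/
theorem card_large_prime_factor_ge {W a Y : ℕ} (ha : 32 * Y + 2 < a) (haW : a ≤ W) :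
    2 ^ W ≤ 2 * (Finset.univ.filter (fun r : Fin (2 ^ W) =>
      ∃ p, p.Prime ∧ p ∣ (r : ℕ) % 2 ^ a + 1 ∧ 2 ^ Y ≤ p)).card := by
  set A := Finset.univ.filter (fun r : Fin (2 ^ W) =>
      ¬ ∃ p, p.Prime ∧ p ∣ (r : ℕ) % 2 ^ a + 1 ∧ 2 ^ Y ≤ p) with hA
  have hWa : 2 ^ W = 2 ^ a * 2 ^ (W - a) := by rw [← pow_add]; congr 1; omega
  have hpos : 0 < 2 ^ a := by positivity
  -- `2 ^ a` divides `2 ^ W`, so the low bits of a random word are uniform and the count of smooth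
  -- numbers carries over.
  have hfib : ∀ c ∈ A.image (fun r : Fin (2 ^ W) => (r : ℕ) % 2 ^ a + 1),
      (A.filter (fun r : Fin (2 ^ W) => (r : ℕ) % 2 ^ a + 1 = c)).card ≤ 2 ^ (W - a) := by
    intro c _
    rw [← Finset.card_range (2 ^ (W - a))]
    apply Finset.card_le_card_of_injOn (fun r : Fin (2 ^ W) => (r : ℕ) / 2 ^ a)
    · intro r _
      simp only [Finset.coe_range, Set.mem_Iio]
      rw [Nat.div_lt_iff_lt_mul hpos, mul_comm, ← hWa]
      exact r.2
    · intro r hr r' hr' hrr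
      simp only [Finset.coe_filter, Set.mem_ofPred_eq] at hr hr' hrr
      have h1 : (r : ℕ) % 2 ^ a = (r' : ℕ) % 2 ^ a := by
        have := hr.2.trans hr'.2.symm
        omega
      apply Fin.ext
      rw [← Nat.div_add_mod (r : ℕ) (2 ^ a), ← Nat.div_add_mod (r' : ℕ) (2 ^ a), h1, hrr]
  have h1 := Finset.card_le_mul_card_image (s := A)
    (f := fun r : Fin (2 ^ W) => (r : ℕ) % 2 ^ a + 1) _ hfib
  have h2 : A.image (fun r : Fin (2 ^ W) => (r : ℕ) % 2 ^ a + 1) ⊆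
      (Finset.Icc 1 (2 ^ a)).filter (fun M => ∀ p, p.Prime → p ∣ M → p < 2 ^ Y) := by
    intro c hc
    obtain ⟨r, hr, rfl⟩ := Finset.mem_image.1 hc
    simp only [hA, Finset.mem_filter, Finset.mem_univ, true_and] at hr
    push Not at hr
    have := Nat.mod_lt (r : ℕ) hpos
    exact Finset.mem_filter.2 ⟨Finset.mem_Icc.2 ⟨by omega, by omega⟩, hr⟩
  have h3 := card_smooth_le ha
  have h4 := Finset.card_le_card h2
  have h5 : 2 * A.card ≤ 2 ^ W := by
    calc 2 * A.card ≤ 2 * (2 ^ (W - a) * _) := Nat.mul_le_mul_left _ h1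
      _ ≤ 2 * (2 ^ (W - a) * _) := Nat.mul_le_mul_left _ (Nat.mul_le_mul_left _ h4)
      _ = 2 ^ (W - a) * (2 * _) := by ring
      _ ≤ 2 ^ (W - a) * 2 ^ a := Nat.mul_le_mul_left _ h3
      _ = 2 ^ W := by rw [hWa, mul_comm]
  have h6 := Finset.card_filter_add_card_filter_not (s := (Finset.univ : Finset (Fin (2 ^ W))))
    (fun r : Fin (2 ^ W) => ∃ p, p.Prime ∧ p ∣ (r : ℕ) % 2 ^ a + 1 ∧ 2 ^ Y ≤ p)
  rw [Finset.card_univ, Fintype.card_fin] at h6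
  have h7 : A.card = (Finset.univ.filter (fun r : Fin (2 ^ W) =>
      ¬ ∃ p, p.Prime ∧ p ∣ (r : ℕ) % 2 ^ a + 1 ∧ 2 ^ Y ≤ p)).card := by
    rw [hA]
  omega

end Fingerprint

end CoreMatching

/-! ### Minimal keys and the probability of a good seed. -/

namespace CoreMatching

/-- The first position up to `n` at which `φ` is minimal. -/
def argmin (φ : ℕ → ℕ) : ℕ → ℕ
  | 0 => 0
  | n + 1 => if φ (n + 1) < φ (argmin φ n) then n + 1 else argmin φ n

theorem argmin_le (φ : ℕ → ℕ) (n : ℕ) : argmin φ n ≤ n := by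
  induction n with
  | zero => exact le_rfl
  | succ n ih =>
    rw [argmin]
    split_ifs <;> omega

theorem apply_argmin_le (φ : ℕ → ℕ) (n : ℕ) : ∀ i ≤ n, φ (argmin φ n) ≤ φ i := by
  induction n with
  | zero => intro i hi; rw [Nat.le_zero.1 hi]; exact le_rfl
  | succ n ih =>
    intro i hi
    rw [argmin]
    rcases Nat.lt_or_ge n i with h | h
    · have : i = n + 1 := by omega
      subst this
      split_ifs with h'
      · exact le_rfl
      · omega
    · have := ih i h
      split_ifs with h'
      · omega
      · exact this

/-- The offset from `base` of the starting position whose key has the smallest hash value. -/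
def minPos (Q a b : ℕ) (key : ℕ → ℕ) (base cnt : ℕ) : ℕ :=
  argmin (fun i => wordHash Q a b (key (base + i))) cnt

/-- The key with the smallest hash value among those at `base, …, base + cnt`. -/
def minKey (Q a b : ℕ) (key : ℕ → ℕ) (base cnt : ℕ) : ℕ :=
  key (base + minPos Q a b key base cnt)

theorem minPos_le (Q a b : ℕ) (key : ℕ → ℕ) (base cnt : ℕ) : minPos Q a b key base cnt ≤ cnt :=
  argmin_le _ _

theorem minKey_mem (Q a b : ℕ) (key : ℕ → ℕ) (base cnt : ℕ) :
    minKey Q a b key base cnt ∈ (Finset.Icc base (base + cnt)).image key :=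
  Finset.mem_image_of_mem _ (Finset.mem_Icc.2 ⟨by omega, by
    have := minPos_le Q a b key base cnt; omega⟩)

theorem wordHash_minKey_le (Q a b : ℕ) (key : ℕ → ℕ) {base cnt : ℕ} :
    ∀ y ∈ (Finset.Icc base (base + cnt)).image key,
      wordHash Q a b (minKey Q a b key base cnt) ≤ wordHash Q a b y := by
  intro y hy
  obtain ⟨i, hi, rfl⟩ := Finset.mem_image.1 hy
  rw [Finset.mem_Icc] at hi
  have := apply_argmin_le (fun i => wordHash Q a b (key (base + i))) cnt (i - base) (by omega)
  simp only [show base + (i - base) = i by omega] at this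
  exact this

/-- If the hash function has a unique minimum on the keys of a window, attained inside a subwindow,
then both windows have this key as the minimal one. -/
theorem minKey_eq_of_unique {Q a b : ℕ} {key : ℕ → ℕ} {u k o l : ℕ} (ho : u ≤ o)
    (ho' : o + l ≤ u + k)
    (h : UniqueMin Q ((Finset.Icc u (u + k)).image key) ((Finset.Icc o (o + l)).image key) a b) :
    minKey Q a b key o l = minKey Q a b key u k := by
  obtain ⟨x, hx, hmin⟩ := h
  have hsub : (Finset.Icc o (o + l)).image key ⊆ (Finset.Icc u (u + k)).image key :=
    Finset.image_subset_image (Finset.Icc_subset_Icc ho ho')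
  have h1 : minKey Q a b key o l = x := by
    by_contra hne
    have := hmin _ (hsub (minKey_mem Q a b key o l)) hne
    have := wordHash_minKey_le Q a b key x hx
    omega
  have h2 : minKey Q a b key u k = x := by
    by_contra hne
    have := hmin _ (minKey_mem Q a b key u k) hne
    have := wordHash_minKey_le Q a b key x (hsub hx)
    omega
  rw [h1, h2]

/-- The fingerprint determined by the first two words of a seed. -/
def seedKey (A L : ℕ) (X d : ℕ → ℕ) (i : ℕ) : ℕ :=
  fingerprint X (d 0 % A + 1) (d 1 % (d 0 % A + 1)) L i

/-- No block with another minimal key than `x` has its minimal key in the bucket of `x`. -/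
def Separated (Q S l g Nb : ℕ) (key : ℕ → ℕ) (a b x c : ℕ) : Prop :=
  ∀ i < Nb, bucketHash Q S c (minKey Q a b key (i * l) g) = bucketHash Q S c x →
    minKey Q a b key (i * l) g = x

/-- The seed `d` makes the fingerprints faithful, makes the window of `2 * g + 1` starting positions
from `u` on have the same minimal key as the block from `o` on, and separates that key from the
minimal keys of all blocks with another one. -/
def SeedGood (Q A S L g m' Nb : ℕ) (X : ℕ → ℕ) (u o : ℕ) (d : ℕ → ℕ) : Prop :=
  FingerprintFaithful X L m' (d 0 % A + 1) (d 1 % (d 0 % A + 1)) ∧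
  minKey Q (d 2) (d 3) (seedKey A L X d) o g = minKey Q (d 2) (d 3) (seedKey A L X d) u (2 * g) ∧
  Separated Q S (g + 1) g Nb (seedKey A L X d) (d 2) (d 3)
    (minKey Q (d 2) (d 3) (seedKey A L X d) u (2 * g)) (d 4)

section Probability

open scoped Classical

/-- The chain rule for probabilities in counting form: `P` has probability at least `1 / k`, and `R`
has conditional probability at least `1 / l` for every outcome in `P`. -/
theorem card_dependent_ge {α β : Type*} [Fintype α] [Fintype β] {P : α → Prop}
    {R : α → β → Prop} {k l : ℕ}
    (hP : Fintype.card α ≤ k * (Finset.univ.filter P).card)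
    (hR : ∀ a, P a → Fintype.card β ≤ l * (Finset.univ.filter (R a)).card) :
    Fintype.card α * Fintype.card β
      ≤ k * l * (Finset.univ.filter (fun x : α × β => P x.1 ∧ R x.1 x.2)).card := by
  have h1 : (Finset.univ.filter (fun x : α × β => P x.1 ∧ R x.1 x.2))
      = ((Finset.univ.filter P).sigma (fun a => Finset.univ.filter (R a))).map
        (Equiv.sigmaEquivProd α β).toEmbedding := by
    ext ⟨a, b⟩
    simp
  rw [h1, Finset.card_map, Finset.card_sigma]
  calc Fintype.card α * Fintype.card β
      ≤ k * (Finset.univ.filter P).card * Fintype.card β := Nat.mul_le_mul_right _ hP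
    _ = k * ∑ a ∈ Finset.univ.filter P, Fintype.card β := by
        rw [Finset.sum_const, smul_eq_mul, mul_assoc]
    _ ≤ k * ∑ a ∈ Finset.univ.filter P, l * (Finset.univ.filter (R a)).card :=
        Nat.mul_le_mul_left _ (Finset.sum_le_sum fun a ha => hR a (Finset.mem_filter.1 ha).2)
    _ = _ := by rw [← Finset.mul_sum, mul_assoc]

theorem card_seed_faithful_ge {W a Y L m' : ℕ} {X : ℕ → ℕ} (ha : 32 * Y + 2 < a) (haW : a ≤ W)
    (hX : ∀ t, X t < 2 ^ Y) (hm : 4 * (m' * m' * L) ≤ 2 ^ Y) :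
    2 ^ W * 2 ^ W ≤ 4 * (Finset.univ.filter (fun s : Fin (2 ^ W) × Fin (2 ^ W) =>
      FingerprintFaithful X L m' (s.1 % 2 ^ a + 1) (s.2 % (s.1 % 2 ^ a + 1)))).card := by
  have h := card_dependent_ge (α := Fin (2 ^ W)) (β := Fin (2 ^ W))
    (P := fun r => ∃ p, p.Prime ∧ p ∣ (r : ℕ) % 2 ^ a + 1 ∧ 2 ^ Y ≤ p)
    (R := fun M r => FingerprintFaithful X L m' ((M : ℕ) % 2 ^ a + 1) ((r : ℕ) % (M % 2 ^ a + 1)))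
    (k := 2) (l := 2)
    (by rw [Fintype.card_fin]; exact card_large_prime_factor_ge ha haW)
    (by
      rintro M ⟨p, hp, hpM, hYp⟩
      rw [Fintype.card_fin]
      refine card_faithful_ge hp hpM (fun t => (hX t).trans_le hYp) ?_ (hm.trans hYp)
      have h1 := Nat.le_of_dvd (Nat.succ_pos _) hpM
      have h2 := Nat.mod_lt (M : ℕ) (show 0 < 2 ^ a by positivity)
      have h3 : 2 ^ a ≤ 2 ^ W := Nat.pow_le_pow_right (by norm_num) haW
      omega)
  rw [Fintype.card_fin] at h
  refine h.trans (Nat.mul_le_mul_left _ (Finset.card_le_card ?_))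
  intro s hs
  simp only [Finset.mem_filter, Finset.mem_univ, true_and] at hs ⊢
  exact hs.2

/-- There are at most `Nb` minimal keys of blocks; each collides with `x` for at most `8 * S`
multipliers, in total at most half of them. -/
theorem card_separated_ge {Q S D l g Nb a b x : ℕ} {key : ℕ → ℕ} (hK : ∀ i, key i < D)
    (hx : x < D) (hS0 : 0 < S) (hS : D ≤ 2 * S) (hNb : 2 * (Nb * (8 * S)) ≤ Q) :
    Q ≤ 2 * (Finset.univ.filter (fun c : Fin Q => Separated Q S l g Nb key a b x c)).card := by
  set Y := (Finset.range Nb).image (fun i => minKey Q a b key (i * l) g) with hY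
  have h4 := card_bucketHash_collision_le (Q := Q) hS0 Y hx
    (by
      intro y hy
      obtain ⟨i, -, rfl⟩ := Finset.mem_image.1 hy
      exact hK _) hS
  have h5 : Y.card ≤ Nb := Finset.card_image_le.trans (Finset.card_range _).le
  have h6 := h4.trans (Nat.mul_le_mul_right _ h5)
  have h7 := Finset.card_filter_add_card_filter_not (s := (Finset.univ : Finset (Fin Q)))
    (fun c : Fin Q => Collides Q S Y x c)
  rw [Finset.card_univ, Fintype.card_fin] at h7
  have h8 : Finset.univ.filter (fun c : Fin Q => ¬ Collides Q S Y x c) ⊆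
      Finset.univ.filter (fun c : Fin Q => Separated Q S l g Nb key a b x c) := by
    intro c hc
    rw [Finset.mem_filter] at hc ⊢
    refine ⟨Finset.mem_univ _, fun i hi he => ?_⟩
    by_contra hne
    exact hc.2 ⟨_, Finset.mem_image_of_mem _ (Finset.mem_range.2 hi), hne, he⟩
  have h9 := Finset.card_le_card h8
  omega

/-- The five words are exposed in the order fingerprint, ordering hash, bucket hash. The keys are
fixed before they are ordered, and the minima before they are put into buckets. The factors are `4 *
64 * 2 = 512`. -/
theorem card_good_keys_ge {Q S D l g Nb u o : ℕ} (K : Fin Q × Fin Q → ℕ → ℕ)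
    {F : Fin Q × Fin Q → Prop} (hF : Q * Q ≤ 4 * (Finset.univ.filter F).card)
    (hK : ∀ s i, K s i < D) (hD : 0 < D) (ho : u ≤ o) (ho' : o + g ≤ u + 2 * g)
    (hcard : ∀ s, F s → ((Finset.Icc u (u + 2 * g)).image (K s)).card
      ≤ 2 * ((Finset.Icc o (o + g)).image (K s)).card)
    (hgW : 8 * (2 * g + 1) * D ≤ Q) (hS : D ≤ 2 * S) (hNb : 2 * (Nb * (8 * S)) ≤ Q) :
    Q ^ 5 ≤ 512 * (Finset.univ.filter
      (fun s : ((Fin Q × Fin Q) × (Fin Q × Fin Q)) × Fin Q =>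
        (F s.1.1 ∧ UniqueMin Q ((Finset.Icc u (u + 2 * g)).image (K s.1.1))
          ((Finset.Icc o (o + g)).image (K s.1.1)) s.1.2.1 s.1.2.2) ∧
        Separated Q S l g Nb (K s.1.1) s.1.2.1 s.1.2.2
          (minKey Q s.1.2.1 s.1.2.2 (K s.1.1) u (2 * g)) s.2)).card := by
  have hS0 : 0 < S := by omega
  have h12 := card_dependent_ge (P := F)
    (R := fun s (t : Fin Q × Fin Q) => UniqueMin Q ((Finset.Icc u (u + 2 * g)).image (K s))
          ((Finset.Icc o (o + g)).image (K s)) t.1 t.2)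
    (k := 4) (l := 64)
    (by rw [Fintype.card_prod, Fintype.card_fin]; exact hF)
    (by
      intro s hs
      rw [Fintype.card_prod, Fintype.card_fin]
      refine card_unique_min_ge (D := D)
        (Finset.image_subset_image (Finset.Icc_subset_Icc ho ho'))
        ((Finset.nonempty_Icc.2 (by omega)).image _) (hcard s hs) ?_ ?_
      · intro x hx
        obtain ⟨i, -, rfl⟩ := Finset.mem_image.1 hx
        exact hK s i
      · refine le_trans (Nat.mul_le_mul_right _ (Nat.mul_le_mul_left _ ?_)) hgW
        refine Finset.card_image_le.trans ?_
        rw [Nat.card_Icc]; omega)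
  rw [← Fintype.card_prod] at h12
  have h3 := card_dependent_ge
    (P := fun s : (Fin Q × Fin Q) × (Fin Q × Fin Q) => F s.1 ∧
      UniqueMin Q ((Finset.Icc u (u + 2 * g)).image (K s.1))
        ((Finset.Icc o (o + g)).image (K s.1)) s.2.1 s.2.2)
    (R := fun (s : (Fin Q × Fin Q) × (Fin Q × Fin Q)) (c : Fin Q) => Separated Q S l g Nb (K s.1) s.2.1 s.2.2
          (minKey Q s.2.1 s.2.2 (K s.1) u (2 * g)) c)
    (k := 4 * 64) (l := 2) (by convert h12)
    (by
      intro s _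
      rw [Fintype.card_fin]
      exact card_separated_ge (hK _) (hK _ _) hS0 hS hNb)
  simp only [Fintype.card_prod, Fintype.card_fin] at h3
  calc Q ^ 5 = Q * Q * (Q * Q) * Q := by ring
    _ ≤ _ := by convert h3

/-- The window number `v` is chosen before the seed: it depends on the string and on `p` only. This
makes the later union bound over positions possible. -/
theorem card_seedGood_ge {W a Y S L g m' Nb p : ℕ} {X : ℕ → ℕ}
    (ha : 32 * Y + 2 < a) (haW : a ≤ W) (hX : ∀ t, X t < 2 ^ Y) (hm : 4 * (m' * m' * L) ≤ 2 ^ Y)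
    (hg : 10 * g ≤ L) (hp : p + 6 * g < m') (hgW : 8 * (2 * g + 1) * 2 ^ a ≤ 2 ^ W)
    (hS : 2 ^ a ≤ 2 * S) (hNb : 2 * (Nb * (8 * S)) ≤ 2 ^ W) :
    ∃ v, v < 3 ∧ ∀ o, p + 2 * g * v ≤ o → o + g ≤ p + 2 * g * v + 2 * g →
      (2 ^ W) ^ 5 ≤ 512 * (Finset.univ.filter (fun d : Fin 5 → Fin (2 ^ W) =>
        SeedGood (2 ^ W) (2 ^ a) S L g m' Nb X (p + 2 * g * v) o (toArray d))).card := by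
  obtain ⟨v, hv, hpure⟩ := exists_pure_window X (g := g) (L := L) (p := p) hg
  refine ⟨v, hv, fun o ho ho' => ?_⟩
  have hv2 : 2 * g * v ≤ 2 * g * 2 := Nat.mul_le_mul_left _ (by omega)
  have hfaith := card_seed_faithful_ge (L := L) ha haW hX hm
  have hA : 0 < 2 ^ a := by positivity
  generalize 2 ^ W = Q at *
  generalize 2 ^ a = A at *
  have h := card_good_keys_ge (l := g + 1) (Nb := Nb) (S := S)
    (fun s i => fingerprint X (s.1 % A + 1) (s.2 % (s.1 % A + 1)) L i) hfaith
    (fun s i => by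
      have h1 : fingerprint X (s.1 % A + 1) (s.2 % (s.1 % A + 1)) L i < s.1 % A + 1 :=
        Nat.mod_lt _ (Nat.succ_pos _)
      have := Nat.mod_lt (s.1 : ℕ) hA
      omega) hA ho ho'
    -- A faithful fingerprint is equal exactly on equal substrings, so it is an admissible labelling
    -- for the pure window.
    (fun s hs => hpure _ (fun i j _ _ hi hj =>
      ⟨hs i j (by omega) (by omega), fun h => h.fingerprint_eq _ _⟩) o ho ho') hgW hS hNb
  refine h.trans (Nat.mul_le_mul_left _ (Finset.card_le_card_of_injOn
        (fun s => ![s.1.1.1, s.1.1.2, s.1.2.1, s.1.2.2, s.2]) ?_ ?_))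
  · rintro ⟨⟨⟨M, r⟩, ⟨x, y⟩⟩, c⟩ hs
    simp only [Finset.coe_filter, Finset.mem_univ, true_and, Set.mem_ofPred_eq] at hs ⊢
    exact ⟨hs.1.1, minKey_eq_of_unique ho ho' hs.1.2, hs.2⟩
  · rintro ⟨⟨⟨M, r⟩, ⟨x, y⟩⟩, c⟩ _ ⟨⟨⟨M', r'⟩, ⟨x', y'⟩⟩, c'⟩ _ h
    have h0 : M = M' := congrFun h 0
    have h1 : r = r' := congrFun h 1
    have h2 : x = x' := congrFun h 2
    have h3 : y = y' := congrFun h 3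
    have h4 : c = c' := congrFun h 4
    rw [h0, h1, h2, h3, h4]

end Probability

end CoreMatching

/-! ### Amplification by independent seeds. -/

namespace CoreMatching

section Amplification

open scoped Classical

/-- Independence: injectivity of `e` means that different `i` read disjoint coordinates; the
coordinates outside its range are free. -/
theorem card_forall_mem_le {ι κ α F : Type*} [Fintype ι] [Fintype κ] [Fintype α] [Fintype F]
    [DecidableEq ι] [DecidableEq κ] [DecidableEq α] (e : ι × κ → α) (he : Function.Injective e) (B : Finset (κ → F)) :
    (Finset.univ.filter (fun ω : α → F => ∀ i, (fun t => ω (e (i, t))) ∈ B)).card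
      ≤ B.card ^ Fintype.card ι
        * Fintype.card F ^ (Fintype.card α - Fintype.card ι * Fintype.card κ) := by
  have hcompl : Fintype.card {x : α // x ∉ Set.range e}
      = Fintype.card α - Fintype.card ι * Fintype.card κ := by
    rw [Fintype.card_subtype_compl (fun x => x ∈ Set.range e), ← Fintype.card_prod]
    congr 1
    rw [← Set.card_range_of_injective he]
  have hpi : (Fintype.piFinset fun _ : ι => B).card = B.card ^ Fintype.card ι := by
    rw [Fintype.card_piFinset, Finset.prod_const, Finset.card_univ]
  rw [← hcompl, ← Fintype.card_fun, ← Finset.card_univ (α := _ → F), ← hpi, ← Finset.card_product]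
  apply Finset.card_le_card_of_injOn (fun ω => (fun i t => ω (e (i, t)), fun x => ω x.1))
  · intro ω hω
    simp only [Finset.coe_filter, Finset.mem_univ, true_and, Set.mem_ofPred_eq] at hω
    simp only [Finset.coe_product, Set.mem_prod, Finset.mem_coe, Fintype.mem_piFinset,
      Finset.mem_univ, and_true]
    exact hω
  · intro ω _ ω' _ h
    rw [Prod.mk.injEq] at h
    funext x
    by_cases hx : x ∈ Set.range e
    · obtain ⟨⟨i, t⟩, rfl⟩ := hx
      exact congrFun (congrFun h.1 i) t
    · exact congrFun h.2 ⟨x, hx⟩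

-- `(511 / 512) ^ 1024` is about `exp (-2)`, which is below `1 / 4`.
set_option exponentiation.threshold 1024 in
theorem four_mul_pow_le : 4 * 511 ^ 1024 ≤ 512 ^ 1024 := by norm_num

/-- Among `1024 * err` independent seeds, none is good for some of at most `2 ^ err` positions with
probability at most `2 ^ (-err)`. -/
theorem card_some_never_good_le {len Q m err : ℕ} (G : ℕ → (Fin 5 → Fin Q) → Prop) (v : ℕ → ℕ)
    (hv : ∀ p, p < m → v p < 3)
    (hG : ∀ p, p < m → Q ^ 5 ≤ 512 * (Finset.univ.filter (G p)).card) (hm : m ≤ 2 ^ err)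
    (hlen : 5 * (3 * (1024 * err)) ≤ len) :
    2 ^ err * (Finset.univ.filter (fun ω : Fin len → Fin Q => ∃ p, ∃ h : p < m,
      ∀ j : Fin (1024 * err), ¬ G p (fun t => ω ⟨5 * (3 * j + v p) + t, by
        have := hv p h; omega⟩))).card ≤ Q ^ len := by
  set J := 1024 * err with hJ
  have hbad : ∀ p, p < m → 512 * (Finset.univ.filter (fun d => ¬ G p d)).card ≤ 511 * Q ^ 5 := by
    intro p hp
    have h1 := Finset.card_filter_add_card_filter_not (s := (Finset.univ : Finset (Fin 5 → Fin Q)))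
      (G p)
    rw [Finset.card_univ, Fintype.card_fun, Fintype.card_fin, Fintype.card_fin] at h1
    have := hG p hp
    omega
  -- For position `p` only the seeds numbered `3 * j + v p` count: those are the functions tied to
  -- its window.
  let e : ∀ p, p < m → Fin J × Fin 5 → Fin len := fun p hp x =>
    ⟨5 * (3 * x.1 + v p) + x.2, by have := hv p hp; omega⟩
  have he : ∀ p hp, Function.Injective (e p hp) := by
    rintro p hp ⟨i, t⟩ ⟨i', t'⟩ h
    have h1 : 5 * (3 * (i : ℕ) + v p) + t = 5 * (3 * (i' : ℕ) + v p) + t' :=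
      congrArg Fin.val h
    have h2 := t.2
    have h3 := t'.2
    have h4 : i = i' := Fin.ext (by omega)
    have h5 : t = t' := Fin.ext (by omega)
    rw [h4, h5]
  have hone : ∀ p (hp : p < m), 4 ^ err * (Finset.univ.filter (fun ω : Fin len → Fin Q =>
      ∀ j : Fin J, (fun t => ω (e p hp (j, t))) ∈ Finset.univ.filter (fun d => ¬ G p d))).card
        ≤ Q ^ len := by
    intro p hp
    have h1 := card_forall_mem_le (F := Fin Q) (e p hp) (he p hp)
      (Finset.univ.filter (fun d => ¬ G p d))
    simp only [Fintype.card_fin] at h1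
    have h2 := Nat.pow_le_pow_left (hbad p hp) J
    rw [mul_pow, mul_pow] at h2
    -- A fixed position fails with probability at most `4 ^ (-err)`; half of the exponent is spent
    -- on the union bound over the positions.
    have h3 : 4 ^ err * 511 ^ J ≤ 512 ^ J := by
      rw [hJ, pow_mul, pow_mul, ← mul_pow]
      exact Nat.pow_le_pow_left four_mul_pow_le err
    have h4 : 4 ^ err * (Finset.univ.filter (fun d => ¬ G p d)).card ^ J ≤ (Q ^ 5) ^ J := by
      refine Nat.le_of_mul_le_mul_left ?_ (show 0 < 512 ^ J by positivity)
      calc 512 ^ J * (4 ^ err * (Finset.univ.filter (fun d => ¬ G p d)).card ^ J)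
          = 4 ^ err * (512 ^ J * (Finset.univ.filter (fun d => ¬ G p d)).card ^ J) := by ring
        _ ≤ 4 ^ err * (511 ^ J * (Q ^ 5) ^ J) := Nat.mul_le_mul_left _ h2
        _ = 4 ^ err * 511 ^ J * (Q ^ 5) ^ J := by ring
        _ ≤ 512 ^ J * (Q ^ 5) ^ J := Nat.mul_le_mul_right _ h3
    calc _ ≤ 4 ^ err * _ := Nat.mul_le_mul_left _ (le_of_eq_of_le (by congr) h1)
      _ = 4 ^ err * (Finset.univ.filter (fun d => ¬ G p d)).card ^ J * Q ^ (len - J * 5) := by ring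
      _ ≤ (Q ^ 5) ^ J * Q ^ (len - J * 5) := Nat.mul_le_mul_right _ h4
      _ = Q ^ len := by
        rw [← pow_mul, ← pow_add]
        congr 1
        omega
  have hunion : Finset.univ.filter (fun ω : Fin len → Fin Q => ∃ p, ∃ h : p < m,
      ∀ j : Fin J, ¬ G p (fun t => ω ⟨5 * (3 * j + v p) + t, by
        have := hv p h; omega⟩)) ⊆
      (Finset.univ : Finset (Fin m)).biUnion (fun p => Finset.univ.filter
        (fun ω : Fin len → Fin Q => ∀ j : Fin J, (fun t => ω (e p p.2 (j, t))) ∈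
          Finset.univ.filter (fun d => ¬ G p d))) := by
    intro ω hω
    simp only [Finset.mem_filter, Finset.mem_univ, true_and, Finset.mem_biUnion] at hω ⊢
    obtain ⟨p, hp, h⟩ := hω
    exact ⟨⟨p, hp⟩, h⟩
  have h1 := (Finset.card_le_card hunion).trans Finset.card_biUnion_le
  calc _ ≤ 2 ^ err * _ := Nat.mul_le_mul_left _ h1
    _ ≤ Q ^ len := by
      refine Nat.le_of_mul_le_mul_left ?_ (show 0 < 2 ^ err by positivity)
      calc _ = ∑ p : Fin m, 4 ^ err * (Finset.univ.filter (fun ω : Fin len → Fin Q =>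
            ∀ j : Fin J, (fun t => ω (e p p.2 (j, t))) ∈
              Finset.univ.filter (fun d => ¬ G p d))).card := by
            rw [← mul_assoc, ← mul_pow, Finset.mul_sum, show 2 * 2 = 4 from rfl]
        _ ≤ ∑ p : Fin m, Q ^ len := Finset.sum_le_sum fun p _ => hone p p.2
        _ = m * Q ^ len := by simp
        _ ≤ 2 ^ err * Q ^ len := Nat.mul_le_mul_right _ hm

end Amplification

end CoreMatching

/-! ### Reasoning rules for programs. -/

namespace WordRAM

@[simp] theorem State.reg_set (s : State) (d v r : ℕ) :
    (s.set d v).reg r = if r = d then v else s.reg r := by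
  simp [State.set, Function.update_apply]

@[simp] theorem State.mem_set (s : State) (d v : ℕ) : (s.set d v).mem = s.mem := rfl

@[simp] theorem State.used_set (s : State) (d v : ℕ) : (s.set d v).used = s.used := rfl

@[simp] theorem State.asked_set (s : State) (d v : ℕ) : (s.set d v).asked = s.asked := rfl

/-- Started in state `s`, the program `p` halts within `T` steps in a state that satisfies `Q`. -/
def Runs (M : Machine) (p : Cmd) (s : State) (T : ℕ) (Q : State → Prop) : Prop :=
  ∃ t s', Exec M p s t s' ∧ t ≤ T ∧ Q s'

/-- Sequential composition of a list of programs. -/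
def seqs : List Cmd → Cmd
  | [] => .skip
  | c :: l => .seq c (seqs l)

variable {M : Machine} {s : State} {T : ℕ} {Q : State → Prop} {l : List Cmd}

theorem Runs.mono {p : Cmd} {T' : ℕ} {Q' : State → Prop} (h : Runs M p s T Q) (hT : T ≤ T')
    (hQ : ∀ s', Q s' → Q' s') : Runs M p s T' Q' := by
  obtain ⟨t, s', he, ht, hq⟩ := h
  exact ⟨t, s', he, ht.trans hT, hQ _ hq⟩

theorem runs_nil (h : Q s) : Runs M (seqs []) s 1 Q := ⟨1, s, .skip s, le_rfl, h⟩

theorem runs_cons {p : Cmd} {T₁ : ℕ} {Q₁ : State → Prop} (h : Runs M p s T₁ Q₁)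
    (h' : ∀ s', Q₁ s' → Runs M (seqs l) s' T Q) : Runs M (seqs (p :: l)) s (T₁ + T) Q := by
  obtain ⟨t, s', he, ht, hq⟩ := h
  obtain ⟨t', s'', he', ht', hq'⟩ := h' s' hq
  exact ⟨t + t', s'', .seq he he', Nat.add_le_add ht ht', hq'⟩

theorem runs_step {p : Cmd} {s' : State} (h : Exec M p s 1 s') (h' : Runs M (seqs l) s' T Q) :
    Runs M (seqs (p :: l)) s (T + 1) Q := by
  obtain ⟨t', s'', he', ht', hq'⟩ := h'
  exact ⟨1 + t', s'', .seq h he', by omega, hq'⟩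

theorem runs_const {d v : ℕ} (h : Runs M (seqs l) (s.set d (v % 2 ^ M.width)) T Q) :
    Runs M (seqs (.const d v :: l)) s (T + 1) Q := runs_step (.const s d v) h

theorem runs_op {o : Op} {d a b : ℕ}
    (h : Runs M (seqs l) (s.set d (o.eval M.width (s.reg a) (s.reg b))) T Q) :
    Runs M (seqs (.op o d a b :: l)) s (T + 1) Q := runs_step (.op s o d a b) h

/-- Lets the exact value `v` be recorded, so that each absence of overflow is proved once, at its
own instruction. -/
theorem runs_op_eq {o : Op} {d a b : ℕ} (v : ℕ) (hv : o.eval M.width (s.reg a) (s.reg b) = v)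
    (h : Runs M (seqs l) (s.set d v) T Q) : Runs M (seqs (.op o d a b :: l)) s (T + 1) Q :=
  runs_op (hv ▸ h)

theorem runs_readData {d a : ℕ} (h : Runs M (seqs l) (s.set d (M.data (s.reg a))) T Q) :
    Runs M (seqs (.readData d a :: l)) s (T + 1) Q := runs_step (.readData s d a) h

theorem runs_ite {a : ℕ} {p q : Cmd} (h : s.reg a ≠ 0 → Runs M p s T Q)
    (h' : s.reg a = 0 → Runs M q s T Q) : Runs M (.ite a p q) s (T + 1) Q := by
  by_cases ha : s.reg a = 0
  · obtain ⟨t, s', he, ht, hq⟩ := h' ha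
    exact ⟨t + 1, s', .ite_false ha he, by omega, hq⟩
  · obtain ⟨t, s', he, ht, hq⟩ := h ha
    exact ⟨t + 1, s', .ite_true ha he, by omega, hq⟩

/-- The rule for a counting loop with invariant `I`. -/
theorem runs_loop {a : ℕ} {p : Cmd} {I : ℕ → State → Prop} (h0 : ∀ s, I 0 s → s.reg a = 0)
    (hstep : ∀ j s, I (j + 1) s → s.reg a ≠ 0 ∧ Runs M p s T (I j)) :
    ∀ j s, I j s → Runs M (.loop a p) s (j * (T + 1) + 1) (I 0) := by
  intro j
  induction j with
  | zero => intro s h; exact ⟨1, s, .loop_done (h0 s h), by omega, h⟩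
  | succ j ih =>
    intro s h
    obtain ⟨ha, t, s', he, ht, hq⟩ := hstep j s h
    obtain ⟨t', s'', he', ht', hq'⟩ := ih s' hq
    refine ⟨t + t' + 1, s'', .loop_step ha he he', ?_, hq'⟩
    rw [Nat.succ_mul]
    omega

/-- The states `s` and `s'` differ at most in registers from `k` on. -/
structure Frame (k : ℕ) (s s' : State) : Prop where
  reg : ∀ r < k, s'.reg r = s.reg r
  mem : s'.mem = s.mem
  used : s'.used = s.used
  asked : s'.asked = s.asked

theorem Frame.refl (k : ℕ) (s : State) : Frame k s s := ⟨fun _ _ => rfl, rfl, rfl, rfl⟩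

theorem Frame.set {k : ℕ} {s s' : State} (h : Frame k s s') {d v : ℕ} (hd : k ≤ d) :
    Frame k s (s'.set d v) := by
  refine ⟨fun r hr => ?_, h.mem, h.used, h.asked⟩
  rw [State.reg_set, if_neg (by omega)]
  exact h.reg r hr

theorem Frame.trans {k : ℕ} {s s' s'' : State} (h : Frame k s s') (h' : Frame k s' s'') :
    Frame k s s'' :=
  ⟨fun r hr => (h'.reg r hr).trans (h.reg r hr), h'.mem.trans h.mem, h'.used.trans h.used,
    h'.asked.trans h.asked⟩

theorem Frame.mono {k k' : ℕ} {s s' : State} (h : Frame k s s') (hk : k' ≤ k) : Frame k' s s' :=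
  ⟨fun r hr => h.reg r (by omega), h.mem, h.used, h.asked⟩

theorem sub_one_word {W j : ℕ} (hj : j + 1 ≤ 2 ^ W) : (j + 1 + (2 ^ W - 1)) % 2 ^ W = j := by
  rw [show j + 1 + (2 ^ W - 1) = j + 2 ^ W by omega, Nat.add_mod_right, Nat.mod_eq_of_lt (by omega)]

theorem sub_word {W x y : ℕ} (hy : y ≤ x) (hx : x < 2 ^ W) :
    (x + (2 ^ W - y)) % 2 ^ W = x - y := by
  rw [show x + (2 ^ W - y) = x - y + 2 ^ W by omega, Nat.add_mod_right,
    Nat.mod_eq_of_lt (by omega)]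

end WordRAM

/-! ### Linear-time search for the minimal key with rolling fingerprints. -/

namespace CoreMatching

open WordRAM

theorem fingerprint_zero (X : ℕ → ℕ) (M r i : ℕ) : fingerprint X M r 0 i = 0 := by
  simp [fingerprint]

theorem sum_range_succ_mul_pow (X : ℕ → ℕ) (r L i : ℕ) :
    ∑ j ∈ Finset.range (L + 1), X (i + j) * r ^ (L - j)
      = (∑ j ∈ Finset.range L, X (i + j) * r ^ (L - 1 - j)) * r + X (i + L) := by
  rw [Finset.sum_range_succ, Finset.sum_mul]
  congr 1
  · refine Finset.sum_congr rfl fun j hj => ?_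
    rw [Finset.mem_range] at hj
    rw [mul_assoc, ← pow_succ]
    congr 2
    omega
  · simp

theorem fingerprint_succ (X : ℕ → ℕ) (M r L i : ℕ) :
    fingerprint X M r (L + 1) i = (fingerprint X M r L i * r + X (i + L)) % M := by
  unfold fingerprint
  rw [Nat.add_sub_cancel, sum_range_succ_mul_pow]
  exact Nat.ModEq.add_right _ (Nat.ModEq.mul_right _ (Nat.mod_modEq _ _).symm)

/-- Appending a symbol multiplies by `r` and adds it; the leading symbol then has weight `r ^ L` and
is removed. Adding `M` minus its residue avoids a negative difference. -/
theorem fingerprint_roll {X : ℕ → ℕ} {M : ℕ} (r L i : ℕ) (hM : 0 < M) :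
    fingerprint X M r L (i + 1)
      = (fingerprint X M r L i * r + X (i + L) + (M - X i * (r ^ L % M) % M)) % M := by
  unfold fingerprint
  have h1 := sum_range_succ_mul_pow X r L i
  rw [Finset.sum_range_succ'] at h1
  have h2 : ∑ j ∈ Finset.range L, X (i + (j + 1)) * r ^ (L - (j + 1))
      = ∑ j ∈ Finset.range L, X (i + 1 + j) * r ^ (L - 1 - j) := by
    refine Finset.sum_congr rfl fun j _ => ?_
    rw [show i + (j + 1) = i + 1 + j by omega, show L - (j + 1) = L - 1 - j by omega]
  rw [h2, add_zero, Nat.sub_zero] at h1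
  set S := ∑ j ∈ Finset.range L, X (i + j) * r ^ (L - 1 - j)
  set S' := ∑ j ∈ Finset.range L, X (i + 1 + j) * r ^ (L - 1 - j)
  have hlt : X i * (r ^ L % M) % M < M := Nat.mod_lt _ hM
  apply Nat.ModEq.add_right_cancel' (X i * (r ^ L % M) % M)
  calc S' + X i * (r ^ L % M) % M ≡ S' + X i * r ^ L [MOD M] :=
        Nat.ModEq.add_left _ ((Nat.mod_modEq _ _).trans (Nat.ModEq.mul_left _ (Nat.mod_modEq _ _)))
    _ = S * r + X (i + L) := h1
    _ ≡ S * r + X (i + L) + M [MOD M] := (Nat.add_modEq_right).symm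
    _ ≡ S % M * r + X (i + L) + M [MOD M] := Nat.ModEq.add_right _ (Nat.ModEq.add_right _
        (Nat.ModEq.mul_right _ (Nat.mod_modEq _ _).symm))
    _ = S % M * r + X (i + L) + (M - X i * (r ^ L % M) % M) + X i * (r ^ L % M) % M := by omega

/-- One step of the evaluation of a fingerprint by Horner's rule. -/
def hornerBody (rd : ℕ → ℕ → Cmd) : Cmd :=
  seqs [rd 44 43, .op .mul 40 40 33, .op .add 40 40 44, .op .mod 40 40 32, .op .mul 41 41 33,
    .op .mod 41 41 32, .op .add 43 43 9, .op .sub 42 42 9]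

/-- One step of the search for the minimal key: update the fingerprint and compare. -/
def rollBody (rd : ℕ → ℕ → Cmd) : Cmd :=
  seqs [rd 44 46, .op .mul 45 44 41, .op .mod 45 45 32, .op .sub 45 32 45, .op .mul 40 40 33,
    rd 44 43, .op .add 40 40 44, .op .add 40 40 45, .op .mod 40 40 32, .op .add 43 43 9,
    .op .add 46 46 9, .op .add 50 50 9, .op .sub 42 42 9, .op .mul 51 34 40, .op .add 51 51 35,
    .op .lt 52 51 49,
    .ite 52 (seqs [.op .or 49 51 51, .op .or 47 40 40, .op .or 48 50 50]) (seqs [])]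

/-- The search for the minimal key in a window of an array that is accessed by `rd`. Registers: `9`
holds the number `1`, `12` the length of the substrings, `30` the first position of the window, `31`
the number of further positions, `32` and `33` the modulus and the base of the fingerprint, `34` and
`35` the parameters of the hash function. The minimal key is left in `47`, its offset in `48`. -/
def scan (rd : ℕ → ℕ → Cmd) : Cmd :=
  seqs [.const 40 0, .const 41 1, .op .mod 41 41 32, .op .or 42 12 12, .op .or 43 30 30,
    .loop 42 (hornerBody rd), .op .mul 49 34 40, .op .add 49 49 35, .op .or 47 40 40, .const 48 0,
    .const 50 0, .op .or 46 30 30, .op .or 42 31 31, .loop 42 (rollBody rd)]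

/-- The parameters of a search are in the registers, and there is no overflow. -/
structure ScanInput (W D : ℕ) (X : ℕ → ℕ) (L base cnt M r a b : ℕ) (s : State) : Prop where
  one : s.reg 9 = 1
  len : s.reg 12 = L
  start : s.reg 30 = base
  further : s.reg 31 = cnt
  modulus : s.reg 32 = M
  radix : s.reg 33 = r
  fst : s.reg 34 = a
  snd : s.reg 35 = b
  pos : 0 < M
  radix_lt : r < M
  modulus_le : M ≤ D
  symbol_lt : ∀ i, X i < D
  bound : D * D + 3 * D < 2 ^ W
  range : base + L + cnt < 2 ^ W

theorem ScanInput.of_frame {W D : ℕ} {X : ℕ → ℕ} {L base cnt M r a b : ℕ} {s s' : State}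
    (h : ScanInput W D X L base cnt M r a b s) (hf : Frame 40 s s') :
    ScanInput W D X L base cnt M r a b s' where
  one := (hf.reg _ (by norm_num)).trans h.one
  len := (hf.reg _ (by norm_num)).trans h.len
  start := (hf.reg _ (by norm_num)).trans h.start
  further := (hf.reg _ (by norm_num)).trans h.further
  modulus := (hf.reg _ (by norm_num)).trans h.modulus
  radix := (hf.reg _ (by norm_num)).trans h.radix
  fst := (hf.reg _ (by norm_num)).trans h.fst
  snd := (hf.reg _ (by norm_num)).trans h.snd
  pos := h.pos
  radix_lt := h.radix_lt
  modulus_le := h.modulus_le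
  symbol_lt := h.symbol_lt
  bound := h.bound
  range := h.range

variable {M : Machine} {rd : ℕ → ℕ → Cmd} {X : ℕ → ℕ} {D L base cnt p r a b : ℕ} {s₀ : State}

/-- The invariant of the evaluation of the first fingerprint. -/
structure HornerInv (W D : ℕ) (X : ℕ → ℕ) (L base cnt M r a b : ℕ) (s₀ : State) (j : ℕ)
    (s : State) : Prop where
  input : ScanInput W D X L base cnt M r a b s
  frame : Frame 40 s₀ s
  le : j ≤ L
  key : s.reg 40 = fingerprint X M r (L - j) base
  power : s.reg 41 = r ^ (L - j) % M
  count : s.reg 42 = j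
  ptr : s.reg 43 = base + (L - j)

theorem runs_hornerBody
    (hrd : ∀ s d a, Exec M (rd d a) s 1 (s.set d (X (s.reg a)))) {j : ℕ} {s : State}
    (h : HornerInv M.width D X L base cnt p r a b s₀ (j + 1) s) :
    Runs M (hornerBody rd) s 9 (HornerInv M.width D X L base cnt p r a b s₀ j) := by
  obtain ⟨hin, hf, hle, hkey, hpow, hcount, hptr⟩ := h
  have h9 := hin.one
  have h32 := hin.modulus
  have h33 := hin.radix
  have hK : fingerprint X p r (L - (j + 1)) base < p := Nat.mod_lt _ hin.pos
  have hR : r ^ (L - (j + 1)) % p < p := Nat.mod_lt _ hin.pos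
  have hb := hin.bound
  have hp := hin.modulus_le
  have hrp := hin.radix_lt
  have hx := hin.symbol_lt (base + (L - (j + 1)))
  have hrange := hin.range
  have hm1 : fingerprint X p r (L - (j + 1)) base * r ≤ D * D :=
    Nat.mul_le_mul (by omega) (by omega)
  have hm2 : r ^ (L - (j + 1)) % p * r ≤ D * D := Nat.mul_le_mul (by omega) (by omega)
  have hL : L - j = L - (j + 1) + 1 := by omega
  have key : Runs M (hornerBody rd) s 9 (fun s' => Frame 40 s s' ∧
      s'.reg 40 = fingerprint X p r (L - j) base ∧ s'.reg 41 = r ^ (L - j) % p ∧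
      s'.reg 42 = j ∧ s'.reg 43 = base + (L - j)) := by
    unfold hornerBody
    refine runs_step (hrd _ _ _) ?_
    refine runs_op_eq (fingerprint X p r (L - (j + 1)) base * r)
      (by simp [Op.eval, *]; exact Nat.mod_eq_of_lt (by omega)) ?_
    refine runs_op_eq (fingerprint X p r (L - (j + 1)) base * r + X (base + (L - (j + 1))))
      (by simp [Op.eval, *]; exact Nat.mod_eq_of_lt (by omega)) ?_
    refine runs_op_eq (fingerprint X p r (L - j) base)
      (by simp [Op.eval, *]; rw [fingerprint_succ]) ?_
    refine runs_op_eq (r ^ (L - (j + 1)) % p * r) (by simp [Op.eval, *]; exact Nat.mod_eq_of_lt (by omega)) ?_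
    refine runs_op_eq (r ^ (L - j) % p)
      (by simp [Op.eval, *]; rw [pow_succ]) ?_
    refine runs_op_eq (base + (L - j)) (by simp [Op.eval, *]; exact Nat.mod_eq_of_lt (by omega)) ?_
    refine runs_op_eq j (by simp [Op.eval, *]; exact sub_one_word (by omega)) (runs_nil ?_)
    refine ⟨?_, by simp, by simp, by simp, by simp⟩
    iterate 8 refine Frame.set ?_ (by norm_num)
    exact Frame.refl 40 s
  refine key.mono le_rfl fun s' ⟨hf', h1, h2, h3, h4⟩ => ?_
  exact ⟨hin.of_frame hf', hf.trans hf', by omega, h1, h2, h3, h4⟩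

end CoreMatching

namespace CoreMatching

open WordRAM

variable {M : Machine} {rd : ℕ → ℕ → Cmd} {X : ℕ → ℕ} {D L base cnt p r a b : ℕ} {s₀ : State}

theorem minPos_succ (Q a b : ℕ) (key : ℕ → ℕ) (base i : ℕ) :
    minPos Q a b key base (i + 1) =
      if wordHash Q a b (key (base + (i + 1))) < wordHash Q a b (minKey Q a b key base i)
      then i + 1 else minPos Q a b key base i := rfl

theorem minKey_succ (Q a b : ℕ) (key : ℕ → ℕ) (base i : ℕ) :
    minKey Q a b key base (i + 1) =
      if wordHash Q a b (key (base + (i + 1))) < wordHash Q a b (minKey Q a b key base i)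
      then key (base + (i + 1)) else minKey Q a b key base i := by
  unfold minKey
  rw [minPos_succ]
  unfold minKey
  split_ifs <;> rfl

/-- The invariant of the search for the minimal key. -/
structure RollInv (W D : ℕ) (X : ℕ → ℕ) (L base cnt M r a b : ℕ) (s₀ : State) (j : ℕ)
    (s : State) : Prop where
  input : ScanInput W D X L base cnt M r a b s
  frame : Frame 40 s₀ s
  le : j ≤ cnt
  key : s.reg 40 = fingerprint X M r L (base + (cnt - j))
  power : s.reg 41 = r ^ L % M
  count : s.reg 42 = j
  ptr : s.reg 43 = base + L + (cnt - j)
  old : s.reg 46 = base + (cnt - j)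
  idx : s.reg 50 = cnt - j
  bestKey : s.reg 47 = minKey (2 ^ W) a b (fingerprint X M r L) base (cnt - j)
  bestPos : s.reg 48 = minPos (2 ^ W) a b (fingerprint X M r L) base (cnt - j)
  bestHash : s.reg 49 = wordHash (2 ^ W) a b
    (minKey (2 ^ W) a b (fingerprint X M r L) base (cnt - j))

theorem runs_rollBody
    (hrd : ∀ s d a, Exec M (rd d a) s 1 (s.set d (X (s.reg a)))) {j : ℕ} {s : State}
    (h : RollInv M.width D X L base cnt p r a b s₀ (j + 1) s) :
    Runs M (rollBody rd) s 22 (RollInv M.width D X L base cnt p r a b s₀ j) := by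
  obtain ⟨hin, hf, hle, hkey, hpow, hcount, hptr, hold, hidx, hbk, hbp, hbh⟩ := h
  have h9 := hin.one
  have h32 := hin.modulus
  have h33 := hin.radix
  have h34 := hin.fst
  have h35 := hin.snd
  obtain ⟨i, hi⟩ : ∃ i, i = cnt - (j + 1) := ⟨_, rfl⟩
  have hij : cnt - j = i + 1 := by omega
  have hicnt : i < cnt := by omega
  rw [← hi] at hkey hptr hold hidx hbk hbp hbh
  clear hi
  have hK : fingerprint X p r L (base + i) < p := Nat.mod_lt _ hin.pos
  have hR : r ^ L % p < p := Nat.mod_lt _ hin.pos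
  have hb := hin.bound
  have hp := hin.modulus_le
  have hrp := hin.radix_lt
  have hx := hin.symbol_lt (base + i)
  have hx' := hin.symbol_lt (base + L + i)
  have hrange := hin.range
  -- No fingerprint update overflows: a product of two residues, a symbol and a further residue sum
  -- to less than `D * D + 3 * D`.
  have hm1 : fingerprint X p r L (base + i) * r ≤ D * D := Nat.mul_le_mul (by omega) (by omega)
  have hm2 : X (base + i) * (r ^ L % p) ≤ D * D := Nat.mul_le_mul (by omega) (by omega)
  have hm3 : X (base + i) * (r ^ L % p) % p < p := Nat.mod_lt _ hin.pos
  set K := fingerprint X p r L with hKdef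
  set Q := 2 ^ M.width with hQ
  have hroll : K (base + (i + 1))
      = (K (base + i) * r + X (base + L + i) + (p - X (base + i) * (r ^ L % p) % p)) % p := by
    rw [← add_assoc, hKdef, fingerprint_roll r L (base + i) hin.pos, add_right_comm base L i]
  obtain ⟨rl, hrl⟩ : ∃ rl, rl = r ^ L % p := ⟨_, rfl⟩
  rw [← hrl] at hpow hR hm2 hm3 hroll
  have key : Runs M (rollBody rd) s 22 (fun s' => Frame 40 s s' ∧
      s'.reg 40 = K (base + (i + 1)) ∧ s'.reg 41 = rl ∧
      s'.reg 42 = j ∧ s'.reg 43 = base + L + (i + 1) ∧ s'.reg 46 = base + (i + 1) ∧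
      s'.reg 50 = i + 1 ∧ s'.reg 47 = minKey Q a b K base (i + 1) ∧
      s'.reg 48 = minPos Q a b K base (i + 1) ∧
      s'.reg 49 = wordHash Q a b (minKey Q a b K base (i + 1))) := by
    unfold rollBody
    refine runs_step (hrd _ _ _) ?_
    refine runs_op_eq (X (base + i) * rl)
      (by simp [Op.eval, hold, hpow]; exact Nat.mod_eq_of_lt (by omega)) ?_
    refine runs_op_eq (X (base + i) * rl % p) (by simp [Op.eval, h32]) ?_
    refine runs_op_eq (p - X (base + i) * rl % p)
      (by simp [Op.eval, h32]; exact sub_word (by omega) (by omega)) ?_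
    refine runs_op_eq (K (base + i) * r)
      (by simp [Op.eval, hkey, h33]; exact Nat.mod_eq_of_lt (by omega)) ?_
    refine runs_step (hrd _ _ _) ?_
    refine runs_op_eq (K (base + i) * r + X (base + L + i))
      (by simp [Op.eval, hptr]; exact Nat.mod_eq_of_lt (by omega)) ?_
    refine runs_op_eq (K (base + i) * r + X (base + L + i) +
        (p - X (base + i) * rl % p))
      (by simp [Op.eval]; exact Nat.mod_eq_of_lt (by omega)) ?_
    refine runs_op_eq (K (base + (i + 1))) (by simp [Op.eval, h32, hroll]) ?_
    refine runs_op_eq (base + L + (i + 1))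
      (by simp [Op.eval, hptr, h9]; exact Nat.mod_eq_of_lt (by omega)) ?_
    refine runs_op_eq (base + (i + 1))
      (by simp [Op.eval, hold, h9]; exact Nat.mod_eq_of_lt (by omega)) ?_
    refine runs_op_eq (i + 1)
      (by simp [Op.eval, hidx, h9]; exact Nat.mod_eq_of_lt (by omega)) ?_
    refine runs_op_eq j (by simp [Op.eval, hcount, h9]; exact sub_one_word (by omega)) ?_
    -- Here the wrap-around of words is wanted: the affine hash is defined modulo `2 ^ W`.
    refine runs_op_eq (a * K (base + (i + 1)) % Q) (by simp [Op.eval, h34, hQ]) ?_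
    refine runs_op_eq (wordHash Q a b (K (base + (i + 1))))
      (by simp [Op.eval, h35, hQ, wordHash]) ?_
    refine runs_op_eq (if wordHash Q a b (K (base + (i + 1))) < wordHash Q a b (minKey Q a b K base i)
      then 1 else 0) (by simp [Op.eval, hbh]) ?_
    rw [minKey_succ, minPos_succ]
    refine (runs_cons (T₁ := 5) (runs_ite (fun hne => ?_) (fun he => ?_))
      (fun _ h => runs_nil h) : Runs _ _ _ (5 + 1) _)
    · have hlt : wordHash Q a b (K (base + (i + 1))) < wordHash Q a b (minKey Q a b K base i) := by
        by_contra hcon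
        simp [hcon] at hne
      refine runs_op_eq (wordHash Q a b (K (base + (i + 1)))) (by simp [Op.eval]) ?_
      refine runs_op_eq (K (base + (i + 1))) (by simp [Op.eval]) ?_
      refine runs_op_eq (i + 1) (by simp [Op.eval]) (runs_nil ?_)
      refine ⟨?_, by simp, by simp [hpow], by simp, by simp, by simp, by simp, by simp [hlt],
        by simp [hlt], by simp [hlt]⟩
      iterate 19 refine Frame.set ?_ (by norm_num)
      exact Frame.refl 40 s
    · have hlt : ¬ wordHash Q a b (K (base + (i + 1))) < wordHash Q a b (minKey Q a b K base i) := by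
        intro hcon
        simp [hcon] at he
      refine (runs_nil ?_).mono (by norm_num) (fun _ h => h)
      refine ⟨?_, by simp, by simp [hpow], by simp, by simp, by simp, by simp, by simp [hlt, hbk],
        by simp [hlt, hbp], by simp [hlt, hbh]⟩
      iterate 16 refine Frame.set ?_ (by norm_num)
      exact Frame.refl 40 s
  refine key.mono le_rfl fun s' ⟨hf', h1, h2, h3, h4, h5, h6, h7, h8, h9⟩ => ?_
  rw [hrl] at h2
  rw [← hij] at h1 h4 h5 h6 h7 h8 h9
  exact ⟨hin.of_frame hf', hf.trans hf', by omega, h1, h2, h3, h4, h5, h6, h7, h8, h9⟩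

theorem runs_scan (hrd : ∀ s d a, Exec M (rd d a) s 1 (s.set d (X (s.reg a))))
    (h : ScanInput M.width D X L base cnt p r a b s₀) :
    Runs M (scan rd) s₀ (10 * L + 23 * cnt + 15) (fun s' => Frame 40 s₀ s' ∧
      s'.reg 47 = minKey (2 ^ M.width) a b (fingerprint X p r L) base cnt ∧
      s'.reg 48 = minPos (2 ^ M.width) a b (fingerprint X p r L) base cnt) := by
  have h12 := h.len
  have h30 := h.start
  have h31 := h.further
  have h32 := h.modulus
  have hb := h.bound
  have hQ1 : 1 < 2 ^ M.width := by
    have := h.pos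
    have := h.modulus_le
    omega
  unfold scan
  refine Runs.mono (T := ((L * (9 + 1) + 1) + ((cnt * (22 + 1) + 1 + 1) + 7)) + 5) ?_ (by omega)
    (fun _ h => h)
  -- The initial power is `1 % p` because the modulus may be `1`. Throughout, `x or x` serves as a
  -- register copy.
  refine runs_const (runs_const (runs_op_eq (1 % p) (by simp [Op.eval, h32, Nat.mod_eq_of_lt hQ1])
    (runs_op_eq L (by simp [Op.eval, h12]) (runs_op_eq base (by simp [Op.eval, h30]) ?_))))
  refine runs_cons (runs_loop (I := HornerInv M.width D X L base cnt p r a b s₀)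
    (fun s h => h.count) (fun j s h => ⟨by rw [h.count]; omega, runs_hornerBody hrd h⟩) L _ ?_)
    (fun s hs => ?_)
  · have hf : Frame 40 s₀ (((((s₀.set 40 (0 % 2 ^ M.width)).set 41 (1 % 2 ^ M.width)).set 41
        (1 % p)).set 42 L).set 43 base) := by
      iterate 5 refine Frame.set ?_ (by norm_num)
      exact Frame.refl 40 s₀
    exact ⟨h.of_frame hf, hf, le_rfl, by simp [fingerprint_zero], by simp, by simp, by simp⟩
  obtain ⟨hin, hf, -, hkey, hpow, hcount, hptr⟩ := hs
  have h34 := hin.fst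
  have h35 := hin.snd
  have h30 := hin.start
  have h31 := hin.further
  rw [Nat.sub_zero] at hkey hpow hptr
  refine runs_op_eq (a * fingerprint X p r L base % 2 ^ M.width) (by simp [Op.eval, hkey, h34]) ?_
  refine runs_op_eq (wordHash (2 ^ M.width) a b (fingerprint X p r L base))
    (by simp [Op.eval, wordHash, h35]) ?_
  refine runs_op_eq (fingerprint X p r L base) (by simp [Op.eval, hkey]) ?_
  refine runs_const (runs_const (runs_op_eq base (by simp [Op.eval, h30])
    (runs_op_eq cnt (by simp [Op.eval, h31]) ?_)))
  refine runs_cons (T₁ := cnt * (22 + 1) + 1) (T := 1) (runs_loop (I := RollInv M.width D X L base cnt p r a b s₀)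
    (fun s h => h.count) (fun j s h => ⟨by rw [h.count]; omega, runs_rollBody hrd h⟩) cnt _ ?_)
    (fun s' hs => runs_nil ?_)
  · have hf' : Frame 40 s (((((((s.set 49 (a * fingerprint X p r L base % 2 ^ M.width)).set 49
        (wordHash (2 ^ M.width) a b (fingerprint X p r L base))).set 47
        (fingerprint X p r L base)).set 48 (0 % 2 ^ M.width)).set 50 (0 % 2 ^ M.width)).set 46
        base).set 42 cnt) := by
      iterate 7 refine Frame.set ?_ (by norm_num)
      exact Frame.refl 40 s
    exact ⟨hin.of_frame hf', hf.trans hf', le_rfl, by simp [hkey], by simp [hpow], by simp,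
      by simp [hptr], by simp, by simp, by simp [minKey, minPos, argmin], by simp [minPos, argmin],
      by simp [minKey, minPos, argmin]⟩
  · have hk := hs.bestKey
    have hp := hs.bestPos
    rw [Nat.sub_zero] at hk hp
    exact ⟨hs.frame, hk, hp⟩

end CoreMatching

/-! ### Parameters, the stored functions and their evaluation. -/

namespace CoreMatching

open WordRAM

/-- The modulus of the fingerprints is at most `2 ^ (200 * err)`. -/
def maxModulus (err : ℕ) : ℕ := 2 ^ (200 * err)

/-- The number of blocks of starting positions in a reference of length `m`. -/
def numBlocks (n m : ℕ) : ℕ := (m - 2 * n + 1) / (n / 16 + 1)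

/-- The number of buckets used to hash the keys. -/
def numBuckets (n m : ℕ) : ℕ := 32 * numBlocks n m

/-- The number of words in a bucket. -/
def bucketSize (W n m : ℕ) : ℕ := (2 ^ W - 1) / numBuckets n m + 1

/-- The number of stored functions. -/
def numFunctions (err : ℕ) : ℕ := 3 * (1024 * err)

/-- The function with seed `d`: the bucket of the minimal key of a block. -/
def blockFun (W n m err : ℕ) (X d : ℕ → ℕ) (x : ℕ) : ℕ :=
  if x < numBlocks n m then
    bucketHash (2 ^ W) (bucketSize W n m) (d 4) (minKey (2 ^ W) (d 2) (d 3)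
      (seedKey (maxModulus err) (2 * n) X d) (x * (n / 16 + 1)) (n / 16))
  else numBuckets n m

/-- The assumptions on the parameters in the case that texts can occur in the reference. -/
structure Sizes (n m err w : ℕ) : Prop where
  one_le : 1 ≤ n
  le_m : 3 * n ≤ m
  m_le : m ≤ 2 ^ err
  one_le_err : 1 ≤ err
  err_le : err ≤ w

theorem pow_mul_pow_le_maxModulus {err : ℕ} (h : 1 ≤ err) : 2 ^ 100 * 2 ^ err ≤ maxModulus err := by
  unfold maxModulus
  rw [← pow_add]
  exact Nat.pow_le_pow_right (by norm_num) (by omega)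

theorem maxModulus_mul_self_le {err w : ℕ} (h : 1 ≤ err) (hw : err ≤ w) :
    2 ^ 100 * (maxModulus err * maxModulus err) ≤ 2 ^ (600 * w) := by
  unfold maxModulus
  rw [← pow_add, ← pow_add]
  exact Nat.pow_le_pow_right (by norm_num) (by omega)

namespace Sizes

variable {n m err w : ℕ}

theorem m_le_maxModulus (h : Sizes n m err w) : 2 ^ 100 * m ≤ maxModulus err :=
  (Nat.mul_le_mul_left _ h.m_le).trans (pow_mul_pow_le_maxModulus h.one_le_err)

theorem maxModulus_pos (err : ℕ) : 0 < maxModulus err := by unfold maxModulus; positivity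

theorem maxModulus_le (h : Sizes n m err w) : 2 ^ 100 * maxModulus err ≤ 2 ^ (600 * w) :=
  (Nat.mul_le_mul_left _ (Nat.le_mul_of_pos_left _ (maxModulus_pos err))).trans
    (maxModulus_mul_self_le h.one_le_err h.err_le)

theorem m_le_word (h : Sizes n m err w) : 2 ^ 100 * m ≤ 2 ^ (600 * w) := by
  have h1 := h.m_le_maxModulus
  have h2 := h.maxModulus_le
  omega

theorem err_lt (h : Sizes n m err w) : 2 ^ 100 * err < 2 ^ (600 * w) := by
  have h1 : err < 2 ^ err := Nat.lt_two_pow_self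
  have h2 := pow_mul_pow_le_maxModulus h.one_le_err
  have h3 := h.maxModulus_le
  omega

theorem bound (h : Sizes n m err w) :
    maxModulus err * maxModulus err + 3 * maxModulus err < 2 ^ (600 * w) := by
  have h1 := maxModulus_mul_self_le h.one_le_err h.err_le
  have h2 : maxModulus err ≤ maxModulus err * maxModulus err :=
    Nat.le_mul_of_pos_left _ (maxModulus_pos err)
  have h3 := maxModulus_pos err
  omega

theorem numBlocks_pos (h : Sizes n m err w) : 0 < numBlocks n m := by
  unfold numBlocks
  have := h.le_m
  have := h.one_le
  exact Nat.div_pos (by omega) (by omega)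

theorem numBlocks_le (h : Sizes n m err w) : numBlocks n m ≤ m := by
  unfold numBlocks
  have := h.le_m
  have := h.one_le
  exact (Nat.div_le_self _ _).trans (by omega)

theorem numBuckets_lt (h : Sizes n m err w) : numBuckets n m + 1 < 2 ^ (600 * w) := by
  have h1 := h.numBlocks_le
  have h2 := h.m_le_word
  have := h.one_le
  have := h.le_m
  unfold numBuckets
  omega

theorem block_end_le {x : ℕ} (h : Sizes n m err w) (hx : x < numBlocks n m) :
    x * (n / 16 + 1) + n / 16 + 2 * n ≤ m := by
  have h1 : (x + 1) * (n / 16 + 1) ≤ m - 2 * n + 1 :=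
    (Nat.mul_le_mul_right _ hx).trans (Nat.div_mul_le_self _ _)
  rw [Nat.succ_mul] at h1
  have := h.le_m
  have := h.one_le
  omega

theorem bucketSize_lt (h : Sizes n m err w) : bucketSize (600 * w) n m < 2 ^ (600 * w) := by
  unfold bucketSize
  have h1 : (2 ^ (600 * w) - 1) / numBuckets n m ≤ (2 ^ (600 * w) - 1) / 32 :=
    Nat.div_le_div_left (by have := h.numBlocks_pos; unfold numBuckets; omega) (by norm_num)
  have h2 := h.m_le_word
  have := h.one_le
  have := h.le_m
  omega

end Sizes

/-- `bucketSize` is `2 ^ W / numBuckets` rounded up, so the buckets cover all words. -/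
theorem bucketHash_lt {W n m a x : ℕ} (hpos : 0 < numBuckets n m) :
    bucketHash (2 ^ W) (bucketSize W n m) a x < numBuckets n m := by
  unfold bucketHash
  rw [Nat.div_lt_iff_lt_mul (show 0 < bucketSize W n m from Nat.succ_pos _)]
  have h1 : a * x % 2 ^ W < 2 ^ W := Nat.mod_lt _ (by positivity)
  have h2 := Nat.div_add_mod (2 ^ W - 1) (numBuckets n m)
  have h3 := Nat.mod_lt (2 ^ W - 1) hpos
  unfold bucketSize
  rw [Nat.mul_add]
  omega

/-- The extra value `numBuckets n m` is taken at all points that are not blocks. It belongs to no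
bucket, so inverting at a bucket can only return a block. -/
theorem blockFun_lt (W n m err : ℕ) (X d : ℕ → ℕ) (x : ℕ) :
    blockFun W n m err X d x < numBuckets n m + 1 := by
  unfold blockFun
  split_ifs with h
  · exact (bucketHash_lt (by unfold numBuckets; omega)).trans (Nat.lt_succ_self _)
  · exact Nat.lt_succ_self _

/-- The program that prepares the parameters of evaluations and queries. -/
def setup : Cmd :=
  seqs [.const 9 1, .const 8 16, .op .div 10 0 8, .op .add 11 10 9, .op .add 12 0 0,
    .op .sub 13 1 12, .op .add 13 13 9, .op .div 13 13 11, .op .add 14 10 10, .const 8 200,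
    .op .mul 8 8 3, .op .shl 15 9 8, .op .sub 16 5 9, .const 8 0, .op .sub 17 8 9,
    .op .div 17 17 16, .op .add 17 17 9]

/-- The parameters of evaluations and queries are in the registers. -/
structure Params (W n m err : ℕ) (s : State) : Prop where
  length : s.reg 0 = n
  one : s.reg 9 = 1
  gap : s.reg 10 = n / 16
  blockLen : s.reg 11 = n / 16 + 1
  len : s.reg 12 = 2 * n
  window : s.reg 14 = 2 * (n / 16)
  modulus : s.reg 15 = maxModulus err
  buckets : s.reg 16 = numBuckets n m
  size : s.reg 17 = bucketSize W n m

theorem Params.of_frame {W n m err : ℕ} {s s' : State} (h : Params W n m err s)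
    (hf : Frame 18 s s') : Params W n m err s' where
  length := (hf.reg _ (by norm_num)).trans h.length
  one := (hf.reg _ (by norm_num)).trans h.one
  gap := (hf.reg _ (by norm_num)).trans h.gap
  blockLen := (hf.reg _ (by norm_num)).trans h.blockLen
  len := (hf.reg _ (by norm_num)).trans h.len
  window := (hf.reg _ (by norm_num)).trans h.window
  modulus := (hf.reg _ (by norm_num)).trans h.modulus
  buckets := (hf.reg _ (by norm_num)).trans h.buckets
  size := (hf.reg _ (by norm_num)).trans h.size

theorem runs_setup {M : Machine} {n m err w : ℕ} {s : State} (h : Sizes n m err w)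
    (hW : M.width = 600 * w) (h0 : s.reg 0 = n) (h1 : s.reg 1 = m) (h3 : s.reg 3 = err)
    (h5 : s.reg 5 = numBuckets n m + 1) :
    Runs M setup s 18 (fun s' => Frame 8 s s' ∧ Params M.width n m err s' ∧
      s'.reg 13 = numBlocks n m) := by
  have hm := h.m_le_word
  have hn1 := h.one_le
  have hn3 := h.le_m
  have herr := h.err_lt
  have hbu := h.numBuckets_lt
  have hbs := h.bucketSize_lt
  have hA := h.maxModulus_le
  have hApos := Sizes.maxModulus_pos err
  rw [← hW] at hm herr hbu hbs hA
  unfold setup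
  refine runs_const (runs_const ?_)
  rw [Nat.mod_eq_of_lt (a := 1) (by omega), Nat.mod_eq_of_lt (a := 16) (by omega)]
  refine runs_op_eq (n / 16) (by simp [Op.eval, h0]) ?_
  refine runs_op_eq (n / 16 + 1) (by simp [Op.eval]; exact Nat.mod_eq_of_lt (by omega)) ?_
  refine runs_op_eq (2 * n) (by simp [Op.eval, h0, ← two_mul]; exact Nat.mod_eq_of_lt (by omega)) ?_
  refine runs_op_eq (m - 2 * n) (by simp [Op.eval, h1]; exact sub_word (by omega) (by omega)) ?_
  refine runs_op_eq (m - 2 * n + 1) (by simp [Op.eval]; exact Nat.mod_eq_of_lt (by omega)) ?_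
  refine runs_op_eq (numBlocks n m) (by simp [Op.eval, numBlocks]) ?_
  refine runs_op_eq (2 * (n / 16))
    (by simp [Op.eval, ← two_mul]; exact Nat.mod_eq_of_lt (by omega)) ?_
  refine runs_const ?_
  rw [Nat.mod_eq_of_lt (a := 200) (by omega)]
  refine runs_op_eq (200 * err) (by simp [Op.eval, h3]; exact Nat.mod_eq_of_lt (by omega)) ?_
  refine runs_op_eq (maxModulus err)
    (by simp [Op.eval]; exact Nat.mod_eq_of_lt (show maxModulus err < _ by omega)) ?_
  refine runs_op_eq (numBuckets n m) (by simp [Op.eval, h5]; exact sub_one_word (by omega)) ?_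
  -- `2 ^ W` does not fit into a word, but `0 - 1` wraps around to `2 ^ W - 1`, which is what
  -- `bucketSize` is defined from.
  refine runs_const ?_
  rw [Nat.zero_mod]
  refine runs_op_eq (2 ^ M.width - 1)
    (by simp [Op.eval]) ?_
  refine runs_op_eq ((2 ^ M.width - 1) / numBuckets n m) (by simp [Op.eval]) ?_
  refine runs_op_eq (bucketSize M.width n m)
    (by simp [Op.eval]; exact Nat.mod_eq_of_lt hbs) (runs_nil ?_)
  refine ⟨?_, ⟨by simp [h0], by simp, by simp, by simp, by simp, by simp, by simp, by simp,
    by simp⟩, by simp⟩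
  iterate 17 refine Frame.set ?_ (by norm_num)
  exact Frame.refl 8 s

/-- The program that reads the five words of a seed. -/
def loadSeed : Cmd :=
  seqs [.readData 32 24, .op .mod 32 32 15, .op .add 32 32 9, .op .add 24 24 9, .readData 33 24,
    .op .mod 33 33 32, .op .add 24 24 9, .readData 34 24, .op .add 24 24 9, .readData 35 24,
    .op .add 24 24 9, .readData 36 24, .op .add 24 24 9]

theorem runs_loadSeed {M : Machine} {n m err w ptr : ℕ} {s : State} (h : Sizes n m err w)
    (hW : M.width = 600 * w) (hp : Params M.width n m err s) (h24 : s.reg 24 = ptr)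
    (hptr : ptr + 5 < 2 ^ M.width) :
    Runs M loadSeed s 14 (fun s' => Frame 24 s s' ∧ s'.reg 24 = ptr + 5 ∧
      s'.reg 32 = M.data ptr % maxModulus err + 1 ∧
      s'.reg 33 = M.data (ptr + 1) % (M.data ptr % maxModulus err + 1) ∧
      s'.reg 34 = M.data (ptr + 2) ∧ s'.reg 35 = M.data (ptr + 3) ∧
      s'.reg 36 = M.data (ptr + 4)) := by
  have h9 := hp.one
  have h15 := hp.modulus
  have hA := h.maxModulus_le
  have hApos := Sizes.maxModulus_pos err
  rw [← hW] at hA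
  have hmod := Nat.mod_lt (M.data ptr) hApos
  unfold loadSeed
  refine runs_readData ?_
  refine runs_op_eq (M.data ptr % maxModulus err) (by simp [Op.eval, h24, h15]) ?_
  refine runs_op_eq (M.data ptr % maxModulus err + 1)
    (by simp [Op.eval, h9]; exact Nat.mod_eq_of_lt (by omega)) ?_
  refine runs_op_eq (ptr + 1) (by simp [Op.eval, h9, h24]; exact Nat.mod_eq_of_lt (by omega)) ?_
  refine runs_readData ?_
  refine runs_op_eq (M.data (ptr + 1) % (M.data ptr % maxModulus err + 1))
    (by simp [Op.eval]) ?_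
  refine runs_op_eq (ptr + 2) (by simp [Op.eval, h9]; exact Nat.mod_eq_of_lt (by omega)) ?_
  refine runs_readData ?_
  refine runs_op_eq (ptr + 3) (by simp [Op.eval, h9]; exact Nat.mod_eq_of_lt (by omega)) ?_
  refine runs_readData ?_
  refine runs_op_eq (ptr + 4) (by simp [Op.eval, h9]; exact Nat.mod_eq_of_lt (by omega)) ?_
  refine runs_readData ?_
  refine runs_op_eq (ptr + 5) (by simp [Op.eval, h9]; exact Nat.mod_eq_of_lt (by omega))
    (runs_nil ?_)
  refine ⟨?_, by simp, by simp, by simp, by simp, by simp, by simp⟩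
  iterate 13 refine Frame.set ?_ (by norm_num)
  exact Frame.refl 24 s

/-- The program that evaluates a stored function. -/
def evalCmd : Cmd :=
  seqs [setup, .const 24 0, loadSeed, .op .lt 18 7 13,
    .ite 18 (seqs [.op .mul 30 7 11, .op .or 31 10 10, scan .readRef, .op .mul 0 36 47,
      .op .div 0 0 17]) (seqs [.op .or 0 16 16])]

theorem runs_evalCmd {M : Machine} {n m err w x : ℕ} {s : State} (h : Sizes n m err w)
    (hW : M.width = 600 * w) (h0 : s.reg 0 = n) (h1 : s.reg 1 = m) (h3 : s.reg 3 = err)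
    (h5 : s.reg 5 = numBuckets n m + 1) (h7 : s.reg 7 = x)
    (hsym : ∀ i, M.ref i < maxModulus err) :
    Runs M evalCmd s (200 * n) (fun s' => s'.reg 0 = blockFun M.width n m err M.ref M.data x) := by
  have hm := h.m_le_word
  have hn1 := h.one_le
  have hn3 := h.le_m
  have hA := h.maxModulus_le
  have hApos := Sizes.maxModulus_pos err
  have hbound := h.bound
  rw [← hW] at hm hA hbound
  unfold evalCmd
  refine Runs.mono (T := 18 + ((14 + (((10 * (2 * n) + 23 * (n / 16) + 15 + (1 + 1 + 1) + 2 + 1) + 1) + 1)) + 1))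
    ?_ (by omega) (fun _ h => h)
  refine runs_cons (runs_setup h hW h0 h1 h3 h5) fun s₁ ⟨hf, hp, h13⟩ => ?_
  have h7' : s₁.reg 7 = x := (hf.reg 7 (by norm_num)).trans h7
  refine runs_const ?_
  rw [Nat.zero_mod]
  refine runs_cons (runs_loadSeed (ptr := 0) h hW
    (hp.of_frame ((Frame.refl 18 s₁).set (by norm_num))) (by simp) (by omega))
    fun s₂ ⟨hf₂, _, h32, h33, h34, h35, h36⟩ => ?_
  replace hf₂ : Frame 24 s₁ s₂ := ((Frame.refl 24 s₁).set (by norm_num)).trans hf₂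
  have hp₂ := hp.of_frame (hf₂.mono (by norm_num))
  have h7₂ : s₂.reg 7 = x := (hf₂.reg 7 (by norm_num)).trans h7'
  have h13₂ : s₂.reg 13 = numBlocks n m := (hf₂.reg 13 (by norm_num)).trans h13
  refine runs_op_eq (if x < numBlocks n m then 1 else 0) (by simp [Op.eval, h7₂, h13₂]) ?_
  refine runs_cons (T := 1) (T₁ := (10 * (2 * n) + 23 * (n / 16) + 15 + (1 + 1 + 1) + 2) + 1)
    (runs_ite (fun hne => ?_) (fun he => ?_)) (fun _ h => runs_nil h)
  · have hx : x < numBlocks n m := by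
      by_contra hcon
      simp [hcon] at hne
    have hend := h.block_end_le hx
    refine runs_op_eq (x * (n / 16 + 1))
      (by simp [Op.eval, h7₂, hp₂.blockLen]; exact Nat.mod_eq_of_lt (by omega)) ?_
    refine runs_op_eq (n / 16) (by simp [Op.eval, hp₂.gap]) ?_
    refine runs_cons (T₁ := 10 * (2 * n) + 23 * (n / 16) + 15) (T := 3) (runs_scan (D := maxModulus err) (X := M.ref) (L := 2 * n)
      (base := x * (n / 16 + 1)) (cnt := n / 16) (p := M.data 0 % maxModulus err + 1)
      (r := M.data 1 % (M.data 0 % maxModulus err + 1)) (a := M.data 2) (b := M.data 3)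
      (fun s d a => .readRef s d a) ?_) fun s₃ ⟨hf₃, h47, _⟩ => ?_
    · exact
        { one := by simp [hp₂.one]
          len := by simp [hp₂.len]
          start := by simp
          further := by simp
          modulus := by simp [h32]
          radix := by simp [h33]
          fst := by simp [h34]
          snd := by simp [h35]
          pos := Nat.succ_pos _
          radix_lt := Nat.mod_lt _ (Nat.succ_pos _)
          modulus_le := Nat.mod_lt _ hApos
          symbol_lt := hsym
          bound := hbound
          range := by omega }
    · have h36₃ : s₃.reg 36 = M.data 4 := by
        rw [hf₃.reg 36 (by norm_num)]
        simp [h36]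
      have h17₃ : s₃.reg 17 = bucketSize M.width n m := by
        rw [hf₃.reg 17 (by norm_num)]
        simp [hp₂.size]
      refine runs_op (runs_op (runs_nil ?_))
      simp [Op.eval, h36₃, h17₃, h47, blockFun, hx, bucketHash]
      rfl
  · have hx : ¬ x < numBlocks n m := by
      intro hcon
      simp [hcon] at he
    refine Runs.mono (T := 1 + 1) (runs_op (runs_nil ?_)) (by omega) (fun _ h => h)
    simp [Op.eval, hp₂.buckets, blockFun, hx]

end CoreMatching

/-! ### The construction: the seeds are the random words themselves. -/

namespace CoreMatching

open WordRAM

/-- The body of the loop that stores random words. -/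
def drawBody : Cmd :=
  seqs [.rand 16, .store 15 16, .op .add 15 15 9, .op .sub 14 14 9]

/-- The program that draws and stores the seeds of the functions. -/
def buildCmd : Cmd :=
  seqs [.const 9 1, .const 8 3, .op .mul 10 0 8, .op .lt 11 1 10,
    .ite 11 (seqs [.const 0 0, .const 1 0, .const 2 0])
      (seqs [.const 8 16, .op .div 12 0 8, .op .add 12 12 9, .op .add 13 0 0, .op .sub 13 1 13,
        .op .add 13 13 9, .op .div 13 13 12, .const 8 32, .op .mul 13 8 13, .op .add 1 13 9,
        .const 8 3072, .op .mul 0 8 3, .const 2 5, .op .mul 14 0 2, .const 15 0,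
        .loop 14 drawBody])]

/-- The invariant of the loop that stores random words. -/
structure DrawInv (M : Machine) (k N len total : ℕ) (j : ℕ) (s : State) : Prop where
  fst : s.reg 0 = k
  snd : s.reg 1 = N
  trd : s.reg 2 = len
  one : s.reg 9 = 1
  le : j ≤ total
  count : s.reg 14 = j
  ptr : s.reg 15 = total - j
  used : s.used = total - j
  mem : ∀ t, t < total - j → s.mem t = M.coins t

theorem runs_drawBody {M : Machine} {k N len total j : ℕ} {s : State}
    (hspace : total ≤ M.space) (hW : total < 2 ^ M.width)
    (h : DrawInv M k N len total (j + 1) s) :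
    Runs M drawBody s 5 (DrawInv M k N len total j) := by
  obtain ⟨h0, h1, h2, h9, hle, hc, hptr, hu, hm⟩ := h
  obtain ⟨i, hi⟩ : ∃ i, i = total - (j + 1) := ⟨_, rfl⟩
  have hij : total - j = i + 1 := by omega
  have hilt : i < total := by omega
  rw [← hi] at hptr hu hm
  clear hi
  unfold drawBody
  refine runs_step (.rand _ _) ?_
  refine runs_step (.store _ _ _ (by simp [hptr]; omega)) ?_
  refine runs_op_eq (i + 1) (by simp [Op.eval, hptr, h9]; exact Nat.mod_eq_of_lt (by omega)) ?_
  refine runs_op_eq j (by simp [Op.eval, hc, h9]; exact sub_one_word (by omega)) (runs_nil ?_)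
  refine ⟨by simp [h0], by simp [h1], by simp [h2], by simp [h9], by omega, by simp,
    by simp [hij], by simp [hij, hu], ?_⟩
  intro t ht
  simp only [State.mem_set, State.reg_set, hptr, hu]
  simp only [show ¬ (15 : ℕ) = 16 by norm_num, if_false, if_true, Function.update_apply]
  split_ifs with hti
  · rw [hti]
  · exact hm t (by omega)

/-- The degenerate case needs only `n ≤ 2 ^ w`, which keeps `3 * n` from overflowing. -/
theorem runs_buildCmd_of_lt {M : Machine} {n m w : ℕ} {s : State} (hw : 1 ≤ w)
    (hW : M.width = 600 * w) (h0 : s.reg 0 = n) (h1 : s.reg 1 = m) (hn : n ≤ 2 ^ w)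
    (hlt : m < 3 * n) :
    Runs M buildCmd s 10 (fun s' => s'.reg 0 = 0 ∧ s'.reg 1 = 0 ∧ s'.reg 2 = 0) := by
  have hbig : 4 * 2 ^ w ≤ 2 ^ M.width := by
    rw [hW, show 4 * 2 ^ w = 2 ^ (w + 2) by rw [pow_add]; ring]
    exact Nat.pow_le_pow_right (by norm_num) (by omega)
  have hpos : 1 ≤ 2 ^ w := Nat.one_le_two_pow
  unfold buildCmd
  refine runs_const (runs_const ?_)
  rw [Nat.mod_eq_of_lt (a := 3) (by omega)]
  refine runs_op_eq (3 * n)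
    (by simp [Op.eval, h0, mul_comm n 3]; exact Nat.mod_eq_of_lt (by omega)) ?_
  refine runs_op_eq 1 (by simp [Op.eval, h1, hlt]) ?_
  refine runs_cons (T₁ := 5) (T := 1) (runs_ite (fun hne => ?_) (fun he => ?_))
    (fun _ h => runs_nil h)
  · exact runs_const (runs_const (runs_const (runs_nil (by simp))))
  · simp at he

theorem runs_buildCmd {M : Machine} {n m err w : ℕ} {s : State} (h : Sizes n m err w)
    (hW : M.width = 600 * w) (h0 : s.reg 0 = n) (h1 : s.reg 1 = m) (h3 : s.reg 3 = err)
    (hu : s.used = 0) (hspace : numFunctions err * 5 ≤ M.space) :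
    Runs M buildCmd s (numFunctions err * 5 * 6 + 23) (fun s' => s'.reg 0 = numFunctions err ∧
      s'.reg 1 = numBuckets n m + 1 ∧ s'.reg 2 = 5 ∧
      ∀ t, t < numFunctions err * 5 → s'.mem t = M.coins t) := by
  have hm := h.m_le_word
  have hn1 := h.one_le
  have hn3 := h.le_m
  have herr := h.err_lt
  have hbu := h.numBuckets_lt
  rw [← hW] at hm herr hbu
  have hk : numFunctions err * 5 < 2 ^ M.width := by unfold numFunctions; omega
  unfold buildCmd
  refine Runs.mono (T := ((numFunctions err * 5 * (5 + 1) + 1 + 1 + 15) + 1 + 1) + 4) ?_ (by omega)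
    (fun _ h => h)
  refine runs_const (runs_const ?_)
  rw [Nat.mod_eq_of_lt (a := 3) (by omega), Nat.mod_eq_of_lt (a := 1) (by omega)]
  refine runs_op_eq (3 * n)
    (by simp [Op.eval, h0, mul_comm n 3]; exact Nat.mod_eq_of_lt (by omega)) ?_
  refine runs_op_eq 0 (by simp [Op.eval, h1]; omega) ?_
  refine runs_cons (T₁ := (numFunctions err * 5 * (5 + 1) + 1 + 1 + 15) + 1) (T := 1)
    (runs_ite (fun hne => ?_) (fun he => ?_)) (fun _ h => runs_nil h)
  · simp at hne
  refine runs_const ?_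
  rw [Nat.mod_eq_of_lt (a := 16) (by omega)]
  refine runs_op_eq (n / 16) (by simp [Op.eval, h0]) ?_
  refine runs_op_eq (n / 16 + 1) (by simp [Op.eval]; exact Nat.mod_eq_of_lt (by omega)) ?_
  refine runs_op_eq (2 * n) (by simp [Op.eval, h0, ← two_mul]; exact Nat.mod_eq_of_lt (by omega)) ?_
  refine runs_op_eq (m - 2 * n) (by simp [Op.eval, h1]; exact sub_word (by omega) (by omega)) ?_
  refine runs_op_eq (m - 2 * n + 1) (by simp [Op.eval]; exact Nat.mod_eq_of_lt (by omega)) ?_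
  refine runs_op_eq (numBlocks n m) (by simp [Op.eval, numBlocks]) (runs_const ?_)
  rw [Nat.mod_eq_of_lt (a := 32) (by omega)]
  refine runs_op_eq (numBuckets n m)
    (by simp [Op.eval]; exact Nat.mod_eq_of_lt (show numBuckets n m < _ by omega)) ?_
  refine runs_op_eq (numBuckets n m + 1)
    (by simp [Op.eval]; exact Nat.mod_eq_of_lt (by omega)) (runs_const ?_)
  rw [Nat.mod_eq_of_lt (a := 3072) (by omega)]
  refine runs_op_eq (numFunctions err) (by
    simp [Op.eval, h3]
    rw [Nat.mod_eq_of_lt (by omega), numFunctions]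
    ring) (runs_const ?_)
  rw [Nat.mod_eq_of_lt (a := 5) (by omega)]
  refine runs_op_eq (numFunctions err * 5)
    (by simp [Op.eval]; exact Nat.mod_eq_of_lt (by omega)) (runs_const ?_)
  refine runs_cons (T₁ := numFunctions err * 5 * (5 + 1) + 1) (T := 1)
    (runs_loop (I := DrawInv M (numFunctions err) (numBuckets n m + 1) 5 (numFunctions err * 5))
    (fun s h => h.count) (fun j s h => ⟨by rw [h.count]; omega, runs_drawBody hspace hk h⟩) _ _ ?_)
    (fun s' hs => runs_nil ?_)
  · exact ⟨by simp, by simp, by simp, by simp, le_rfl, by simp, by simp, by simp [hu], by simp⟩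
  · exact ⟨hs.fst, hs.snd, hs.trd, fun t ht => hs.mem t (by omega)⟩

end CoreMatching

/-! ### Checking the candidate that belongs to an answer of the oracle. -/

namespace CoreMatching

open WordRAM

/-- The bucket for which the function with seed `d` is inverted, using window number `v` of the
text `X`. -/
def queryHash (W n m err : ℕ) (X d : ℕ → ℕ) (v : ℕ) : ℕ :=
  bucketHash (2 ^ W) (bucketSize W n m) (d 4) (minKey (2 ^ W) (d 2) (d 3)
    (seedKey (maxModulus err) (2 * n) X d) (2 * (n / 16) * v) (2 * (n / 16)))

/-- The candidate for an occurrence of the core of the text `X` in `Y` if block `x` of `Y` is the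
answer of the oracle. -/
def candidate (W n err : ℕ) (Y X d : ℕ → ℕ) (v x : ℕ) : ℕ :=
  x * (n / 16 + 1) + minPos (2 ^ W) (d 2) (d 3) (seedKey (maxModulus err) (2 * n) Y d)
    (x * (n / 16 + 1)) (n / 16) + n
  - (2 * (n / 16) * v + minPos (2 ^ W) (d 2) (d 3) (seedKey (maxModulus err) (2 * n) X d)
    (2 * (n / 16) * v) (2 * (n / 16)))

/-- The central third of the text `X` occurs in `Y` at position `c`. -/
def CoreAt (n : ℕ) (Y X : ℕ → ℕ) (c : ℕ) : Prop := ∀ t < n, Y (c + t) = X (n + t)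

/-- One step of the comparison of the core of the text with a substring of the reference. -/
def verifyBody : Cmd :=
  seqs [.readRef 44 39, .readText 45 53, .op .eq 46 44 45, .op .and 37 37 46, .op .add 39 39 9,
    .op .add 53 53 9, .op .sub 38 38 9]

/-- The invariant of the comparison of the core of the text with a substring of the reference. -/
structure VerifyInv (M : Machine) (n c : ℕ) (s₀ : State) (j : ℕ) (s : State) : Prop where
  frame : Frame 37 s₀ s
  le : j ≤ n
  count : s.reg 38 = j
  refPtr : s.reg 39 = c + (n - j)
  textPtr : s.reg 53 = n + (n - j)
  flag_le : s.reg 37 ≤ 1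
  flag : s.reg 37 = 1 ↔ ∀ t < n - j, M.ref (c + t) = M.text (n + t)

theorem and_flag {x : ℕ} (hx : x ≤ 1) (p : Prop) [Decidable p] :
    (x &&& if p then 1 else 0) ≤ 1 ∧ ((x &&& if p then 1 else 0) = 1 ↔ x = 1 ∧ p) := by
  interval_cases x <;> split_ifs with h <;> simp [h]

theorem runs_verifyBody {M : Machine} {n c j : ℕ} {s₀ s : State} (h9 : s₀.reg 9 = 1)
    (hc : c + 2 * n < 2 ^ M.width) (h : VerifyInv M n c s₀ (j + 1) s) :
    Runs M verifyBody s 8 (VerifyInv M n c s₀ j) := by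
  obtain ⟨hf, hle, hcount, hr, ht, hfl, hflag⟩ := h
  replace h9 : s.reg 9 = 1 := (hf.reg 9 (by norm_num)).trans h9
  obtain ⟨e, he⟩ : ∃ e, e = n - (j + 1) := ⟨_, rfl⟩
  have hij : n - j = e + 1 := by omega
  have hen : e < n := by omega
  rw [← he] at hr ht hflag
  clear he
  obtain ⟨hand, hand'⟩ := and_flag hfl (M.ref (c + e) = M.text (n + e))
  have key : Runs M verifyBody s 8 (fun s' => Frame 37 s s' ∧ s'.reg 38 = j ∧
      s'.reg 39 = c + (e + 1) ∧ s'.reg 53 = n + (e + 1) ∧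
      s'.reg 37 = (s.reg 37 &&& if M.ref (c + e) = M.text (n + e) then 1 else 0)) := by
    unfold verifyBody
    refine runs_step (.readRef _ _ _) (runs_step (.readText _ _ _) ?_)
    refine runs_op_eq (if M.ref (c + e) = M.text (n + e) then 1 else 0)
      (by simp [Op.eval, hr, ht]) ?_
    refine runs_op_eq (s.reg 37 &&& if M.ref (c + e) = M.text (n + e) then 1 else 0)
      (by simp [Op.eval]) ?_
    refine runs_op_eq (c + (e + 1))
      (by simp [Op.eval, hr, h9]; exact Nat.mod_eq_of_lt (by omega)) ?_
    refine runs_op_eq (n + (e + 1))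
      (by simp [Op.eval, ht, h9]; exact Nat.mod_eq_of_lt (by omega)) ?_
    refine runs_op_eq j (by simp [Op.eval, hcount, h9]; exact sub_one_word (by omega))
      (runs_nil ?_)
    refine ⟨?_, by simp, by simp, by simp, by simp⟩
    iterate 7 refine Frame.set ?_ (by norm_num)
    exact Frame.refl 37 s
  refine key.mono le_rfl fun s' ⟨hf', h1, h2, h3, h4⟩ => ?_
  refine ⟨hf.trans hf', by omega, h1, by rw [hij, h2], by rw [hij, h3], by rw [h4]; exact hand, ?_⟩
  rw [h4, hand', hflag, hij]
  constructor
  · rintro ⟨h5, h6⟩ t ht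
    rcases Nat.lt_succ_iff_lt_or_eq.1 ht with h | h
    · exact h5 t h
    · rw [h]; exact h6
  · intro h5
    exact ⟨fun t ht => h5 t (by omega), h5 e (by omega)⟩

/-- The program that finds and checks the candidate given by an answer of the oracle. -/
def tryCmd : Cmd :=
  seqs [.op .mul 30 28 11, .op .or 31 10 10, scan .readRef, .op .add 29 30 48, .op .add 29 29 0,
    .op .sub 29 29 26, .const 37 1, .op .or 38 0 0, .op .or 39 29 29, .op .or 53 0 0,
    .loop 38 verifyBody, .ite 37 (seqs [.const 22 1, .op .or 23 29 29]) (seqs [])]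

/-- Only the block number is known, so the minimum in the block is searched again in the reference
to find its offset. The found position is kept in registers `22` and `23`, which a failed check
leaves unchanged. -/
theorem runs_tryCmd {M : Machine} {n m err w x q p r a b c : ℕ} {s : State} (h : Sizes n m err w)
    (hW : M.width = 600 * w) (hp : Params M.width n m err s)
    (hsym : ∀ i, M.ref i < maxModulus err) (hx : x < numBlocks n m) (h28 : s.reg 28 = x)
    (h26 : s.reg 26 = q) (hq : q ≤ n) (h32 : s.reg 32 = p) (h33 : s.reg 33 = r)
    (h34 : s.reg 34 = a) (h35 : s.reg 35 = b) (hp0 : 0 < p) (hrp : r < p)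
    (hpA : p ≤ maxModulus err)
    (hc : c = x * (n / 16 + 1) + minPos (2 ^ M.width) a b (fingerprint M.ref p r (2 * n))
      (x * (n / 16 + 1)) (n / 16) + n - q) :
    Runs M tryCmd s (60 * n) (fun s' => Frame 22 s s' ∧ s'.reg 24 = s.reg 24 ∧
      ((CoreAt n M.ref M.text c ∧ s'.reg 22 = 1 ∧ s'.reg 23 = c) ∨
        (¬ CoreAt n M.ref M.text c ∧ s'.reg 22 = s.reg 22 ∧ s'.reg 23 = s.reg 23))) := by
  have hm := h.m_le_word
  have hn1 := h.one_le
  have hn3 := h.le_m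
  have hbound := h.bound
  rw [← hW] at hm hbound
  have hend := h.block_end_le hx
  unfold tryCmd
  refine Runs.mono (T := (10 * (2 * n) + 23 * (n / 16) + 15 + ((n * (8 + 1) + 1 + (4 + 1)) + 7)) + 2)
    ?_ (by omega) (fun _ h => h)
  refine runs_op_eq (x * (n / 16 + 1))
    (by simp [Op.eval, h28, hp.blockLen]; exact Nat.mod_eq_of_lt (by omega)) ?_
  refine runs_op_eq (n / 16) (by simp [Op.eval, hp.gap]) ?_
  refine runs_cons (T₁ := 10 * (2 * n) + 23 * (n / 16) + 15) (T := (n * (8 + 1) + 1 + (4 + 1)) + 7)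
    (runs_scan (D := maxModulus err) (X := M.ref) (L := 2 * n)
      (base := x * (n / 16 + 1)) (cnt := n / 16) (p := p) (r := r) (a := a) (b := b)
      (fun s d a => .readRef s d a)
      { one := by simp [hp.one]
        len := by simp [hp.len]
        start := by simp
        further := by simp
        modulus := by simp [h32]
        radix := by simp [h33]
        fst := by simp [h34]
        snd := by simp [h35]
        pos := hp0
        radix_lt := hrp
        modulus_le := hpA
        symbol_lt := hsym
        bound := hbound
        range := by omega }) fun s₁ ⟨hf, _, h48⟩ => ?_
  have hpos := minPos_le (2 ^ M.width) a b (fingerprint M.ref p r (2 * n))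
    (x * (n / 16 + 1)) (n / 16)
  set pos := minPos (2 ^ M.width) a b (fingerprint M.ref p r (2 * n))
    (x * (n / 16 + 1)) (n / 16)
  have h30 : s₁.reg 30 = x * (n / 16 + 1) := by rw [hf.reg 30 (by norm_num)]; simp
  replace hf : Frame 30 s s₁ :=
    (((Frame.refl 30 s).set (by norm_num)).set (by norm_num)).trans (hf.mono (by norm_num))
  have h0 : s₁.reg 0 = n := (hf.reg 0 (by norm_num)).trans hp.length
  have h26₁ : s₁.reg 26 = q := (hf.reg 26 (by norm_num)).trans h26
  have h9 : s₁.reg 9 = 1 := (hf.reg 9 (by norm_num)).trans hp.one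
  refine runs_op_eq (x * (n / 16 + 1) + pos)
    (by simp [Op.eval, h30, h48]; exact Nat.mod_eq_of_lt (by omega)) ?_
  refine runs_op_eq (x * (n / 16 + 1) + pos + n)
    (by simp [Op.eval, h0]; exact Nat.mod_eq_of_lt (by omega)) ?_
  refine runs_op_eq c (by simp [Op.eval, h26₁, hc]; exact sub_word (by omega) (by omega)) ?_
  refine runs_const ?_
  rw [Nat.mod_eq_of_lt (a := 1) (by omega)]
  refine runs_op_eq n (by simp [Op.eval, h0]) (runs_op_eq c (by simp [Op.eval])
    (runs_op_eq n (by simp [Op.eval, h0]) ?_))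
  have hf₂ : Frame 29 s (((((((s₁.set 29 (x * (n / 16 + 1) + pos)).set 29
      (x * (n / 16 + 1) + pos + n)).set 29 c).set 37 1).set 38 n).set 39 c).set 53 n) := by
    iterate 7 refine Frame.set ?_ (by norm_num)
    exact hf.mono (by norm_num)
  refine runs_cons (T₁ := n * (8 + 1) + 1) (T := 4 + 1)
    (runs_loop (I := VerifyInv M n c (((((((s₁.set 29 (x * (n / 16 + 1) + pos)).set 29
      (x * (n / 16 + 1) + pos + n)).set 29 c).set 37 1).set 38 n).set 39 c).set 53 n))
    (fun s h => h.count) (fun j s h => ⟨by rw [h.count]; omega,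
      runs_verifyBody (by simp [h9]) (by omega) h⟩) n _
    ⟨Frame.refl 37 _, le_rfl, by simp, by simp, by simp, by simp, by simp⟩) fun s₂ hs => ?_
  have hfl := hs.flag
  rw [Nat.sub_zero] at hfl
  have hf₃ : Frame 29 s s₂ := hf₂.trans (hs.frame.mono (by norm_num))
  have h29 : s₂.reg 29 = c := by rw [hs.frame.reg 29 (by norm_num)]; simp
  refine runs_cons (T₁ := 4) (T := 1) (runs_ite (T := 3) (fun hne => ?_) (fun he => ?_))
    (fun _ h => runs_nil h)
  · have h1 : s₂.reg 37 = 1 := by have := hs.flag_le; omega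
    refine runs_const (runs_op_eq c (by simp [Op.eval, h29]) (runs_nil ⟨?_, ?_, Or.inl ⟨?_, ?_, ?_⟩⟩))
    · iterate 2 refine Frame.set ?_ (by norm_num)
      exact hf₃.mono (by norm_num)
    · simp [hf₃.reg 24 (by norm_num)]
    · exact hfl.1 h1
    · simp [Nat.mod_eq_of_lt (show 1 < 2 ^ M.width by omega)]
    · simp
  · refine (runs_nil ⟨hf₃.mono (by norm_num), hf₃.reg 24 (by norm_num), Or.inr ⟨?_,
      hf₃.reg 22 (by norm_num), hf₃.reg 23 (by norm_num)⟩⟩).mono (by norm_num) (fun _ h => h)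
    intro hcore
    have := hfl.2 hcore
    omega

end CoreMatching

/-! ### The bucket of a window of the text. -/

namespace CoreMatching

open WordRAM

/-- The seed number `i` in an array of seeds. -/
def seedAt (d : ℕ → ℕ) (i : ℕ) : ℕ → ℕ := fun t => d (5 * i + t)

/-- The program that computes the bucket for which a function is inverted. -/
def hashCmd : Cmd :=
  seqs [.const 19 3, .op .mod 19 21 19, .op .mul 18 14 19, loadSeed, .op .or 30 18 18,
    .op .or 31 14 14, scan .readText, .op .mul 25 36 47, .op .div 25 25 17, .op .add 26 18 48]

/-- Besides the bucket, the offset of the minimum in the text and the seed stay in registers for the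
check of the candidate. -/
theorem runs_hashCmd {M : Machine} {n m err w i : ℕ} {s : State} (h : Sizes n m err w)
    (hW : M.width = 600 * w) (hp : Params M.width n m err s)
    (hsym : ∀ i, M.text i < maxModulus err) (h21 : s.reg 21 = i) (h24 : s.reg 24 = 5 * i)
    (hi : 5 * i + 5 < 2 ^ M.width) :
    Runs M hashCmd s (120 * n) (fun s' => Frame 18 s s' ∧ s'.reg 20 = s.reg 20 ∧
      s'.reg 21 = s.reg 21 ∧ s'.reg 22 = s.reg 22 ∧ s'.reg 23 = s.reg 23 ∧
      s'.reg 24 = 5 * i + 5 ∧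
      s'.reg 25 = queryHash M.width n m err M.text (seedAt M.data i) (i % 3) ∧
      s'.reg 26 = 2 * (n / 16) * (i % 3) + minPos (2 ^ M.width) (seedAt M.data i 2)
        (seedAt M.data i 3) (seedKey (maxModulus err) (2 * n) M.text (seedAt M.data i))
        (2 * (n / 16) * (i % 3)) (2 * (n / 16)) ∧
      s'.reg 32 = seedAt M.data i 0 % maxModulus err + 1 ∧
      s'.reg 33 = seedAt M.data i 1 % (seedAt M.data i 0 % maxModulus err + 1) ∧
      s'.reg 34 = seedAt M.data i 2 ∧ s'.reg 35 = seedAt M.data i 3) := by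
  have hm := h.m_le_word
  have hn1 := h.one_le
  have hn3 := h.le_m
  have hApos := Sizes.maxModulus_pos err
  have hbound := h.bound
  rw [← hW] at hm hbound
  have hv : i % 3 < 3 := Nat.mod_lt _ (by norm_num)
  set v := i % 3 with hvdef
  have hbase : 2 * (n / 16) * v ≤ 2 * (n / 16) * 2 := Nat.mul_le_mul_left _ (by omega)
  unfold hashCmd
  refine Runs.mono (T := (14 + ((10 * (2 * n) + 23 * (2 * (n / 16)) + 15 + (1 + 1 + 1 + 1)) + 1 + 1))
    + 1 + 1 + 1) ?_ (by omega) (fun _ h => h)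
  refine runs_const ?_
  rw [Nat.mod_eq_of_lt (a := 3) (by omega)]
  refine runs_op_eq v (by simp [Op.eval, h21, hvdef]) ?_
  refine runs_op_eq (2 * (n / 16) * v)
    (by simp [Op.eval, hp.window]; exact Nat.mod_eq_of_lt (by omega)) ?_
  have hf₀ : Frame 18 s (((s.set 19 3).set 19 v).set 18 (2 * (n / 16) * v)) := by
    iterate 3 refine Frame.set ?_ (by norm_num)
    exact Frame.refl 18 s
  refine runs_cons (runs_loadSeed (ptr := 5 * i) h hW (hp.of_frame hf₀) (by simp [h24]) hi)
    fun s₁ ⟨hf₁, h24₁, h32, h33, h34, h35, h36⟩ => ?_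
  have hp₁ := (hp.of_frame hf₀).of_frame (hf₁.mono (by norm_num))
  have h18 : s₁.reg 18 = 2 * (n / 16) * v := by rw [hf₁.reg 18 (by norm_num)]; simp
  have hk : ∀ r, 20 ≤ r → r < 24 → s₁.reg r = s.reg r := by
    intro r hr hr'
    rw [hf₁.reg r hr']
    simp [show r ≠ 18 by omega, show r ≠ 19 by omega]
  refine runs_op_eq (2 * (n / 16) * v) (by simp [Op.eval, h18]) ?_
  refine runs_op_eq (2 * (n / 16)) (by simp [Op.eval, hp₁.window]) ?_
  have hf₂ : Frame 30 s₁ ((s₁.set 30 (2 * (n / 16) * v)).set 31 (2 * (n / 16))) :=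
    ((Frame.refl 30 s₁).set (by norm_num)).set (by norm_num)
  refine runs_cons (T := 1 + 1 + 1 + 1) (T₁ := 10 * (2 * n) + 23 * (2 * (n / 16)) + 15)
    (runs_scan (D := maxModulus err) (X := M.text) (L := 2 * n)
      (base := 2 * (n / 16) * v) (cnt := 2 * (n / 16))
      (p := seedAt M.data i 0 % maxModulus err + 1)
      (r := seedAt M.data i 1 % (seedAt M.data i 0 % maxModulus err + 1))
      (a := seedAt M.data i 2) (b := seedAt M.data i 3)
      (fun s d a => .readText s d a)
      { one := by simp [hp₁.one]
        len := by simp [hp₁.len]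
        start := by simp
        further := by simp
        modulus := by simp [h32, seedAt]
        radix := by simp [h33, seedAt]
        fst := by simp [h34, seedAt]
        snd := by simp [h35, seedAt]
        pos := Nat.succ_pos _
        radix_lt := Nat.mod_lt _ (Nat.succ_pos _)
        modulus_le := Nat.mod_lt _ hApos
        symbol_lt := hsym
        bound := hbound
        range := by omega }) fun s₂ ⟨hf₃, h47, h48⟩ => ?_
  have hf₄ : Frame 30 s₁ s₂ := hf₂.trans (hf₃.mono (by norm_num))
  have hpos := minPos_le (2 ^ M.width) (seedAt M.data i 2) (seedAt M.data i 3)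
    (fingerprint M.text (seedAt M.data i 0 % maxModulus err + 1)
      (seedAt M.data i 1 % (seedAt M.data i 0 % maxModulus err + 1)) (2 * n))
    (2 * (n / 16) * v) (2 * (n / 16))
  have h36₂ : s₂.reg 36 = seedAt M.data i 4 := by
    rw [hf₃.reg 36 (by norm_num)]
    simp [h36, seedAt]
  have hr : ∀ r, 32 ≤ r → r < 36 → s₂.reg r = s₁.reg r := by
    intro r hr hr'
    rw [hf₃.reg r (by omega)]
    simp [show r ≠ 30 by omega, show r ≠ 31 by omega]
  have h17 : s₂.reg 17 = bucketSize M.width n m := (hf₄.reg 17 (by norm_num)).trans hp₁.size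
  have h18' : s₂.reg 18 = 2 * (n / 16) * v := (hf₄.reg 18 (by norm_num)).trans h18
  refine runs_op (runs_op_eq (queryHash M.width n m err M.text (seedAt M.data i) v) ?_
    (runs_op_eq (2 * (n / 16) * v + minPos (2 ^ M.width) (seedAt M.data i 2)
        (seedAt M.data i 3) (seedKey (maxModulus err) (2 * n) M.text (seedAt M.data i))
        (2 * (n / 16) * v) (2 * (n / 16))) ?_ (runs_nil ?_)))
  · simp [Op.eval, h36₂, h17, h47, queryHash, bucketHash]
    rfl
  · simp [Op.eval, h18', h48]
    exact Nat.mod_eq_of_lt (by omega)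
  · have hf₅ : Frame 18 s s₂ := (hf₀.trans (hf₁.mono (by norm_num))).trans (hf₄.mono (by norm_num))
    refine ⟨((hf₅.set (by norm_num)).set (by norm_num)).set (by norm_num), ?_, ?_, ?_, ?_, ?_,
      by simp, by simp, ?_, ?_, ?_, ?_⟩
    · simp [hf₄.reg 20 (by norm_num), hk]
    · simp [hf₄.reg 21 (by norm_num), hk]
    · simp [hf₄.reg 22 (by norm_num), hk]
    · simp [hf₄.reg 23 (by norm_num), hk]
    · simp [hf₄.reg 24 (by norm_num), h24₁]
    · simp [hr 32, h32, seedAt]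
    · simp [hr 33, h33, seedAt]
    · simp [hr 34, h34, seedAt]
    · simp [hr 35, h35, seedAt]

end CoreMatching

/-! ### The query loop. -/

namespace WordRAM

theorem runs_query {M : Machine} {s : State} {T : ℕ} {Q : State → Prop}
    {l : List Cmd} {d e a b : ℕ}
    (h : ∀ x, M.oracle (s.reg a) (s.reg b) = some x → Runs M (seqs l)
      ((({ s with asked := (s.reg a, s.reg b) :: s.asked } : State).set d 1).set e x) T Q)
    (h' : M.oracle (s.reg a) (s.reg b) = none → Runs M (seqs l)
      ((({ s with asked := (s.reg a, s.reg b) :: s.asked } : State).set d 0).set e 0) T Q) :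
    Runs M (seqs (.query d e a b :: l)) s (T + 1) Q := by
  cases ho : M.oracle (s.reg a) (s.reg b) with
  | none => exact runs_step (.query_none s d e a b ho) (h' ho)
  | some x => exact runs_step (.query_some s d e a b x ho) (h x ho)

end WordRAM

namespace CoreMatching

open WordRAM

/-- The body of the loop over the functions. -/
def queryBody : Cmd :=
  seqs [hashCmd, .query 27 28 21 25, .ite 27 tryCmd (seqs []), .op .add 21 21 9,
    .op .sub 20 20 9]

/-- Function number `i` leads to an occurrence of the core of the text. -/
def Hits (M : Machine) (n m err i : ℕ) : Prop :=
  ∃ x, M.oracle i (queryHash M.width n m err M.text (seedAt M.data i) (i % 3)) = some x ∧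
    CoreAt n M.ref M.text
      (candidate M.width n err M.ref M.text (seedAt M.data i) (i % 3) x)

/-- The invariant of the loop over the functions. -/
structure QueryInv (M : Machine) (n m err k : ℕ) (j : ℕ) (s : State) : Prop where
  params : Params M.width n m err s
  le : j ≤ k
  count : s.reg 20 = j
  idx : s.reg 21 = k - j
  ptr : s.reg 24 = 5 * (k - j)
  sound : s.reg 22 = 0 ∨ s.reg 22 = 1 ∧ CoreAt n M.ref M.text (s.reg 23) ∧ s.reg 23 + n ≤ m
  hit : ∀ i < k - j, Hits M n m err i → s.reg 22 ≠ 0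
  asked_lt : ∀ q ∈ s.asked, q.1 < k - j ∧ q.2 < numBuckets n m + 1
  nodup : (s.asked.map Prod.fst).Nodup

theorem runs_queryBody {M : Machine} {n m err w k j : ℕ} {s : State} (h : Sizes n m err w)
    (hW : M.width = 600 * w) (hsym : ∀ i, M.ref i < maxModulus err)
    (hsym' : ∀ i, M.text i < maxModulus err) (hk : 5 * k + 5 < 2 ^ M.width)
    (ho : ∀ i < k, ∀ y < numBuckets n m, ∀ x, M.oracle i y = some x → x < numBlocks n m)
    (hs : QueryInv M n m err k (j + 1) s) :
    Runs M queryBody s (200 * n) (QueryInv M n m err k j) := by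
  obtain ⟨hp, hle, hcount, hidx, hptr, hsound, hhit, hasked, hnodup⟩ := hs
  have hm := h.m_le_word
  have hn1 := h.one_le
  have hn3 := h.le_m
  have hApos := Sizes.maxModulus_pos err
  rw [← hW] at hm
  obtain ⟨i, hi⟩ : ∃ i, i = k - (j + 1) := ⟨_, rfl⟩
  have hij : k - j = i + 1 := by omega
  have hik : i < k := by omega
  rw [← hi] at hidx hptr hhit hasked
  have hjk : j + i + 1 = k := by omega
  clear hi
  have hbpos : 0 < numBuckets n m := by have := h.numBlocks_pos; unfold numBuckets; omega
  have hy : queryHash M.width n m err M.text (seedAt M.data i) (i % 3) < numBuckets n m :=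
    bucketHash_lt hbpos
  unfold queryBody
  refine Runs.mono (T := 120 * n + (((60 * n + 1) + 3) + 1)) ?_ (by omega) (fun _ h => h)
  refine runs_cons (runs_hashCmd h hW hp hsym' hidx hptr (by omega))
    fun s₁ ⟨hf, h20, h21, h22, h23, h24, h25, h26, h32, h33, h34, h35⟩ => ?_
  have hp₁ := hp.of_frame hf
  rw [hidx] at h21
  rw [hcount] at h20
  -- Earlier queries went to functions with smaller numbers, so no function is inverted twice.
  have hnodup' : ((((s₁.reg 21, s₁.reg 25) :: s₁.asked).map Prod.fst)).Nodup := by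
    rw [List.map_cons, List.nodup_cons, hf.asked]
    refine ⟨fun hmem => ?_, hnodup⟩
    obtain ⟨q, hq, hq'⟩ := List.mem_map.1 hmem
    have := (hasked q hq).1
    simp only [h21] at hq'
    omega
  have hasked' : ∀ q ∈ (s₁.reg 21, s₁.reg 25) :: s₁.asked,
      q.1 < k - j ∧ q.2 < numBuckets n m + 1 := by
    intro q hq
    rw [hij]
    rcases List.mem_cons.1 hq with rfl | hq
    · exact ⟨by simp [h21], by simp [h25]; omega⟩
    · rw [hf.asked] at hq
      have := hasked q hq
      omega
  -- The end of a round is the same for both outcomes of the oracle; only the soundness and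
  -- completeness of the flag in register `22` differ.
  have hfin : ∀ s₃ : State, Params M.width n m err s₃ → s₃.reg 20 = j + 1 → s₃.reg 21 = i →
      s₃.reg 24 = 5 * i + 5 →
      (s₃.reg 22 = 0 ∨ s₃.reg 22 = 1 ∧ CoreAt n M.ref M.text (s₃.reg 23) ∧ s₃.reg 23 + n ≤ m) →
      (∀ i' < i + 1, Hits M n m err i' → s₃.reg 22 ≠ 0) →
      s₃.asked = (s₁.reg 21, s₁.reg 25) :: s₁.asked →
      Runs M (seqs [.op .add 21 21 9, .op .sub 20 20 9]) s₃ 3 (QueryInv M n m err k j) := by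
    intro s₃ hp₃ h1 h2 h3 h4 h5 h6
    refine runs_op_eq (i + 1)
      (by simp [Op.eval, h2, hp₃.one]; exact Nat.mod_eq_of_lt (by omega)) ?_
    refine runs_op_eq j
      (by simp [Op.eval, h1, hp₃.one]; exact sub_one_word (by omega)) (runs_nil ?_)
    refine ⟨hp₃.of_frame (((Frame.refl 18 s₃).set (by norm_num)).set (by norm_num)), by omega,
      by simp, by simp [hij], by simp [h3, hij]; ring, by simpa using h4, ?_, ?_, ?_⟩
    · rw [hij]
      simpa using h5
    · simpa [h6] using hasked'
    · simpa [h6] using hnodup'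
  obtain ⟨s₂, hs₂⟩ : ∃ s₂ : State, s₂ = { s₁ with asked := (s₁.reg 21, s₁.reg 25) :: s₁.asked } :=
    ⟨_, rfl⟩
  have hreg : s₂.reg = s₁.reg := by rw [hs₂]
  have hask : s₂.asked = (s₁.reg 21, s₁.reg 25) :: s₁.asked := by rw [hs₂]
  have hp₂ : Params M.width n m err s₂ := by
    rw [hs₂]
    exact ⟨hp₁.1, hp₁.2, hp₁.3, hp₁.4, hp₁.5, hp₁.6, hp₁.7, hp₁.8, hp₁.9⟩
  have hsound₂ : s₂.reg 22 = 0 ∨ s₂.reg 22 = 1 ∧ CoreAt n M.ref M.text (s₂.reg 23) ∧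
      s₂.reg 23 + n ≤ m := by rwa [hreg, h22, h23]
  have hhit₂ : ∀ i' < i, Hits M n m err i' → s₂.reg 22 ≠ 0 := by rwa [hreg, h22]
  refine runs_query (fun x hx => ?_) (fun hx => ?_) <;> rw [← hs₂] <;> rw [h21, h25] at hx
  · have hxb := ho i hik _ hy x hx
    have hf₃ : Frame 27 s₂ ((s₂.set 27 1).set 28 x) :=
      ((Frame.refl 27 s₂).set (by norm_num)).set (by norm_num)
    have hminq := minPos_le (2 ^ M.width) (seedAt M.data i 2) (seedAt M.data i 3)
      (seedKey (maxModulus err) (2 * n) M.text (seedAt M.data i))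
      (2 * (n / 16) * (i % 3)) (2 * (n / 16))
    have hv : 2 * (n / 16) * (i % 3) ≤ 2 * (n / 16) * 2 := Nat.mul_le_mul_left _ (by omega)
    refine runs_cons (T₁ := 60 * n + 1) (T := 3) (runs_ite (fun _ => runs_tryCmd
      (c := candidate M.width n err M.ref M.text (seedAt M.data i) (i % 3) x)
      (q := 2 * (n / 16) * (i % 3) + minPos (2 ^ M.width) (seedAt M.data i 2) (seedAt M.data i 3)
        (seedKey (maxModulus err) (2 * n) M.text (seedAt M.data i))
        (2 * (n / 16) * (i % 3)) (2 * (n / 16)))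
      (p := seedAt M.data i 0 % maxModulus err + 1)
      (r := seedAt M.data i 1 % (seedAt M.data i 0 % maxModulus err + 1))
      (a := seedAt M.data i 2) (b := seedAt M.data i 3) h hW
      (hp₂.of_frame (hf₃.mono (by norm_num))) hsym hxb (by simp) (by simp [hreg, h26])
      (by omega) (by simp [hreg, h32]) (by simp [hreg, h33]) (by simp [hreg, h34])
      (by simp [hreg, h35]) (Nat.succ_pos _) (Nat.mod_lt _ (Nat.succ_pos _))
      (Nat.mod_lt _ hApos) rfl) (fun he => absurd he (by simp))) fun s₃ ⟨hf', h24', hc⟩ => ?_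
    have hend := h.block_end_le hxb
    have hminx := minPos_le (2 ^ M.width) (seedAt M.data i 2) (seedAt M.data i 3)
      (seedKey (maxModulus err) (2 * n) M.ref (seedAt M.data i)) (x * (n / 16 + 1)) (n / 16)
    have hc' : candidate M.width n err M.ref M.text (seedAt M.data i) (i % 3) x + n ≤ m := by
      unfold candidate
      omega
    have hf₄ := (hf₃.mono (show 22 ≤ 27 by norm_num)).trans hf'
    refine hfin _ (hp₂.of_frame (hf₄.mono (by norm_num))) ?_ ?_ ?_ ?_ ?_ (hf₄.asked.trans hask)
    · rw [hf₄.reg 20 (by norm_num), hreg, h20]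
    · rw [hf₄.reg 21 (by norm_num), hreg, h21]
    · rw [h24', hf₃.reg 24 (by norm_num), hreg, h24]
    · rcases hc with ⟨hcore, h1, h2⟩ | ⟨-, h1, h2⟩
      · exact Or.inr ⟨h1, h2 ▸ hcore, h2 ▸ hc'⟩
      · rw [h1, h2, hf₃.reg 22 (by norm_num), hf₃.reg 23 (by norm_num)]
        exact hsound₂
    · intro i' hi' hh
      rcases hc with ⟨hcore, h1, h2⟩ | ⟨hcore, h1, h2⟩
      · rw [h1]; exact one_ne_zero
      · rw [h1, hf₃.reg 22 (by norm_num)]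
        rcases Nat.lt_succ_iff_lt_or_eq.1 hi' with hi' | rfl
        · exact hhit₂ i' hi' hh
        · obtain ⟨x', hx', hcore'⟩ := hh
          rw [hx] at hx'
          cases hx'
          exact absurd hcore' hcore
  · have hf₃ : Frame 27 s₂ ((s₂.set 27 0).set 28 0) :=
      ((Frame.refl 27 s₂).set (by norm_num)).set (by norm_num)
    refine runs_cons (T₁ := 60 * n + 1) (T := 3) (Q₁ := fun s => s = (s₂.set 27 0).set 28 0)
      (runs_ite (fun hne => absurd (by simp) hne) fun _ =>
        (runs_nil (Q := fun s => s = (s₂.set 27 0).set 28 0) rfl).mono (by omega) fun _ h => h) fun s₃ hs₃ => ?_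
    subst hs₃
    refine hfin _ (hp₂.of_frame (hf₃.mono (by norm_num))) ?_ ?_ ?_ ?_ ?_ (hf₃.asked.trans hask)
    · rw [hf₃.reg 20 (by norm_num), hreg, h20]
    · rw [hf₃.reg 21 (by norm_num), hreg, h21]
    · rw [hf₃.reg 24 (by norm_num), hreg, h24]
    · rw [hf₃.reg 22 (by norm_num), hf₃.reg 23 (by norm_num)]
      exact hsound₂
    · intro i' hi' hh
      rw [hf₃.reg 22 (by norm_num)]
      rcases Nat.lt_succ_iff_lt_or_eq.1 hi' with hi' | rfl
      · exact hhit₂ i' hi' hh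
      · obtain ⟨x', hx', -⟩ := hh
        rw [hx] at hx'
        cases hx'

/-- The program that answers queries. -/
def queryCmd : Cmd :=
  .ite 4 (seqs [setup, .op .or 20 4 4, .const 21 0, .const 22 0, .const 23 0, .const 24 0,
    .loop 20 queryBody, .op .or 0 22 22, .op .or 1 23 23]) (seqs [.const 0 0])

theorem runs_queryCmd {M : Machine} {n m err w k : ℕ} {s : State} (h : Sizes n m err w)
    (hW : M.width = 600 * w) (hsym : ∀ i, M.ref i < maxModulus err)
    (hsym' : ∀ i, M.text i < maxModulus err) (hk : 5 * k + 5 < 2 ^ M.width) (hk0 : k ≠ 0)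
    (ho : ∀ i < k, ∀ y < numBuckets n m, ∀ x, M.oracle i y = some x → x < numBlocks n m)
    (h0 : s.reg 0 = n) (h1 : s.reg 1 = m) (h3 : s.reg 3 = err) (h4 : s.reg 4 = k)
    (h5 : s.reg 5 = numBuckets n m + 1) (hasked : s.asked = []) :
    Runs M queryCmd s (k * (200 * n + 1) + 30) (fun s' =>
      (s'.reg 0 = 0 ∨ s'.reg 0 = 1 ∧ CoreAt n M.ref M.text (s'.reg 1) ∧ s'.reg 1 + n ≤ m) ∧
      (∀ i < k, Hits M n m err i → s'.reg 0 ≠ 0) ∧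
      (∀ q ∈ s'.asked, q.1 < k ∧ q.2 < numBuckets n m + 1) ∧
      (s'.asked.map Prod.fst).Nodup) := by
  unfold queryCmd
  refine Runs.mono (T := (18 + ((k * (200 * n + 1) + 1 + 3) + 1 + 1 + 1 + 1 + 1)) + 1)
    (runs_ite (fun _ => ?_) (fun he => absurd (h4.symm.trans he) hk0)) (by omega) (fun _ h => h)
  refine runs_cons (runs_setup h hW h0 h1 h3 h5) fun s₁ ⟨hf, hp, _⟩ => ?_
  have h4₁ : s₁.reg 4 = k := (hf.reg 4 (by norm_num)).trans h4
  refine runs_op_eq k (by simp [Op.eval, h4₁]) (runs_const (runs_const (runs_const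
    (runs_const ?_))))
  rw [Nat.zero_mod]
  have hf₁ : Frame 18 s₁ (((((s₁.set 20 k).set 21 0).set 22 0).set 23 0).set 24 0) := by
    iterate 5 refine Frame.set ?_ (by norm_num)
    exact Frame.refl 18 s₁
  have hask : (((((s₁.set 20 k).set 21 0).set 22 0).set 23 0).set 24 0).asked = [] := by
    rw [hf₁.asked, hf.asked, hasked]
  refine runs_cons (T := 3) (runs_loop (I := QueryInv M n m err k) (fun s h => h.count)
    (fun j s hs => ⟨by rw [hs.count]; omega, runs_queryBody h hW hsym hsym' hk ho hs⟩) k _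
    ⟨hp.of_frame hf₁, le_rfl, by simp, by simp, by simp, Or.inl (by simp),
      fun i hi => absurd hi (by omega), by rw [hask]; simp, by rw [hask]; simp⟩) fun s₂ hs => ?_
  obtain ⟨-, -, -, -, -, hsound, hhit, hasked, hnodup⟩ := hs
  rw [Nat.sub_zero] at hhit hasked
  refine runs_op_eq (s₂.reg 22) (by simp [Op.eval]) (runs_op_eq (s₂.reg 23) (by simp [Op.eval])
    (runs_nil ⟨by simpa using hsound, by simpa using hhit, by simpa using hasked,
      by simpa using hnodup⟩))

theorem runs_queryCmd_of_eq_zero {M : Machine} {s : State} (h4 : s.reg 4 = 0) :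
    Runs M queryCmd s 3 (fun s' => s'.reg 0 = 0 ∧ s'.asked = s.asked) := by
  unfold queryCmd
  exact runs_ite (fun hne => absurd h4 hne) fun _ => runs_const (runs_nil (by simp))

end CoreMatching

/-! ### Correctness of a query with a good seed. -/

namespace CoreMatching

open WordRAM

theorem fingerprint_congr {X Y : ℕ → ℕ} {L i j : ℕ} (M r : ℕ)
    (h : ∀ t < L, X (i + t) = Y (j + t)) : fingerprint X M r L i = fingerprint Y M r L j := by
  unfold fingerprint
  congr 1
  exact Finset.sum_congr rfl fun t ht => by rw [h t (Finset.mem_range.1 ht)]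

theorem argmin_congr {φ ψ : ℕ → ℕ} {n : ℕ} (h : ∀ i ≤ n, φ i = ψ i) : argmin φ n = argmin ψ n := by
  induction n with
  | zero => rfl
  | succ n ih =>
    have := ih fun i hi => h i (by omega)
    rw [argmin, argmin, this, h _ le_rfl, h _ ((argmin_le ψ n).trans (Nat.le_succ n))]

theorem minPos_congr {Q a b base base' cnt : ℕ} {key key' : ℕ → ℕ}
    (h : ∀ i ≤ cnt, key (base + i) = key' (base' + i)) :
    minPos Q a b key base cnt = minPos Q a b key' base' cnt :=
  argmin_congr fun i hi => by rw [h i hi]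

theorem minKey_congr {Q a b base base' cnt : ℕ} {key key' : ℕ → ℕ}
    (h : ∀ i ≤ cnt, key (base + i) = key' (base' + i)) :
    minKey Q a b key base cnt = minKey Q a b key' base' cnt := by
  unfold minKey
  rw [minPos_congr h]
  exact h _ (minPos_le _ _ _ _ _ _)

variable {W n m err w p v b : ℕ} {X Y d : ℕ → ℕ}

/-- The substrings involved start at offset at most `6 * (n / 16) ≤ n` and have length `2 * n`, so
they lie inside the text. -/
theorem seedKey_text (hv : v < 3) (hT : ∀ t < 3 * n, Y t = X (p + t)) {i : ℕ}
    (hi : i ≤ 2 * (n / 16)) :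
    seedKey (maxModulus err) (2 * n) Y d (2 * (n / 16) * v + i) =
      seedKey (maxModulus err) (2 * n) X d (p + 2 * (n / 16) * v + i) := by
  have hv2 : 2 * (n / 16) * v ≤ 2 * (n / 16) * 2 := Nat.mul_le_mul_left _ (by omega)
  refine fingerprint_congr _ _ fun t ht => ?_
  rw [hT _ (by omega)]
  congr 1
  omega

/-- For a good seed the block inside the window is a preimage of the queried bucket, so the oracle
cannot answer that there is none. -/
theorem blockFun_eq_queryHash (hv : v < 3) (hT : ∀ t < 3 * n, Y t = X (p + t))
    (hb : b < numBlocks n m)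
    (hgood : SeedGood (2 ^ W) (maxModulus err) (bucketSize W n m) (2 * n) (n / 16)
      (m - 2 * n + 1) (numBlocks n m) X (p + 2 * (n / 16) * v) (b * (n / 16 + 1)) d) :
    blockFun W n m err X d b = queryHash W n m err Y d v := by
  unfold blockFun queryHash
  rw [if_pos hb, hgood.2.1, minKey_congr fun i hi => seedKey_text hv hT hi]

/-- The oracle may choose any preimage `x`. Separation forces the minimal key of block `x` to equal
that of the window, and faithfulness turns equal keys into equal substrings. Which of several equal
minima is selected is irrelevant. -/
theorem coreAt_candidate (h : Sizes n m err w) (hv : v < 3) (hp : p + 3 * n ≤ m)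
    (hT : ∀ t < 3 * n, Y t = X (p + t))
    (hgood : SeedGood (2 ^ W) (maxModulus err) (bucketSize W n m) (2 * n) (n / 16)
      (m - 2 * n + 1) (numBlocks n m) X (p + 2 * (n / 16) * v) (b * (n / 16 + 1)) d) {x : ℕ}
    (hx : blockFun W n m err X d x = queryHash W n m err Y d v) :
    CoreAt n X Y (candidate W n err X Y d v x) := by
  have hv2 : 2 * (n / 16) * v ≤ 2 * (n / 16) * 2 := Nat.mul_le_mul_left _ (by omega)
  have hn3 := h.le_m
  have hxb : x < numBlocks n m := by
    by_contra hcon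
    have := bucketHash_lt (W := W) (n := n) (m := m) (a := d 4) (x := minKey (2 ^ W) (d 2) (d 3)
      (seedKey (maxModulus err) (2 * n) Y d) (2 * (n / 16) * v) (2 * (n / 16)))
      (by have := h.numBlocks_pos; unfold numBuckets; omega)
    unfold blockFun at hx
    rw [if_neg hcon, hx] at *
    exact lt_irrefl _ this
  have hkeys := minKey_congr (Q := 2 ^ W) (a := d 2) (b := d 3)
    fun i hi => seedKey_text (err := err) (d := d) hv hT hi
  have hposs := minPos_congr (Q := 2 ^ W) (a := d 2) (b := d 3)
    fun i hi => seedKey_text (err := err) (d := d) hv hT hi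
  unfold blockFun queryHash at hx
  rw [if_pos hxb, hkeys] at hx
  have hsep := hgood.2.2 x hxb hx
  have hend := h.block_end_le hxb
  have hpos1 := minPos_le (2 ^ W) (d 2) (d 3) (seedKey (maxModulus err) (2 * n) X d)
    (x * (n / 16 + 1)) (n / 16)
  have hpos2 := minPos_le (2 ^ W) (d 2) (d 3) (seedKey (maxModulus err) (2 * n) X d)
    (p + 2 * (n / 16) * v) (2 * (n / 16))
  have hwin := hgood.1 _ _ (by omega) (by omega) hsep
  intro t ht
  unfold candidate
  rw [hposs]
  set i₁ := minPos (2 ^ W) (d 2) (d 3) (seedKey (maxModulus err) (2 * n) X d)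
    (x * (n / 16 + 1)) (n / 16)
  set i₂ := minPos (2 ^ W) (d 2) (d 3) (seedKey (maxModulus err) (2 * n) X d)
    (p + 2 * (n / 16) * v) (2 * (n / 16))
  -- The common substring starts at offset `2 * (n / 16) * v + i₂ ≤ n` in the text and has length `2
  -- * n`; hence it covers `[n, 2 * n)`, and this is where the core sits in it.
  have := hwin (n - (2 * (n / 16) * v + i₂) + t) (by omega)
  rw [hT _ (by omega), show p + (n + t) = p + 2 * (n / 16) * v + i₂ +
    (n - (2 * (n / 16) * v + i₂) + t) by omega, ← this]
  congr 1
  omega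

/-- The first multiple of `n / 16 + 1` from `u` on is at most `u + n / 16`, so its block ends within
the window. The block is complete because the windows and their substrings stay inside the
occurrence of the text. -/
theorem exists_block (hv : v < 3) (hp : p + 3 * n ≤ m) :
    ∃ b < numBlocks n m, p + 2 * (n / 16) * v ≤ b * (n / 16 + 1) ∧
      b * (n / 16 + 1) + n / 16 ≤ p + 2 * (n / 16) * v + 2 * (n / 16) := by
  have hv2 : 2 * (n / 16) * v ≤ 2 * (n / 16) * 2 := Nat.mul_le_mul_left _ (by omega)
  set u := p + 2 * (n / 16) * v
  have h1 := Nat.div_add_mod (u + n / 16) (n / 16 + 1)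
  have h2 := Nat.mod_lt (u + n / 16) (show n / 16 + 1 > 0 by omega)
  rw [mul_comm] at h1
  refine ⟨(u + n / 16) / (n / 16 + 1), ?_, by omega, by omega⟩
  unfold numBlocks
  rw [← Nat.succ_le_iff, Nat.le_div_iff_mul_le (by omega), Nat.succ_eq_add_one,
    Nat.add_mul, one_mul]
  omega

theorem SeedGood.congr {Q A S L g m' Nb u o : ℕ} {d' : ℕ → ℕ} (hd : ∀ t < 5, d t = d' t)
    (h : SeedGood Q A S L g m' Nb X u o d) : SeedGood Q A S L g m' Nb X u o d' := by
  unfold SeedGood seedKey at *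
  rwa [hd 0 (by norm_num), hd 1 (by norm_num), hd 2 (by norm_num), hd 3 (by norm_num),
    hd 4 (by norm_num)] at h

theorem blockFun_congr {d' : ℕ → ℕ} (hd : ∀ t < 5, d t = d' t) (x : ℕ) :
    blockFun W n m err X d x = blockFun W n m err X d' x := by
  unfold blockFun seedKey
  rw [hd 0 (by norm_num), hd 1 (by norm_num), hd 2 (by norm_num), hd 3 (by norm_num),
    hd 4 (by norm_num)]

open scoped Classical in
theorem card_seedGood_param_ge (h : Sizes n m err w) (hX : ∀ t, X t < 2 ^ err)
    (hp : p + 3 * n ≤ m) : ∃ v b, v < 3 ∧ b < numBlocks n m ∧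
      (2 ^ (600 * w)) ^ 5 ≤ 512 * (Finset.univ.filter (fun d : Fin 5 → Fin (2 ^ (600 * w)) =>
        SeedGood (2 ^ (600 * w)) (maxModulus err) (bucketSize (600 * w) n m) (2 * n) (n / 16)
          (m - 2 * n + 1) (numBlocks n m) X (p + 2 * (n / 16) * v) (b * (n / 16 + 1))
          (toArray d))).card := by
  have h1 := h.one_le_err
  have h2 := h.err_le
  have h3 := h.m_le_maxModulus
  have h4 := maxModulus_mul_self_le h1 h2
  have h5 := h.numBlocks_le
  have h6 := h.le_m
  have h7 := h.numBlocks_pos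
  have h8 := h.one_le
  have hmW := h.m_le_word
  have h9 : 2 ^ 100 * (m * maxModulus err) ≤ 2 ^ (600 * w) := by
    refine le_trans ?_ h4
    exact Nat.mul_le_mul_left _ (Nat.mul_le_mul_right _ (by omega))
  have hS : 2 ^ (600 * w) ≤ numBuckets n m * bucketSize (600 * w) n m ∧
      numBuckets n m * bucketSize (600 * w) n m ≤ 2 ^ (600 * w) + numBuckets n m := by
    have e1 := Nat.div_add_mod (2 ^ (600 * w) - 1) (numBuckets n m)
    have e2 := Nat.mod_lt (2 ^ (600 * w) - 1)
      (show 0 < numBuckets n m by unfold numBuckets; omega)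
    unfold bucketSize
    rw [Nat.mul_add]
    omega
  -- `Y = 6 * err` makes the prime factor exceed the union bound `4 * m' ^ 2 * L ≤ 2 ^ (2 + 3 *
  -- err)`; `a = 200 * err` exceeds `32 * Y + 2`; and `600 * w` bits leave ample room for keys of at
  -- most `200 * err` bits.
  obtain ⟨v, hv, hcard⟩ := card_seedGood_ge (W := 600 * w) (a := 200 * err) (Y := 6 * err)
    (S := bucketSize (600 * w) n m) (L := 2 * n) (g := n / 16) (m' := m - 2 * n + 1)
    (Nb := numBlocks n m) (p := p) (X := X) (by omega) (by omega)
    (fun t => (hX t).trans_le (Nat.pow_le_pow_right (by norm_num) (by omega)))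
    (by
      have e1 : (m - 2 * n + 1) * (m - 2 * n + 1) * (2 * n) ≤ 2 ^ err * 2 ^ err * 2 ^ err := by
        have := h.m_le
        exact Nat.mul_le_mul (Nat.mul_le_mul (by omega) (by omega)) (by omega)
      calc 4 * ((m - 2 * n + 1) * (m - 2 * n + 1) * (2 * n))
          ≤ 2 ^ 2 * (2 ^ err * 2 ^ err * 2 ^ err) := Nat.mul_le_mul_left _ e1
        _ = 2 ^ (2 + (err + err + err)) := by rw [pow_add 2 2, pow_add, pow_add]
        _ ≤ 2 ^ (6 * err) := Nat.pow_le_pow_right (by norm_num) (by omega))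
    (by omega) (by omega)
    (by
      have e1 : 8 * (2 * (n / 16) + 1) * maxModulus err ≤ 8 * m * maxModulus err :=
        Nat.mul_le_mul_right _ (by omega)
      rw [mul_assoc 8 m] at e1
      exact e1.trans (by omega))
    (by
      change maxModulus err ≤ _
      have e1 : numBuckets n m * bucketSize (600 * w) n m ≤ 32 * m * bucketSize (600 * w) n m :=
        Nat.mul_le_mul_right _ (by unfold numBuckets; omega)
      have e2 : m * (16 * maxModulus err) ≤ m * (16 * (2 * bucketSize (600 * w) n m)) := by
        calc m * (16 * maxModulus err) = 16 * (m * maxModulus err) := by ring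
          _ ≤ 32 * m * bucketSize (600 * w) n m := by omega
          _ = m * (16 * (2 * bucketSize (600 * w) n m)) := by ring
      have := Nat.le_of_mul_le_mul_left e2 (by omega)
      omega)
    (by
      -- The factor `32` in `numBuckets` is chosen here: rounding up gives `32 * Nb * S ≤ 2 ^ W +
      -- numBuckets ≤ 2 * 2 ^ W`, so at most half of the multipliers cause a collision.
      have e1 : 2 * (2 * (numBlocks n m * (8 * bucketSize (600 * w) n m))) =
          numBuckets n m * bucketSize (600 * w) n m := by unfold numBuckets; ring
      have e2 : numBuckets n m ≤ 32 * m := by unfold numBuckets; omega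
      omega)
  obtain ⟨b, hb, h10, h11⟩ := exists_block hv hp
  exact ⟨v, b, hv, hb, hcard _ h10 h11⟩

end CoreMatching

/-! ### All promised properties for a fixed good choice of random words. -/

namespace CoreMatching

open WordRAM

theorem toArray_lt {a b K : ℕ} (X : Fin a → Fin b) (hb : b ≤ K) (hK : 0 < K) (i : ℕ) :
    toArray X i < K := by
  unfold toArray
  split_ifs with h
  · exact (X ⟨i, h⟩).2.trans_le hb
  · exact hK

theorem toArray_of_lt {a b i : ℕ} (X : Fin a → Fin b) (h : i < a) : toArray X i = X ⟨i, h⟩ := by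
  rw [toArray, dif_pos h]

theorem block_eq_seedAt {mem : ℕ → ℕ} {i t : ℕ} (ht : t < 5) :
    block mem (i * 5) 5 t = seedAt mem i t := by
  rw [block, if_pos ht, seedAt, mul_comm]

theorem seedAt_block {mem : ℕ → ℕ} {i k t : ℕ} (hi : i < k) (ht : t < 5) :
    seedAt (block mem 0 (k * 5)) i t = seedAt mem i t := by
  rw [seedAt, block, if_pos (by omega), Nat.zero_add, seedAt]

/-- A block has more than `n / 16` positions, so there are `O(m / n)` blocks. The function size
needs no factor `err`. -/
theorem numBuckets_mul_le {n m : ℕ} (h : 3 * n ≤ m) : (numBuckets n m + 1) * n ≤ 513 * m + 513 := by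
  have h1 : numBlocks n m * (n / 16 + 1) ≤ m - 2 * n + 1 := Nat.div_mul_le_self _ _
  have h2 : numBlocks n m * n ≤ numBlocks n m * (16 * (n / 16 + 1)) :=
    Nat.mul_le_mul_left _ (by omega)
  calc (numBuckets n m + 1) * n = 32 * (numBlocks n m * n) + n := by unfold numBuckets; ring
    _ ≤ 32 * (numBlocks n m * (16 * (n / 16 + 1))) + n := by omega
    _ = 512 * (numBlocks n m * (n / 16 + 1)) + n := by ring
    _ ≤ 513 * m + 513 := by omega

theorem occursAt_core {m n σ i : ℕ} {R : Fin m → Fin σ} {T : Fin (3 * n) → Fin σ} (hi : i + n ≤ m)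
    (h : CoreAt n (toArray R) (toArray T) i) : OccursAt (core T) R i := by
  refine ⟨hi, fun j => Fin.ext ?_⟩
  have := h j j.2
  rwa [toArray_of_lt R (by omega), toArray_of_lt T (by omega)] at this

theorem OccursAt.toArray_eq {a b σ p : ℕ} {T : Fin a → Fin σ} {R : Fin b → Fin σ}
    (h : OccursAt T R p) {t : ℕ} (ht : t < a) : toArray T t = toArray R (p + t) := by
  obtain ⟨hle, h⟩ := h
  rw [toArray_of_lt T ht, toArray_of_lt R (by omega), ← h ⟨t, ht⟩]

theorem success_of_good {m σ n err w c space : ℕ} {R : Fin m → Fin σ} {mem : ℕ → ℕ}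
    (h : Sizes n m err w) (hσ : σ ≤ 2 ^ err) (hc : 1000000 ≤ c)
    (hspace : numFunctions err * 5 ≤ space)
    (hgood : ∀ p, p + 3 * n ≤ m → ∃ v b j, v < 3 ∧ b < numBlocks n m ∧ j < 1024 * err ∧
      SeedGood (2 ^ (600 * w)) (maxModulus err) (bucketSize (600 * w) n m) (2 * n) (n / 16)
        (m - 2 * n + 1) (numBlocks n m) (toArray R) (p + 2 * (n / 16) * v) (b * (n / 16 + 1))
        (seedAt mem (3 * j + v))) :
    Success (600 * w) space c n err evalCmd queryCmd R mem (numFunctions err)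
      (numBuckets n m + 1) 5 := by
  have hn1 := h.one_le
  have hn3 := h.le_m
  have herr := h.one_le_err
  have hσA : σ ≤ maxModulus err :=
    hσ.trans (Nat.pow_le_pow_right (by norm_num) (by omega))
  have hApos := Sizes.maxModulus_pos err
  have hcerr : 1000000 * err ≤ c * err := Nat.mul_le_mul_right _ hc
  have hcn : 1000000 * (n * err) ≤ c * (n * err) := Nat.mul_le_mul_right _ hc
  have hnerr : n ≤ n * err := Nat.le_mul_of_pos_right _ herr
  have herrn : err ≤ n * err := Nat.le_mul_of_pos_left _ hn1
  have hmerr : m ≤ m * err := Nat.le_mul_of_pos_right _ herr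
  have hkerr : 5 * numFunctions err + 5 < 2 ^ (600 * w) := by
    have := h.err_lt
    unfold numFunctions
    omega
  have hbuckets : ∀ (d : ℕ → ℕ) (x y : ℕ), y < numBuckets n m →
      blockFun (600 * w) n m err (toArray R) d x = y → x < numBlocks n m := by
    intro d x y hy hxy
    by_contra hcon
    rw [blockFun, if_neg hcon] at hxy
    omega
  refine ⟨by unfold numFunctions; omega, by omega, ?_, hspace,
    fun i x => ⟨blockFun (600 * w) n m err (toArray R) (block mem (i * 5) 5) x,
      blockFun_lt _ _ _ _ _ _ _⟩, fun i x => ?_, fun T inv hinv => ?_⟩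
  · refine (numBuckets_mul_le hn3).trans ?_
    calc 513 * m + 513 ≤ 1000000 * (m * err) := by omega
      _ ≤ c * (m * err) := Nat.mul_le_mul_right _ hc
  · exact Runs.mono (runs_evalCmd (M := evalMachine (600 * w) (c * err) R (block mem (i * 5) 5))
      h rfl rfl rfl rfl rfl (x := x) rfl (toArray_lt R hσA hApos)) (by omega) fun _ h => h
  · have ho : ∀ i < numFunctions err, ∀ y < numBuckets n m, ∀ x, inv i y = some x →
        blockFun (600 * w) n m err (toArray R) (block mem (i * 5) 5) x = y := by
      intro i hi y hy x hx
      have := hinv ⟨i, hi⟩ ⟨y, by omega⟩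
      simp only [hx] at this
      obtain ⟨hxN, hf⟩ := this
      exact congrArg Fin.val hf
    refine Runs.mono (runs_queryCmd (k := numFunctions err)
      (M := queryMachine (600 * w) (c * err) R (block mem 0 (numFunctions err * 5)) T inv)
      h rfl (toArray_lt R hσA hApos) (toArray_lt T hσA hApos) hkerr
      (by unfold numFunctions; omega)
      (fun i hi y hy x hx => hbuckets _ x y hy (ho i hi y hy x hx)) rfl rfl rfl rfl rfl rfl) ?_ ?_
    · have : numFunctions err * (200 * n + 1) ≤ numFunctions err * (201 * n) :=
        Nat.mul_le_mul_left _ (by omega)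
      have e : numFunctions err * (201 * n) = 617472 * (n * err) := by unfold numFunctions; ring
      omega
    · rintro s ⟨hsound, hhit, hasked, hnodup⟩
      refine ⟨hasked, hnodup, ?_⟩
      rcases hsound with h0 | ⟨h1, hcore, hle⟩
      · rw [if_pos h0]
        intro p hocc
        obtain ⟨v, b, j, hv, hb, hj, hg⟩ := hgood p hocc.1
        have hik : 3 * j + v < numFunctions err := by unfold numFunctions; omega
        have hmod : (3 * j + v) % 3 = v := by omega
        refine hhit (3 * j + v) hik ?_ h0
        unfold Hits
        rw [hmod]
        have hg' := hg.congr (d' := seedAt (block mem 0 (numFunctions err * 5)) (3 * j + v))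
          fun t ht => (seedAt_block hik ht).symm
        have hfun : ∀ x, blockFun (600 * w) n m err (toArray R)
            (block mem ((3 * j + v) * 5) 5) x = blockFun (600 * w) n m err (toArray R)
            (seedAt (block mem 0 (numFunctions err * 5)) (3 * j + v)) x :=
          blockFun_congr fun t ht => (block_eq_seedAt ht).trans (seedAt_block hik ht).symm
        have hT : ∀ t < 3 * n, toArray T t = toArray R (p + t) := fun t ht => hocc.toArray_eq ht
        have hbq := blockFun_eq_queryHash hv hT hb hg'
        set y := queryHash (600 * w) n m err (toArray T)
          (seedAt (block mem 0 (numFunctions err * 5)) (3 * j + v)) v with hy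
        have hylt : y < numBuckets n m :=
          bucketHash_lt (by have := h.numBlocks_pos; unfold numBuckets; omega)
        cases hx : inv (3 * j + v) y with
        | none =>
          -- The block `b` refutes the answer that there is no preimage.
          have := hinv ⟨3 * j + v, hik⟩ ⟨y, by omega⟩
          simp only [hx] at this
          exact absurd (Fin.ext ((hfun b).trans hbq))
            (this ⟨b, by have := hb; unfold numBuckets; omega⟩)
        | some x =>
          refine ⟨x, hx, ?_⟩
          exact coreAt_candidate h hv hocc.1 hT hg'
            ((hfun x).symm.trans (ho _ hik y hylt x hx))
      · rw [if_neg (by omega)]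
        exact occursAt_core hle hcore

/-- The text is longer than the reference, so the failure symbol is always correct, and with no
functions the bound on `N` holds with `N = 0`. -/
theorem success_of_lt {m σ n err W c space : ℕ} {R : Fin m → Fin σ} {mem : ℕ → ℕ}
    (hc : 3 ≤ c) (hn : 1 ≤ n) (herr : 1 ≤ err) (hlt : m < 3 * n) :
    Success W space c n err evalCmd queryCmd R mem 0 0 0 := by
  refine ⟨by omega, by omega, by omega, by omega, fun i => i.elim0, fun i => i.elim0,
    fun T inv _ => ?_⟩
  refine Runs.mono (runs_queryCmd_of_eq_zero rfl) ?_ ?_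
  · calc 3 ≤ c * 1 := by omega
      _ ≤ c * (n * err) := Nat.mul_le_mul_left _ (Nat.mul_pos hn herr)
  · rintro s ⟨h0, hasked⟩
    have hasked' : s.asked = [] := hasked
    rw [hasked', if_pos h0]
    refine ⟨by simp, by simp, fun i hi => ?_⟩
    have := hi.1
    omega

end CoreMatching

/-! ### Probability of success and the theorem. -/

namespace WordRAM

open scoped Classical in
theorem prob_ge {L W err : ℕ} {P : (Fin L → Fin (2 ^ W)) → Prop}
    (B : (Fin L → Fin (2 ^ W)) → Prop)
    (hB : 2 ^ err * (Finset.univ.filter B).card ≤ (2 ^ W) ^ L) (h : ∀ ω, ¬ B ω → P ω) :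
    1 - (2 : ℝ)⁻¹ ^ err ≤ prob L W P := by
  have hcard : Fintype.card (Fin L → Fin (2 ^ W)) = (2 ^ W) ^ L := by simp
  have h1 : (2 ^ W) ^ L ≤ Nat.card {ω // P ω} + (Finset.univ.filter B).card := by
    have h2 := Finset.card_filter_add_card_filter_not
      (s := (Finset.univ : Finset (Fin L → Fin (2 ^ W)))) B
    rw [Finset.card_univ, hcard] at h2
    have h3 : (Finset.univ.filter fun ω => ¬ B ω).card ≤ (Finset.univ.filter P).card :=
      Finset.card_le_card fun ω hω => by
        simp only [Finset.mem_filter, Finset.mem_univ, true_and] at hω ⊢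
        exact h ω hω
    rw [Nat.subtype_card (Finset.univ.filter P) (by simp)]
    omega
  have hK : 0 < (2 ^ W) ^ L := by positivity
  unfold prob
  rw [Nat.card_eq_fintype_card (α := Fin L → Fin (2 ^ W)), hcard]
  generalize (2 ^ W) ^ L = K at *
  generalize Nat.card {ω // P ω} = N at *
  generalize (Finset.univ.filter B).card = b at *
  rw [le_div_iff₀ (by exact_mod_cast hK), inv_pow]
  have h2 : (2 : ℝ) ^ err * b ≤ K := by exact_mod_cast hB
  have h3 : (K : ℝ) ≤ N + b := by exact_mod_cast h1
  have h4 : (b : ℝ) ≤ ((2 : ℝ) ^ err)⁻¹ * K := by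
    rw [inv_mul_eq_div, le_div_iff₀ (by positivity), mul_comm]
    exact h2
  linarith

end WordRAM

namespace CoreMatching

open WordRAM

theorem mul_le_two_pow {m σ err : ℕ} (h : 0 < m * σ)
    (hlog : Real.logb 2 ((m : ℝ) * (σ : ℝ)) ≤ (err : ℝ)) : m * σ ≤ 2 ^ err := by
  have hpos : (0 : ℝ) < (m : ℝ) * (σ : ℝ) := by exact_mod_cast h
  rw [Real.logb_le_iff_le_rpow (by norm_num) hpos, Real.rpow_natCast] at hlog
  exact_mod_cast hlog

theorem exists_seeds {m σ n err w len : ℕ} (R : Fin m → Fin σ) (h : Sizes n m err w)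
    (hσ : σ ≤ 2 ^ err) (hlen : numFunctions err * 5 ≤ len) :
    ∃ B : (Fin len → Fin (2 ^ (600 * w))) → Prop,
      (∀ [DecidablePred B],
        2 ^ err * (Finset.univ.filter B).card ≤ (2 ^ (600 * w)) ^ len) ∧
      ∀ ω mem, ¬ B ω → (∀ t < numFunctions err * 5, mem t = toArray ω t) →
        ∀ p, p + 3 * n ≤ m → ∃ v b j, v < 3 ∧ b < numBlocks n m ∧ j < 1024 * err ∧
          SeedGood (2 ^ (600 * w)) (maxModulus err) (bucketSize (600 * w) n m) (2 * n) (n / 16)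
            (m - 2 * n + 1) (numBlocks n m) (toArray R) (p + 2 * (n / 16) * v)
            (b * (n / 16 + 1)) (seedAt mem (3 * j + v)) := by
  classical
  have hX : ∀ t, toArray R t < 2 ^ err := toArray_lt R hσ (by positivity)
  have hn1 := h.one_le
  have hn3 := h.le_m
  have hm := h.m_le
  have hex : ∀ p, ∃ v b, p < m - 3 * n + 1 → v < 3 ∧ b < numBlocks n m ∧
      (2 ^ (600 * w)) ^ 5 ≤ 512 * (Finset.univ.filter (fun d : Fin 5 → Fin (2 ^ (600 * w)) =>
        SeedGood (2 ^ (600 * w)) (maxModulus err) (bucketSize (600 * w) n m) (2 * n) (n / 16)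
          (m - 2 * n + 1) (numBlocks n m) (toArray R) (p + 2 * (n / 16) * v) (b * (n / 16 + 1))
          (toArray d))).card := by
    intro p
    by_cases hp : p + 3 * n ≤ m
    · obtain ⟨v, b, hvb⟩ := card_seedGood_param_ge h hX hp
      exact ⟨v, b, fun _ => by convert hvb⟩
    · exact ⟨0, 0, fun hp' => absurd hp' (by omega)⟩
  -- Window and block are functions of the position alone, independent of the random words. The
  -- guard `p < m - 3 * n + 1` is inside the existential so that they are defined for all `p`.
  choose v b hvb using hex
  have hv : ∀ p < m - 3 * n + 1, v p < 3 := fun p hp => (hvb p hp).1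
  have hcount := card_some_never_good_le (len := len) (Q := 2 ^ (600 * w)) (err := err)
    (m := m - 3 * n + 1) (fun p d => SeedGood (2 ^ (600 * w)) (maxModulus err)
      (bucketSize (600 * w) n m) (2 * n) (n / 16) (m - 2 * n + 1) (numBlocks n m) (toArray R)
      (p + 2 * (n / 16) * v p) (b p * (n / 16 + 1)) (toArray d)) v hv
    (fun p hp => by convert (hvb p hp).2.2) (by omega) (by unfold numFunctions at hlen; omega)
  refine ⟨_, fun {_} => by convert hcount, fun ω mem hω hmem p hp => ?_⟩
  by_contra hcon
  refine hω ⟨p, by omega, fun j hg => hcon ⟨v p, b p, j, hv p (by omega), (hvb p (by omega)).2.1,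
    j.2, hg.congr fun t ht => ?_⟩⟩
  have hvp := hv p (by omega)
  have hj := j.2
  have hlt : 5 * (3 * (j : ℕ) + v p) + t < numFunctions err * 5 := by unfold numFunctions; omega
  rw [toArray_of_lt _ ht, seedAt, hmem _ hlt, toArray_of_lt ω (hlt.trans_le hlen)]

end CoreMatching

theorem mainTheorem7 :
    ∃ (build eval query : WordRAM.Cmd) (κ c : ℕ), 1 ≤ κ ∧
      ∀ (ℓ τ n m σ err w : ℕ) (R : Fin m → Fin σ),
        1 ≤ τ → n = 2 ^ ℓ * τ → 1 ≤ m → 1 ≤ err →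
        Real.logb 2 ((m : ℝ) * (σ : ℝ)) ≤ (err : ℝ) →
        err ≤ w → n ≤ 2 ^ w →
        (∀ ω : Fin (c * err ^ c) → Fin (2 ^ (κ * w)),
          WordRAM.Halts (CoreMatching.buildMachine (c * err ^ c) R ω) build
            [n, m, σ, err] (c * err ^ c) (fun _ => True)) ∧
        1 - (2 : ℝ)⁻¹ ^ err ≤
          WordRAM.prob (c * err ^ c) (κ * w) (fun ω =>
            WordRAM.Halts (CoreMatching.buildMachine (c * err ^ c) R ω) build
              [n, m, σ, err] (c * err ^ c) (fun s =>
                CoreMatching.Success (κ * w) (c * err ^ c) c n err eval query R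
                  s.mem (s.reg 0) (s.reg 1) (s.reg 2))) := by
  classical
  -- The constant is made opaque so that `err ^ c` is never computed. Its size is dictated by the
  -- query time, `3072 * err` rounds of at most `201 * n` steps.
  obtain ⟨c, hc⟩ : ∃ c, 1000000 ≤ c := ⟨_, le_rfl⟩
  refine ⟨CoreMatching.buildCmd, CoreMatching.evalCmd, CoreMatching.queryCmd, 600, c, by norm_num,
    fun ℓ τ n m σ err w R hτ hn hm herr hlog herrw hnw => ?_⟩
  have hn1 : 1 ≤ n := by rw [hn]; exact Nat.mul_pos (by positivity) hτ
  have hσ : 1 ≤ σ := (Nat.zero_le _).trans_lt (R ⟨0, hm⟩).2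
  have hmσ := CoreMatching.mul_le_two_pow (Nat.mul_pos hm hσ) hlog
  have hm' : m ≤ 2 ^ err := (Nat.le_mul_of_pos_right m hσ).trans hmσ
  have hσ' : σ ≤ 2 ^ err := (Nat.le_mul_of_pos_left σ hm).trans hmσ
  have hsize : 1000000 * err ≤ c * err ^ c :=
    Nat.mul_le_mul hc (Nat.le_self_pow (by omega) err)
  generalize c * err ^ c = L at *
  by_cases hlt : m < 3 * n
  · have hrun : ∀ ω : Fin L → Fin (2 ^ (600 * w)),
        WordRAM.Halts (CoreMatching.buildMachine L R ω) CoreMatching.buildCmd [n, m, σ, err] L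
          (fun s => CoreMatching.Success (600 * w) L c n err CoreMatching.evalCmd
            CoreMatching.queryCmd R s.mem (s.reg 0) (s.reg 1) (s.reg 2)) := fun ω => by
      refine WordRAM.Runs.mono (CoreMatching.runs_buildCmd_of_lt
        (M := CoreMatching.buildMachine L R ω) (n := n) (m := m) (herr.trans herrw)
        rfl rfl rfl hnw hlt) (by omega) ?_
      rintro s ⟨h0, h1, h2⟩
      rw [h0, h1, h2]
      exact CoreMatching.success_of_lt (by omega) hn1 herr hlt
    exact ⟨fun ω => WordRAM.Runs.mono (hrun ω) le_rfl fun _ _ => trivial,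
      WordRAM.prob_ge (fun _ => False) (by simp) fun ω _ => hrun ω⟩
  · have h : CoreMatching.Sizes n m err w := ⟨hn1, by omega, hm', herr, herrw⟩
    have hspace : CoreMatching.numFunctions err * 5 ≤ L := by
      unfold CoreMatching.numFunctions
      omega
    have hrun : ∀ ω : Fin L → Fin (2 ^ (600 * w)),
        WordRAM.Halts (CoreMatching.buildMachine L R ω) CoreMatching.buildCmd [n, m, σ, err] L
          (fun s => s.reg 0 = CoreMatching.numFunctions err ∧
            s.reg 1 = CoreMatching.numBuckets n m + 1 ∧ s.reg 2 = 5 ∧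
            ∀ t, t < CoreMatching.numFunctions err * 5 → s.mem t = CoreMatching.toArray ω t) :=
      fun ω => WordRAM.Runs.mono (CoreMatching.runs_buildCmd
        (M := CoreMatching.buildMachine L R ω) h rfl rfl rfl rfl rfl hspace)
        (by unfold CoreMatching.numFunctions; omega) fun _ h => h
    obtain ⟨B, hB, hgood⟩ := CoreMatching.exists_seeds R h hσ' hspace
    refine ⟨fun ω => WordRAM.Runs.mono (hrun ω) le_rfl fun _ _ => trivial,
      WordRAM.prob_ge B hB fun ω hω => WordRAM.Runs.mono (hrun ω) le_rfl ?_⟩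
    rintro s ⟨h0, h1, h2, hmem⟩
    rw [h0, h1, h2]
    exact CoreMatching.success_of_good h hσ' hc hspace (hgood ω s.mem hω hmem)
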